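/- **Theorem.** For $n\in\mathbb N$ let $H^n=H^{n,2}(\mathbb R)$ be the real Sobolev space of functions in $L^2(\mathbb R)$ whose weak derivatives up to order $n$ belong to $L^2(\mathbb R)$, with norm $\|u\|_{H^n}=\|(1-\partial_x^2)^{n/2}u\|_{L^2}$, i.e. $\|u\|_{H^n}^2=\sum_{k=0}^n\binom nk\|\partial_x^k u\|_{L^2}^2$. Put $X=H^1$, $Y=H^2$, and let $Q=(1-\partial_x^2)^{1/2}$ be the Fourier multiplier which is an isometric isomorphism of $H^2$ onto $H^1$. There is a constant $K>0$ such that the following holds. Let $a:H^1\to H^3$ and $b:H^1\to H^2$ be Lipschitz continuous maps with $\sup_{y\in H^1}\|a(y)\|_{H^3}<\infty$ and $\sup_{y\in H^1}\|b(y)\|_{H^2}<\infty$. For every $y\in H^1$ there is exactly one operator $\mathcal A(y)$ in $H^1$ that is the generator of a one-parameter $C_0$-group in $H^1$, contains $H^2$ in its domain, and satisfies $\mathcal A(y)u=a(y)\,\partial_xu+b(y)\,u$ for $u\in H^2$. Moreover, for every $y\in H^1$ there is a bounded operator $B(y)\in\mathcal L(H^1)$ with $$Q\mathcal A(y)Q^{-1}=\mathcal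 A(y)+B(y),\qquad \|B(y)\|_{\mathcal L(H^1)}\le K\max\bigl(\|\partial_xa(y)\|_{H^2},\|b(y)\|_{H^2}\bigr)$$ (an equality of unbounded operators in $H^1$, including their domains, where $\mathrm{Dom}(Q\mathcal A(y)Q^{-1})=\{x\in H^1:\ Q^{-1}x\in \mathrm{Dom}\,\mathcal A(y),\ \mathcal A(y)Q^{-1}x\in H^2\}$). Finally, for every $R>0$ and every $\tau>0$ the family $A(t,v):=\mathcal A(v)$, $B(t,v):=B(v)$, $t\in I=[-\tau,\tau]$, $v\in Y$, satisfies Kato's condition with radius $R$ for the densely embedded pair of Hilbert spaces $Y\subset X$, that is: 1. for all $v\in Y$, $t\in I$ the operator $-A(t,v)$ generates a $C_0$-semigroup in $X$, and there is $\beta\in\mathbb R$ such that $\|e^{-sA(t,v)}\|_{\mathcal L(X)}\le e^{\beta s}$ for all $s\ge0$, $t\in I$ and $\|v\|_Y\le R$; 2. for all $v\in Y$, $t\in I$ one has $QA(t,v)Q^{-1}=A(t,v)+B(t,v)$ with $B(t,v)\in\mathcal L(X)$, the map $I\ni t\mapsto B(t,v)\in\mathcal L(X)$ is strongly measurable, and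 $\sup_{t\in I}\sup_{\|v\|_Y\le R}\|B(t,v)\|_{\mathcal L(X)}<\infty$; 3. for all $v\in Y$, $t\in I$ one has $A(t,v)\in\mathcal L(Y,X)$, and the map $I\ni t\mapsto A(t,v)\in\mathcal L(Y,X)$ is continuous; 4. there is $\mu\in\mathbb R$ such that $\|(A(t,v_1)-A(t,v_2))u\|_X\le\mu\|v_1-v_2\|_X\|u\|_Y$ for all $t\in I$, $u\in Y$ and $\|v_1\|_Y,\|v_2\|_Y\le R$. -/

import Mathlib

open MeasureTheory Filter Topology
open scoped SchwartzMap FourierTransform InnerProductSpace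

noncomputable section

/-- The real Hilbert space `L²(ℝ)`. -/
abbrev RealL2 : Type := Lp ℝ 2 (volume : Measure ℝ)

/-- `v ∈ L²` is the weak (distributional) derivative of `u ∈ L²`. -/
def HasWeakDeriv (u v : RealL2) : Prop :=
  ∀ φ : 𝓢(ℝ, ℝ), ∫ x, u x * deriv φ x = -∫ x, v x * φ x

theorem hasWeakDeriv_iff_inner (u v : RealL2) :
    HasWeakDeriv u v ↔ ∀ φ : 𝓢(ℝ, ℝ),
      ⟪u, (SchwartzMap.derivCLM ℝ ℝ φ).toLp 2⟫_ℝ = -⟪v, φ.toLp 2⟫_ℝ := by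
  have key : ∀ (w : RealL2) (ψ : 𝓢(ℝ, ℝ)), ⟪w, ψ.toLp 2⟫_ℝ = ∫ x, w x * ψ x := by
    intro w ψ
    rw [L2.inner_def]
    refine integral_congr_ae ?_
    filter_upwards [ψ.coeFn_toLp 2] with x hx
    rw [hx]
    simp [mul_comm]
  simp only [HasWeakDeriv, key, SchwartzMap.derivCLM_apply]

theorem HasWeakDeriv.unique {u v w : RealL2} (hv : HasWeakDeriv u v) (hw : HasWeakDeriv u w) :
    v = w := by
  rw [hasWeakDeriv_iff_inner] at hv hw
  have hd : DenseRange (SchwartzMap.toLpCLM ℝ (E := ℝ) ℝ 2 volume) :=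
    SchwartzMap.denseRange_toLpCLM ENNReal.ofNat_ne_top
  rw [← sub_eq_zero]
  refine hd.eq_zero_of_inner_left ℝ (x := v - w) ?_
  intro φ
  have h1 := hv φ
  have h2 := hw φ
  rw [inner_sub_left]
  simp only [SchwartzMap.toLpCLM_apply]
  linarith

theorem HasWeakDeriv.add {u u₁ v v₁ : RealL2} (hu : HasWeakDeriv u u₁) (hv : HasWeakDeriv v v₁) :
    HasWeakDeriv (u + v) (u₁ + v₁) := by
  rw [hasWeakDeriv_iff_inner] at *
  intro φ
  rw [inner_add_left, inner_add_left, hu, hv]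
  ring

theorem HasWeakDeriv.smul {u u₁ : RealL2} (c : ℝ) (hu : HasWeakDeriv u u₁) :
    HasWeakDeriv (c • u) (c • u₁) := by
  rw [hasWeakDeriv_iff_inner] at *
  intro φ
  rw [real_inner_smul_left, real_inner_smul_left, hu]
  ring

theorem hasWeakDeriv_zero : HasWeakDeriv 0 0 := by
  rw [hasWeakDeriv_iff_inner]
  simp

open Classical in
/-- The weak derivative of `u ∈ L²`, if it exists in `L²` (and `0` otherwise). -/
def weakDeriv (u : RealL2) : RealL2 :=
  if h : ∃ v, HasWeakDeriv u v then h.choose else 0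

theorem HasWeakDeriv.weakDeriv_eq {u v : RealL2} (h : HasWeakDeriv u v) : weakDeriv u = v := by
  have h' : ∃ v, HasWeakDeriv u v := ⟨v, h⟩
  rw [weakDeriv, dif_pos h']
  exact h'.choose_spec.unique h

/-- `u ∈ L²` has `L²` weak derivatives up to order `n`. -/
def MemSobolevSpace (n : ℕ) (u : RealL2) : Prop :=
  ∀ k < n, HasWeakDeriv (weakDeriv^[k] u) (weakDeriv^[k + 1] u)

theorem MemSobolevSpace.iterate_add {n : ℕ} {u v : RealL2} (hu : MemSobolevSpace n u)
    (hv : MemSobolevSpace n v) :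
    ∀ k ≤ n, weakDeriv^[k] (u + v) = weakDeriv^[k] u + weakDeriv^[k] v
  | 0, _ => rfl
  | k + 1, hk => by
    rw [Function.iterate_succ_apply', MemSobolevSpace.iterate_add hu hv k (by omega)]
    exact ((hu k (by omega)).add (hv k (by omega))).weakDeriv_eq

theorem MemSobolevSpace.iterate_smul {n : ℕ} {u : RealL2} (c : ℝ) (hu : MemSobolevSpace n u) :
    ∀ k ≤ n, weakDeriv^[k] (c • u) = c • weakDeriv^[k] u
  | 0, _ => rfl
  | k + 1, hk => by
    rw [Function.iterate_succ_apply', MemSobolevSpace.iterate_smul c hu k (by omega)]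
    exact ((hu k (by omega)).smul c).weakDeriv_eq

theorem weakDeriv_iterate_zero (k : ℕ) : weakDeriv^[k] 0 = 0 :=
  Function.iterate_fixed hasWeakDeriv_zero.weakDeriv_eq k

/-- `Hⁿ(ℝ)` as a subspace of `L²(ℝ)`. -/
def sobolevSubmodule (n : ℕ) : Submodule ℝ RealL2 where
  carrier := {u | MemSobolevSpace n u}
  add_mem' := by
    intro u v hu hv k hk
    rw [MemSobolevSpace.iterate_add hu hv k hk.le, MemSobolevSpace.iterate_add hu hv (k + 1) hk]
    exact (hu k hk).add (hv k hk)
  zero_mem' := by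
    intro k _
    rw [weakDeriv_iterate_zero, weakDeriv_iterate_zero]
    exact hasWeakDeriv_zero
  smul_mem' := by
    intro c u hu k hk
    rw [MemSobolevSpace.iterate_smul c hu k hk.le, MemSobolevSpace.iterate_smul c hu (k + 1) hk]
    exact (hu k hk).smul c

/-- The real Sobolev space `Hⁿ(ℝ) = H^{n,2}(ℝ)`. It is a type of its own, since its norm is not
the one inherited from `L²`. -/
def SobolevSpace (n : ℕ) : Type := sobolevSubmodule n

namespace SobolevSpace

variable {n : ℕ}

instance : AddCommGroup (SobolevSpace n) := inferInstanceAs (AddCommGroup (sobolevSubmodule n))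

instance : Module ℝ (SobolevSpace n) := inferInstanceAs (Module ℝ (sobolevSubmodule n))

/-- The underlying `L²` function. -/
def toL2 : SobolevSpace n →ₗ[ℝ] RealL2 := (sobolevSubmodule n).subtype

theorem mem (u : SobolevSpace n) : MemSobolevSpace n u.toL2 := Subtype.property u

theorem toL2_injective : Function.Injective (toL2 (n := n)) := Subtype.val_injective

/-- The inner product `⟪u, v⟫ = ∑ₖ (n choose k) ∫ ∂ᵏu ∂ᵏv`, that is,
`⟪(1 - ∂²)^{n/2} u, (1 - ∂²)^{n/2} v⟫` in `L²`. -/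
@[reducible]
def innerCore (n : ℕ) : InnerProductSpace.Core ℝ (SobolevSpace n) where
  inner u v := ∑ k ∈ Finset.range (n + 1),
    (n.choose k : ℝ) * ⟪weakDeriv^[k] u.toL2, weakDeriv^[k] v.toL2⟫_ℝ
  conj_inner_symm u v := by
    simp [real_inner_comm]
  re_inner_nonneg u := by
    rw [RCLike.re_to_real]
    refine Finset.sum_nonneg fun k _ => mul_nonneg (Nat.cast_nonneg _)
      (real_inner_self_nonneg (x := weakDeriv^[k] u.toL2))
  add_left u v w := by
    rw [← Finset.sum_add_distrib]
    refine Finset.sum_congr rfl fun k hk => ?_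
    rw [map_add, u.mem.iterate_add v.mem k (by simpa [Nat.lt_succ_iff] using hk),
      inner_add_left]
    ring
  smul_left u v c := by
    rw [Finset.mul_sum]
    refine Finset.sum_congr rfl fun k hk => ?_
    rw [map_smul, u.mem.iterate_smul c k (by simpa [Nat.lt_succ_iff] using hk),
      real_inner_smul_left]
    simp only [conj_trivial]
    ring
  definite u hu := by
    have h := (Finset.sum_eq_zero_iff_of_nonneg fun k _ =>
      mul_nonneg (Nat.cast_nonneg (n.choose k))
        (real_inner_self_nonneg (x := weakDeriv^[k] u.toL2))).1 hu 0 (by simp)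
    apply toL2_injective
    simpa using h

instance : NormedAddCommGroup (SobolevSpace n) := (innerCore n).toNormedAddCommGroup

instance : InnerProductSpace ℝ (SobolevSpace n) := .ofCore (innerCore n).toCore

theorem inner_eq (u v : SobolevSpace n) : ⟪u, v⟫_ℝ = ∑ k ∈ Finset.range (n + 1),
    (n.choose k : ℝ) * ⟪weakDeriv^[k] u.toL2, weakDeriv^[k] v.toL2⟫_ℝ := rfl

theorem norm_sq_eq (u : SobolevSpace n) : ‖u‖ ^ 2 = ∑ k ∈ Finset.range (n + 1),
    (n.choose k : ℝ) * ‖weakDeriv^[k] u.toL2‖ ^ 2 := by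
  rw [← real_inner_self_eq_norm_sq, inner_eq]
  simp only [real_inner_self_eq_norm_sq]

theorem norm_iterate_le (u : SobolevSpace n) {k : ℕ} (hk : k ≤ n) :
    ‖weakDeriv^[k] u.toL2‖ ≤ ‖u‖ := by
  refine le_of_sq_le_sq ?_ (norm_nonneg _)
  rw [norm_sq_eq]
  have h1 : (1 : ℝ) ≤ n.choose k := by exact_mod_cast Nat.choose_pos hk
  calc ‖weakDeriv^[k] u.toL2‖ ^ 2 ≤ (n.choose k : ℝ) * ‖weakDeriv^[k] u.toL2‖ ^ 2 :=
        le_mul_of_one_le_left (by positivity) h1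
    _ ≤ _ := Finset.single_le_sum
        (f := fun k => (n.choose k : ℝ) * ‖weakDeriv^[k] u.toL2‖ ^ 2)
        (fun k _ => by positivity) (Finset.mem_range.2 (by omega))

theorem iterate_sub (u v : SobolevSpace n) {k : ℕ} (hk : k ≤ n) :
    weakDeriv^[k] (u - v).toL2 = weakDeriv^[k] u.toL2 - weakDeriv^[k] v.toL2 := by
  have h := (u - v).mem.iterate_add v.mem k hk
  rw [← map_add, sub_add_cancel] at h
  rw [h, add_sub_cancel_right]

instance : CompleteSpace (SobolevSpace n) := by
  refine Metric.complete_of_cauchySeq_tendsto fun u hu => ?_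
  have hc : ∀ k ≤ n, ∃ w, Tendsto (fun m => weakDeriv^[k] (u m).toL2) atTop (𝓝 w) := by
    intro k hk
    refine cauchySeq_tendsto_of_complete ?_
    rw [Metric.cauchySeq_iff'] at hu ⊢
    intro ε hε
    obtain ⟨N, hN⟩ := hu ε hε
    refine ⟨N, fun m hm => lt_of_le_of_lt ?_ (hN m hm)⟩
    rw [dist_eq_norm, dist_eq_norm, ← iterate_sub _ _ hk]
    exact norm_iterate_le _ hk
  choose! w hw using hc
  have hd : ∀ k < n, HasWeakDeriv (w k) (w (k + 1)) := by
    intro k hk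
    rw [hasWeakDeriv_iff_inner]
    intro φ
    refine tendsto_nhds_unique (((hw k hk.le).inner tendsto_const_nhds)) ?_
    have h2 := ((hw (k + 1) hk).inner (𝕜 := ℝ)
      (tendsto_const_nhds (x := φ.toLp 2))).neg
    refine h2.congr fun m => ?_
    exact ((hasWeakDeriv_iff_inner _ _).1 ((u m).mem k hk) φ).symm
  have hit : ∀ k ≤ n, weakDeriv^[k] (w 0) = w k := by
    intro k
    induction k with
    | zero => intro _; rfl
    | succ k ih =>
      intro hk
      rw [Function.iterate_succ_apply', ih (by omega)]
      exact (hd k hk).weakDeriv_eq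
  have hmem : MemSobolevSpace n (w 0) := by
    intro k hk
    rw [hit k hk.le, hit (k + 1) hk]
    exact hd k hk
  let v : SobolevSpace n := ⟨w 0, hmem⟩
  refine ⟨v, ?_⟩
  rw [tendsto_iff_norm_sub_tendsto_zero]
  have hsq : Tendsto (fun m => ‖u m - v‖ ^ 2) atTop (𝓝 0) := by
    simp only [norm_sq_eq]
    rw [show (0 : ℝ) = ∑ k ∈ Finset.range (n + 1), (n.choose k : ℝ) * 0 ^ 2 by simp]
    refine tendsto_finsetSum _ fun k hk => ?_
    have hk' : k ≤ n := by simpa [Nat.lt_succ_iff] using hk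
    refine Tendsto.const_mul _ (Tendsto.pow ?_ 2)
    simp only [iterate_sub _ _ hk']
    have hv : weakDeriv^[k] v.toL2 = w k := hit k hk'
    rw [hv]
    exact tendsto_iff_norm_sub_tendsto_zero.1 (hw k hk')
  have := hsq.sqrt
  simpa [Real.sqrt_sq (norm_nonneg _)] using this

/-- The embedding `H^{n+1} ⊂ Hⁿ`. -/
def incl : SobolevSpace (n + 1) →L[ℝ] SobolevSpace n :=
  LinearMap.mkContinuous
    (Submodule.inclusion (p := sobolevSubmodule (n + 1)) (p' := sobolevSubmodule n)
      fun _ hu k hk => hu k (Nat.lt_succ_of_lt hk) :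
        SobolevSpace (n + 1) →ₗ[ℝ] SobolevSpace n) 1 <| by
    intro u
    rw [one_mul]
    refine le_of_sq_le_sq ?_ (norm_nonneg _)
    rw [norm_sq_eq, norm_sq_eq, Finset.sum_range_succ _ (n + 1)]
    refine le_add_of_le_of_nonneg (Finset.sum_le_sum fun k _ => ?_) (by positivity)
    refine mul_le_mul_of_nonneg_right ?_ (by positivity)
    exact_mod_cast Nat.choose_le_choose k (Nat.le_succ n)

/-- The derivative `∂ₓ : H^{n+1} → Hⁿ`. -/
def deriv (u : SobolevSpace (n + 1)) : SobolevSpace n :=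
  ⟨weakDeriv u.toL2, fun k hk => u.mem (k + 1) (Nat.succ_lt_succ hk)⟩

/-- The Fourier transform of `u ∈ Hⁿ` (normalized with the kernel `e^{-2πixξ}`). -/
def fourier (u : SobolevSpace n) : Lp ℂ 2 (volume : Measure ℝ) :=
  𝓕 (Complex.ofRealCLM.compLp u.toL2)

end SobolevSpace

/-- `Q = (1 - ∂ₓ²)^{1/2}` on `H^{n+1}`: the Fourier multiplier with symbol
`(1 + (2πξ)²)^{1/2}`. -/
def IsSqrtOneSubDerivSq {n : ℕ} (Q : SobolevSpace (n + 1) → SobolevSpace n) : Prop :=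
  ∀ u, (Q u).fourier =ᵐ[volume]
    fun ξ : ℝ => (Real.sqrt (1 + (2 * Real.pi * ξ) ^ 2) : ℂ) * u.fourier ξ

section Semigroups

variable {X : Type*} [NormedAddCommGroup X] [NormedSpace ℝ X]

/-- `S s`, `s ≥ 0`, is a `C₀`-semigroup of bounded operators on `X`. -/
structure IsC0Semigroup (S : ℝ → X →L[ℝ] X) : Prop where
  zero : S 0 = ContinuousLinearMap.id ℝ X
  add : ∀ s t, 0 ≤ s → 0 ≤ t → S (s + t) = (S s).comp (S t)
  continuousOn : ∀ x, ContinuousOn (fun s => S s x) (Set.Ici 0)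

/-- `G` is the generator of the semigroup `S`: `G x = lim_{s → 0+} (S s x - x) / s`, with the
domain consisting of all `x` for which the limit exists. -/
def IsGeneratorOfSemigroup (G : X →ₗ.[ℝ] X) (S : ℝ → X →L[ℝ] X) : Prop :=
  ∀ x z, (x, z) ∈ G.graph ↔ Tendsto (fun s : ℝ => s⁻¹ • (S s x - x)) (𝓝[>] 0) (𝓝 z)

/-- `U t`, `t ∈ ℝ`, is a one-parameter `C₀`-group of bounded operators on `X`. -/
structure IsC0Group (U : ℝ → X →L[ℝ] X) : Prop where
  zero : U 0 = ContinuousLinearMap.id ℝ X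
  add : ∀ s t, U (s + t) = (U s).comp (U t)
  continuous : ∀ x, Continuous fun t => U t x

/-- `G` is the generator of the one-parameter group `U`. -/
def IsGeneratorOfGroup (G : X →ₗ.[ℝ] X) (U : ℝ → X →L[ℝ] X) : Prop :=
  ∀ x z, (x, z) ∈ G.graph ↔ Tendsto (fun t : ℝ => t⁻¹ • (U t x - x)) (𝓝[≠] 0) (𝓝 z)

end Semigroups

section Kato

variable {X Y : Type*} [NormedAddCommGroup X] [InnerProductSpace ℝ X] [CompleteSpace X]
  [NormedAddCommGroup Y] [InnerProductSpace ℝ Y] [CompleteSpace Y]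

/-- The equality `Q A Q⁻¹ = A + B` of unbounded operators in `X`, including equality of the
domains, where `Y ⊂ X` through `ι`. The domain of `Q A Q⁻¹` consists of all `x ∈ X` with
`Q⁻¹ x ∈ Dom A` and `A Q⁻¹ x ∈ Y`. -/
def ConjugationIdentity (ι : Y →L[ℝ] X) (Q : Y ≃L[ℝ] X) (A : X →ₗ.[ℝ] X) (B : X →L[ℝ] X) : Prop :=
  ∀ x z, (∃ w : Y, (ι (Q.symm x), ι w) ∈ A.graph ∧ Q w = z) ↔
    ∃ g, (x, g) ∈ A.graph ∧ g + B x = z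

/-- Kato's condition, with radius `R`, for the operators `A t v`, `t ∈ I`, `v ∈ Y`, in `X`,
where the Hilbert space `Y` is densely embedded into the Hilbert space `X` through `ι`,
with the isomorphism `Q : Y → X` and the bounded operators `B t v`. -/
structure KatoCondition (ι : Y →L[ℝ] X) (I : Set ℝ) (R : ℝ) (A : ℝ → Y → X →ₗ.[ℝ] X)
    (Q : Y ≃L[ℝ] X) (B : ℝ → Y → X →L[ℝ] X) : Prop where
  injective : Function.Injective ι
  denseRange : DenseRange ι
  /-- `-A t v` generates a `C₀`-semigroup, with `‖e^{-s A t v}‖ ≤ e^{β s}` for `‖v‖ ≤ R`. -/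
  generates : ∃ S : ℝ → Y → ℝ → X →L[ℝ] X,
    (∀ t ∈ I, ∀ v, IsC0Semigroup (S t v) ∧ IsGeneratorOfSemigroup (-A t v) (S t v)) ∧
    ∃ β : ℝ, ∀ t ∈ I, ∀ v, ‖v‖ ≤ R → ∀ s, 0 ≤ s → ‖S t v s‖ ≤ Real.exp (β * s)
  conjugation : ∀ t ∈ I, ∀ v, ConjugationIdentity ι Q (A t v) (B t v)
  stronglyMeasurable : ∀ v, StronglyMeasurable fun t : I => B t v
  bounded : ∃ lam : ℝ, ∀ t ∈ I, ∀ v, ‖v‖ ≤ R → ‖B t v‖ ≤ lam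
  /-- `A t v` restricts to a bounded operator from `Y` to `X`, continuous in `t`. -/
  continuous : ∀ v, ∃ A' : ℝ → Y →L[ℝ] X,
    (∀ t ∈ I, ∀ u, (ι u, A' t u) ∈ (A t v).graph) ∧ ContinuousOn A' I
  /-- `‖(A t v₁ - A t v₂) u‖_X ≤ μ ‖v₁ - v₂‖_X ‖u‖_Y`. -/
  lipschitz : ∃ μ : ℝ, ∀ t ∈ I, ∀ u v₁ v₂ : Y, ‖v₁‖ ≤ R → ‖v₂‖ ≤ R →
    ∀ f₁ f₂ : X, (ι u, f₁) ∈ (A t v₁).graph → (ι u, f₂) ∈ (A t v₂).graph →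
      ‖f₁ - f₂‖ ≤ μ * ‖ι v₁ - ι v₂‖ * ‖u‖

end Kato

/-- `G` is an operator in `H¹` that generates a one-parameter `C₀`-group, contains `H²` in its
domain and coincides there with the differential operator `a ∂ₓ + b`. -/
def IsFirstOrderGenerator (a : SobolevSpace 3) (b : SobolevSpace 2)
    (G : SobolevSpace 1 →ₗ.[ℝ] SobolevSpace 1) : Prop :=
  (∃ U : ℝ → SobolevSpace 1 →L[ℝ] SobolevSpace 1, IsC0Group U ∧ IsGeneratorOfGroup G U) ∧
  ∀ u : SobolevSpace 2, ∃ f : SobolevSpace 1, (SobolevSpace.incl u, f) ∈ G.graph ∧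
    f.toL2 =ᵐ[volume] fun x : ℝ => a.toL2 x * u.deriv.toL2 x + b.toL2 x * u.toL2 x

end

/-! Write `P = Q⁻¹ = (1 - ∂ₓ²)^{-1/2}` and let `T = a ∂ₓ + b`, an operator from `H²` to `H¹`.
Everything rests on two facts about `T`. The energy estimate `|⟪T u, u⟫| ≤ β ‖u‖²` in `H¹`, with `β
= 2‖a‖ + 3‖b‖`, follows by integrating by parts (`abs_inner_firstOrder_le`). The commutation
relation `T P u = P (T u + B u)` for `u ∈ H²`, with `B` bounded in `H¹`, says that `[Q, T] Q⁻¹` has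
order zero (`exists_conjugation_firstOrder`).

Generation. The estimate bounds `r - T` from below for large real `|r|` of either sign. The
commutation relation makes its range dense: `J = P (1 + P)⁻¹` acts as a Friedrichs mollifier whose
commutator with `T` is controlled by `B` (`eq_zero_of_orthogonal_range`). Hence all real `r` with
large `|r|` lie in the resolvent set of the closure of `T`. A Yosida approximation using `r` and
`-r` together gives commuting bounded operators whose symmetric parts are uniformly bounded; their
exponentials converge to a group with `‖U t‖ ≤ exp (2β|t|)`.

Uniqueness. A group generator `G` that extends `T` is closed, so it extends the closure of `T`. For
large `r` the operator `r - G` is injective, while `r` minus the closure is already onto, so the two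
coincide. This identification of every admissible `G` with the closure is used throughout.

Conjugation. The relation passes from `H²` to the closure. Equality of domains comes from solving
`(r - G - B) g = f` by a Neumann series for large `r`.

The operator `B`. Because `P` commutes with `∂ₓ`, it is enough to bound `[Q, c]` in `H¹` for
multiplication by `c ∈ H²`. As `Q = P (1 - ∂ₓ²)`, the Leibniz rule reduces this to `[c, P] = P C P`
with `C` bounded in `L²`. On the Fourier side this is the inequality `|p(t) - p(s)| ≤ 2π |t - s|
p(t) p(s)` for the symbol `p` of `P`, together with the integrability of the Fourier transform of
`c'`. Only derivatives of `a` and `b` enter, which gives the bound with `K = 2 (3 +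
besselSymbolNorm)`. -/

noncomputable section

/-! ### Generators of one-parameter groups -/

section GroupGenerators

variable {X : Type*} [NormedAddCommGroup X] [NormedSpace ℝ X]

/-- `z` is the derivative at `0` of the orbit of `x` under the group `U`. -/
def IsOrbitDeriv (U : ℝ → X →L[ℝ] X) (x z : X) : Prop :=
  Tendsto (fun t : ℝ => t⁻¹ • (U t x - x)) (𝓝[≠] 0) (𝓝 z)

theorem isOrbitDeriv_iff_hasDerivAt {U : ℝ → X →L[ℝ] X} (hU : U 0 = ContinuousLinearMap.id ℝ X)
    (x z : X) : IsOrbitDeriv U x z ↔ HasDerivAt (fun t => U t x) z 0 := by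
  rw [hasDerivAt_iff_tendsto_slope, IsOrbitDeriv]
  have : slope (fun t => U t x) 0 = fun t : ℝ => t⁻¹ • (U t x - x) := by
    ext t
    simp [slope_def_module, hU]
  rw [this]

theorem IsOrbitDeriv.sub {U : ℝ → X →L[ℝ] X} {x z x' z' : X} (h : IsOrbitDeriv U x z)
    (h' : IsOrbitDeriv U x' z') : IsOrbitDeriv U (x - x') (z - z') := by
  refine (Tendsto.sub h h').congr fun t => ?_
  rw [← smul_sub, map_sub]
  congr 1
  abel

theorem IsC0Group.hasDerivAt {U : ℝ → X →L[ℝ] X} (hU : IsC0Group U) {x z : X}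
    (h : IsOrbitDeriv U x z) (t : ℝ) : HasDerivAt (fun s => U s x) (U t z) t := by
  rw [isOrbitDeriv_iff_hasDerivAt hU.zero] at h
  have h1 : HasDerivAt (fun s => U t (U (s - t) x)) (U t z) t := by
    have h0 : HasDerivAt (fun s => U (s - t) x) z t := by
      have h2 : HasDerivAt (fun s => U s x) z (t - t) := by simpa using h
      exact HasDerivAt.comp_sub_const t t h2
    exact (U t).hasFDerivAt.comp_hasDerivAt t h0
  refine h1.congr_of_eventuallyEq (Eventually.of_forall fun s => ?_)
  have := hU.add t (s - t)
  rw [add_sub_cancel] at this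
  simp [this]

/-- The integrated form contains no limit of difference quotients. It is therefore stable under
limits in `(x, z)` and under limits of approximating groups. -/
theorem IsC0Group.isOrbitDeriv_iff_integral [CompleteSpace X] {U : ℝ → X →L[ℝ] X}
    (hU : IsC0Group U) (x z : X) :
    IsOrbitDeriv U x z ↔ ∀ t, U t x - x = ∫ s in (0 : ℝ)..t, U s z := by
  constructor
  · intro h t
    rw [intervalIntegral.integral_eq_sub_of_hasDerivAt (fun s _ => hU.hasDerivAt h s)
      ((hU.continuous z).intervalIntegrable _ _)]
    simp [hU.zero]
  · intro h
    rw [isOrbitDeriv_iff_hasDerivAt hU.zero]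
    have h1 : HasDerivAt (fun t => x + ∫ s in (0 : ℝ)..t, U s z) (U 0 z) 0 :=
      (intervalIntegral.integral_hasDerivAt_right
        ((hU.continuous z).intervalIntegrable _ _)
        ((hU.continuous z).stronglyMeasurableAtFilter _ _)
        (hU.continuous z).continuousAt).const_add x
    rw [hU.zero] at h1
    refine h1.congr_of_eventuallyEq (Eventually.of_forall fun t => ?_)
    simp [← h t]

theorem IsC0Group.exists_bound [CompleteSpace X] {U : ℝ → X →L[ℝ] X} (hU : IsC0Group U) (T : ℝ) :
    ∃ M, ∀ s ∈ Set.uIcc 0 T, ‖U s‖ ≤ M := by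
  obtain ⟨M, hM⟩ := banach_steinhaus (g := fun s : Set.uIcc (0 : ℝ) T => U s) (fun x => by
    obtain ⟨C, hC⟩ := (isCompact_uIcc (a := (0 : ℝ)) (b := T)).exists_bound_of_continuousOn
      (hU.continuous x).continuousOn
    exact ⟨C, fun s => hC s s.2⟩)
  exact ⟨M, fun s hs => hM ⟨s, hs⟩⟩

/-- The generator of a `C₀`-group is closed. -/
theorem IsC0Group.isClosed_setOf_isOrbitDeriv [CompleteSpace X] {U : ℝ → X →L[ℝ] X}
    (hU : IsC0Group U) : IsClosed {p : X × X | IsOrbitDeriv U p.1 p.2} := by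
  simp only [hU.isOrbitDeriv_iff_integral, Set.ofPred_forall]
  refine isClosed_iInter fun t => ?_
  refine isClosed_eq (by fun_prop) ?_
  obtain ⟨M, hM⟩ := hU.exists_bound t
  -- Uniform boundedness of `U` on compact intervals makes the integral Lipschitz in `z`, so each
  -- integrated identity is a closed condition.
  have hlip : LipschitzWith (Real.toNNReal (M * |t - 0|)) fun z => ∫ s in (0 : ℝ)..t, U s z := by
    refine LipschitzWith.of_dist_le_mul fun z w => ?_
    rw [dist_eq_norm, dist_eq_norm,
      ← intervalIntegral.integral_sub ((hU.continuous z).intervalIntegrable _ _)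
      ((hU.continuous w).intervalIntegrable _ _)]
    have hM0 : 0 ≤ M := (norm_nonneg _).trans (hM 0 (by simp))
    rw [Real.coe_toNNReal _ (by positivity)]
    refine (intervalIntegral.norm_integral_le_of_norm_le_const (C := M * ‖z - w‖)
      fun s hs => ?_).trans (by nlinarith [le_refl (M * ‖z - w‖ * |t - 0|)])
    rw [← map_sub]
    exact (U s).le_of_opNorm_le (hM s (Set.uIoc_subset_uIcc hs)) _
  exact hlip.continuous.comp continuous_snd

/-- A generator has no real eigenvalue above the logarithm of the norm of `U 1`. -/
theorem IsC0Group.eq_zero_of_isOrbitDeriv_smul {U : ℝ → X →L[ℝ] X} (hU : IsC0Group U) {r : ℝ}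
    (hr : ‖U 1‖ < Real.exp r) {y : X} (hy : IsOrbitDeriv U y (r • y)) : y = 0 := by
  -- The function `e^{-rs} U s y` is constant; comparing `s = 1` with `s = 0` gives `‖y‖ ≤ e^{-r} ‖U
  -- 1‖ ‖y‖`.
  have hd : ∀ t, HasDerivAt (fun s => Real.exp (-(r * s)) • U s y) 0 t := by
    intro t
    have h1 : HasDerivAt (fun s => Real.exp (-(r * s))) (Real.exp (-(r * t)) * -(r * 1)) t :=
      (((hasDerivAt_id t).const_mul r).neg).exp
    refine (h1.smul (hU.hasDerivAt hy t)).congr_deriv ?_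
    rw [map_smul, smul_smul, ← add_smul]
    simp
  have hc := is_const_of_deriv_eq_zero (fun t => (hd t).differentiableAt)
    (fun t => (hd t).deriv) 1 0
  simp only [mul_one, mul_zero, neg_zero, Real.exp_zero, one_smul, hU.zero,
    ContinuousLinearMap.id_apply] at hc
  by_contra hne
  have h2 : ‖y‖ ≤ Real.exp (-r) * (‖U 1‖ * ‖y‖) := by
    calc ‖y‖ = Real.exp (-r) * ‖U 1 y‖ := by
          conv_lhs => rw [← hc]
          rw [norm_smul, Real.norm_of_nonneg (Real.exp_pos _).le]
      _ ≤ _ := by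
          gcongr
          exact (U 1).le_opNorm y
  have h3 : 0 < ‖y‖ := norm_pos_iff.2 hne
  have h4 : Real.exp (-r) * (‖U 1‖ * ‖y‖) < Real.exp (-r) * (Real.exp r * ‖y‖) := by gcongr
  rw [← mul_assoc (Real.exp (-r)) (Real.exp r), ← Real.exp_add, neg_add_cancel, Real.exp_zero,
    one_mul] at h4
  linarith

end GroupGenerators

/-! ### Exponentials of bounded operators with bounded symmetric part -/

section Exponential

variable {X : Type*} [NormedAddCommGroup X] [InnerProductSpace ℝ X] [CompleteSpace X]

theorem hasDerivAt_exp_smul_apply (C : X →L[ℝ] X) (x : X) (t : ℝ) :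
    HasDerivAt (fun s : ℝ => NormedSpace.exp (s • C) x) (C (NormedSpace.exp (t • C) x)) t := by
  have h := (hasDerivAt_exp_smul_const' (𝕂 := ℝ) C t).clm_apply (hasDerivAt_const t x)
  simpa using h

/-- Along `u s = exp (s C) x` the derivative of `‖u s‖²` is `2⟪C u, u⟫ ≤ 2ω‖u‖²`, so `e^{-2ωs}‖u
s‖²` decreases. The bound involves the symmetric part of `C` only, not `‖C‖`. -/
theorem norm_exp_smul_apply_le_of_nonneg {C : X →L[ℝ] X} {ω : ℝ}
    (hC : ∀ x, ⟪C x, x⟫_ℝ ≤ ω * ‖x‖ ^ 2) {t : ℝ} (ht : 0 ≤ t) (x : X) :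
    ‖NormedSpace.exp (t • C) x‖ ≤ Real.exp (ω * t) * ‖x‖ := by
  set u : ℝ → X := fun s => NormedSpace.exp (s • C) x with hu
  have hd : ∀ s, HasDerivAt (fun s => Real.exp (-(2 * ω * s)) * ‖u s‖ ^ 2)
      (Real.exp (-(2 * ω * s)) * -(2 * ω * 1) * ‖u s‖ ^ 2 +
        Real.exp (-(2 * ω * s)) * (2 * ⟪u s, C (u s)⟫_ℝ)) s := by
    intro s
    have h1 : HasDerivAt (fun s => Real.exp (-(2 * ω * s)))
        (Real.exp (-(2 * ω * s)) * -(2 * ω * 1)) s :=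
      (((hasDerivAt_id s).const_mul (2 * ω)).neg).exp
    exact h1.mul (hasDerivAt_exp_smul_apply C x s).norm_sq
  have hanti : Antitone fun s => Real.exp (-(2 * ω * s)) * ‖u s‖ ^ 2 := by
    refine antitone_of_deriv_nonpos (fun s => (hd s).differentiableAt) fun s => ?_
    rw [(hd s).deriv, real_inner_comm]
    nlinarith [hC (u s), Real.exp_pos (-(2 * ω * s))]
  have h := hanti ht
  simp only [mul_zero, neg_zero, Real.exp_zero, one_mul] at h
  have h0 : u 0 = x := by simp [hu]
  rw [h0] at h
  refine le_of_sq_le_sq ?_ (by positivity)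
  rw [mul_pow, ← Real.exp_nat_mul]
  have h2 : ‖u t‖ ^ 2 = Real.exp (2 * ω * t) * (Real.exp (-(2 * ω * t)) * ‖u t‖ ^ 2) := by
    rw [← mul_assoc, ← Real.exp_add]
    simp
  rw [h2, show ((2 : ℕ) : ℝ) * (ω * t) = 2 * ω * t by push_cast; ring]
  gcongr

theorem norm_exp_smul_le {C : X →L[ℝ] X} {ω : ℝ}
    (hC : ∀ x, |⟪C x, x⟫_ℝ| ≤ ω * ‖x‖ ^ 2) (t : ℝ) :
    ‖NormedSpace.exp (t • C)‖ ≤ Real.exp (ω * |t|) := by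
  refine ContinuousLinearMap.opNorm_le_bound _ (Real.exp_pos _).le fun x => ?_
  rcases le_total 0 t with ht | ht
  · rw [abs_of_nonneg ht]
    exact norm_exp_smul_apply_le_of_nonneg (fun x => (le_abs_self _).trans (hC x)) ht x
  · rw [abs_of_nonpos ht]
    have h := norm_exp_smul_apply_le_of_nonneg (C := -C) (ω := ω)
      (fun x => by
        rw [neg_apply, inner_neg_left]
        exact (neg_le_abs _).trans (hC x)) (neg_nonneg.2 ht) x
    rwa [smul_neg, neg_smul, neg_neg] at h

theorem exp_add_smul (C : X →L[ℝ] X) (s t : ℝ) :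
    NormedSpace.exp ((s + t) • C) = NormedSpace.exp (s • C) * NormedSpace.exp (t • C) := by
  let _ : NormedAlgebra ℚ (X →L[ℝ] X) := NormedAlgebra.restrictScalars ℚ ℝ _
  rw [add_smul]
  exact NormedSpace.exp_add_of_commute (((Commute.refl C).smul_left s).smul_right t)

/-- Interpolate by `exp (stC) exp ((1 - s)tD) x`, `s ∈ [0, 1]`. Commutativity lets its derivative be
written as this product applied to `t (C x - D x)`, and the two factors together have norm at most
`e^{ω|t|}`. -/
theorem norm_exp_smul_sub_exp_smul_apply_le {C D : X →L[ℝ] X} (hCD : Commute C D) {ω : ℝ}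
    (hC : ∀ x, |⟪C x, x⟫_ℝ| ≤ ω * ‖x‖ ^ 2) (hD : ∀ x, |⟪D x, x⟫_ℝ| ≤ ω * ‖x‖ ^ 2)
    (t : ℝ) (x : X) :
    ‖NormedSpace.exp (t • C) x - NormedSpace.exp (t • D) x‖ ≤
      Real.exp (ω * |t|) * (|t| * ‖C x - D x‖) := by
  let _ : NormedAlgebra ℚ (X →L[ℝ] X) := NormedAlgebra.restrictScalars ℚ ℝ _
  have hexp : ∀ s : ℝ, NormedSpace.exp (s • (t • (C - D)) + t • D) =
      NormedSpace.exp ((s * t) • C) * NormedSpace.exp (((1 - s) * t) • D) := by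
    intro s
    rw [← NormedSpace.exp_add_of_commute ((hCD.smul_left _).smul_right _)]
    congr 1
    module
  have hcomm : ∀ s : ℝ, Commute (s • (t • (C - D))) (t • D) := fun s =>
    (((hCD.sub_left (Commute.refl D)).smul_left t).smul_left s).smul_right t
  have hd : ∀ s : ℝ, HasDerivAt (fun s : ℝ => NormedSpace.exp (s • (t • (C - D)))
      (NormedSpace.exp (t • D) x))
      ((NormedSpace.exp (s • (t • (C - D)) + t • D)) (t • (C x - D x))) s := by
    intro s
    have h := (hasDerivAt_exp_smul_const (𝕂 := ℝ) (t • (C - D)) s).clm_apply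
      (hasDerivAt_const s (NormedSpace.exp (t • D) x))
    convert h using 1
    have h2 : Commute (t • (C - D)) (NormedSpace.exp (t • D)) := by
      have := hcomm 1
      rw [one_smul] at this
      exact this.exp_right
    rw [NormedSpace.exp_add_of_commute (hcomm s)]
    have h3 := congrArg (fun L : X →L[ℝ] X => L x) h2.eq
    simp only [mul_apply_eq_comp, smul_apply, sub_apply] at h3
    simp only [mul_apply_eq_comp, smul_apply, sub_apply, map_zero, add_zero, h3]
  have h := norm_image_sub_le_of_norm_deriv_le_segment_01'
    (C := Real.exp (ω * |t|) * (|t| * ‖C x - D x‖))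
    (fun s _ => (hd s).hasDerivWithinAt) (fun s hs => by
      rw [hexp]
      refine (ContinuousLinearMap.le_opNorm _ _).trans ?_
      rw [norm_smul, Real.norm_eq_abs]
      gcongr
      refine (norm_mul_le _ _).trans ?_
      have h1 := norm_exp_smul_le hC (s * t)
      have h2 := norm_exp_smul_le hD ((1 - s) * t)
      calc _ ≤ Real.exp (ω * |s * t|) * Real.exp (ω * |(1 - s) * t|) := by gcongr
        _ = Real.exp (ω * |t|) := by
          rw [← Real.exp_add, abs_mul, abs_mul, abs_of_nonneg hs.1,
            abs_of_nonneg (by linarith [hs.2] : 0 ≤ 1 - s)]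
          ring_nf)
  have e1 : NormedSpace.exp ((1 : ℝ) • (t • (C - D))) (NormedSpace.exp (t • D) x) =
      NormedSpace.exp (t • C) x := by
    rw [← mul_apply_eq_comp, ← NormedSpace.exp_add_of_commute (hcomm 1), hexp 1]
    simp
  rw [e1] at h
  simpa using h

end Exponential

/-! ### Quasi-skew-adjoint operators and their resolvents -/

section QuasiSkew

variable {X : Type*} [NormedAddCommGroup X] [InnerProductSpace ℝ X]

/-- The graph `Γ` of a densely defined operator in `X` whose symmetric part is bounded by `β` and
which has all real numbers of modulus greater than `r₀` in its resolvent set. -/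
structure IsQuasiSkewAdjoint (Γ : Submodule ℝ (X × X)) (β r₀ : ℝ) : Prop where
  nonneg : 0 ≤ β
  le : 4 * β ≤ r₀
  form_le : ∀ p ∈ Γ, |⟪p.2, p.1⟫_ℝ| ≤ β * ‖p.1‖ ^ 2
  dense : Dense (Prod.fst '' (Γ : Set (X × X)))
  surjective : ∀ r : ℝ, r₀ < |r| → ∀ y, ∃ p ∈ Γ, r • p.1 - p.2 = y

/-- Pair `r • p.1 - p.2` with `p.1` and apply Cauchy–Schwarz. The two-sided form bound allows either
sign of `r`. -/
theorem norm_fst_le_of_form_le {β : ℝ} {p : X × X} (h : |⟪p.2, p.1⟫_ℝ| ≤ β * ‖p.1‖ ^ 2) (r : ℝ) :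
    (|r| - β) * ‖p.1‖ ≤ ‖r • p.1 - p.2‖ := by
  rcases eq_or_ne p.1 0 with h0 | h0
  · simp [h0]
  have hp : 0 < ‖p.1‖ := norm_pos_iff.2 h0
  have h1 : |r| * ‖p.1‖ ^ 2 ≤ |⟪r • p.1 - p.2, p.1⟫_ℝ| + |⟪p.2, p.1⟫_ℝ| := by
    have : r * ‖p.1‖ ^ 2 = ⟪r • p.1 - p.2, p.1⟫_ℝ + ⟪p.2, p.1⟫_ℝ := by
      rw [inner_sub_left, real_inner_smul_left, real_inner_self_eq_norm_sq]
      ring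
    calc |r| * ‖p.1‖ ^ 2 = |r * ‖p.1‖ ^ 2| := by
          rw [abs_mul, abs_of_nonneg (sq_nonneg ‖p.1‖)]
      _ ≤ _ := by
          rw [this]
          exact abs_add_le _ _
  have h2 := abs_real_inner_le_norm (r • p.1 - p.2) p.1
  refine le_of_mul_le_mul_right ?_ hp
  nlinarith

namespace IsQuasiSkewAdjoint

variable {Γ : Submodule ℝ (X × X)} {β r₀ : ℝ}

theorem eq_zero_of_smul (h : IsQuasiSkewAdjoint Γ β r₀) {r : ℝ} (hr : r₀ < |r|) {p : X × X}
    (hp : p ∈ Γ) (h0 : r • p.1 - p.2 = 0) : p = 0 := by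
  have h1 := norm_fst_le_of_form_le (h.form_le p hp) r
  rw [h0, norm_zero] at h1
  have h2 : 0 < |r| - β := by linarith [h.le, h.nonneg]
  have h3 : p.1 = 0 := by
    rw [← norm_le_zero_iff]
    by_contra! h4
    linarith [mul_pos h2 h4]
  rw [h3, smul_zero, zero_sub, neg_eq_zero] at h0
  exact Prod.ext h3 h0

theorem exists_resolvent (h : IsQuasiSkewAdjoint Γ β r₀) {r : ℝ} (hr : r₀ < |r|) :
    ∃ R : X →L[ℝ] X, (∀ y, (R y, r • R y - y) ∈ Γ) ∧ (∀ p ∈ Γ, R (r • p.1 - p.2) = p.1) ∧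
      ∀ y, (|r| - β) * ‖R y‖ ≤ ‖y‖ := by
  choose f hf hfr using h.surjective r hr
  have huniq : ∀ p ∈ Γ, f (r • p.1 - p.2) = p := by
    intro p hp
    have h1 := Γ.sub_mem (hf (r • p.1 - p.2)) hp
    refine sub_eq_zero.1 (h.eq_zero_of_smul hr h1 ?_)
    rw [Prod.fst_sub, Prod.snd_sub, smul_sub, sub_sub_sub_comm, hfr, sub_self]
  have h2 : 0 < |r| - β := by linarith [h.le, h.nonneg]
  have hbound : ∀ y, (|r| - β) * ‖(f y).1‖ ≤ ‖y‖ := by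
    intro y
    have := norm_fst_le_of_form_le (h.form_le (f y) (hf y)) r
    rwa [hfr] at this
  let L : X →ₗ[ℝ] X :=
    { toFun := fun y => (f y).1
      map_add' := fun y z => by
        have h1 := huniq _ (Γ.add_mem (hf y) (hf z))
        rw [Prod.fst_add, Prod.snd_add, smul_add, add_sub_add_comm, hfr, hfr] at h1
        rw [h1, Prod.fst_add]
      map_smul' := fun c y => by
        have h1 := huniq _ (Γ.smul_mem c (hf y))
        rw [Prod.smul_fst, Prod.smul_snd, smul_comm, ← smul_sub, hfr] at h1
        rw [h1, Prod.smul_fst, RingHom.id_apply] }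
  refine ⟨L.mkContinuous (|r| - β)⁻¹ fun y => ?_, fun y => ?_, fun p hp => ?_, hbound⟩
  · rw [← div_eq_inv_mul, le_div_iff₀' h2]
    exact hbound y
  · have h1 : r • (f y).1 - y = (f y).2 := by
      conv_lhs => rw [← hfr y]
      rw [hfr y]
      nth_rewrite 2 [← hfr y]
      abel
    change ((f y).1, r • (f y).1 - y) ∈ Γ
    rw [h1]
    exact hf y
  · change (f (r • p.1 - p.2)).1 = p.1
    rw [huniq p hp]

/-- The symmetric part of the two-sided Yosida approximation is bounded. -/
theorem yosida_form_le (h : IsQuasiSkewAdjoint Γ β r₀) {r : ℝ} (hr : r₀ < r) {x y z : X}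
    (hy : (y, z) ∈ Γ) (hz : (z, r ^ 2 • (y - x)) ∈ Γ) : |⟪z, x⟫_ℝ| ≤ 2 * β * ‖x‖ ^ 2 := by
  have hr0 : 0 < r := by linarith [h.le, h.nonneg]
  -- Writing `G` for the operator with graph `Γ`, the hypotheses say `G y = z = r v` and `G v = -r
  -- w`. Hence `⟪z, x⟫ = r⟪v, y⟫ + r⟪v, w⟫ = ⟪G y, y⟫ - ⟪G v, v⟫`.
  set w : X := x - y with hw
  set v : X := r⁻¹ • z with hv
  have hzv : z = r • v := by rw [hv, smul_inv_smul₀ hr0.ne']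
  have hvw : (v, -(r • w)) ∈ Γ := by
    have := Γ.smul_mem r⁻¹ hz
    rw [Prod.smul_mk, smul_smul] at this
    convert this using 2
    rw [hw, ← neg_sub y x, smul_neg, neg_neg]
    congr 1
    field_simp
  have h1 := h.form_le _ hy
  have h2 := h.form_le _ hvw
  have h3 := h.form_le _ (Γ.add_mem hy hvw)
  have h4 := h.form_le _ (Γ.sub_mem hy hvw)
  have hx : x = y + w := by rw [hw]; abel
  simp only [Prod.mk_add_mk, Prod.mk_sub_mk, hzv] at h1 h2 h3 h4 ⊢
  have e1 : ‖y + v‖ ^ 2 = ‖y‖ ^ 2 + 2 * ⟪y, v⟫_ℝ + ‖v‖ ^ 2 := norm_add_sq_real y v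
  have e2 : ‖y - v‖ ^ 2 = ‖y‖ ^ 2 - 2 * ⟪y, v⟫_ℝ + ‖v‖ ^ 2 := norm_sub_sq_real y v
  have e3 : ‖x‖ ^ 2 = ‖y‖ ^ 2 + 2 * ⟪y, w⟫_ℝ + ‖w‖ ^ 2 := by rw [hx]; exact norm_add_sq_real y w
  rw [e1] at h3
  rw [e2] at h4
  rw [e3]
  rw [hx]
  simp only [inner_add_left, inner_add_right, inner_sub_left, inner_sub_right, inner_neg_left,
    real_inner_smul_left, real_inner_self_eq_norm_sq,
    real_inner_comm w y, real_inner_comm v y, real_inner_comm v w] at h1 h2 h3 h4 ⊢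
  rw [abs_le] at h1 h2 h3 h4
  have hw2 := sq_nonneg ‖w‖
  -- Polarization: the difference of the forms at `y + v` and `y - v` is `2(⟪G y, v⟫ + ⟪G v, y⟫) =
  -- 2r(‖v‖² - ⟪y, w⟫)`.
  have hN : r * (‖v‖ ^ 2 - ⟪y, w⟫_ℝ) ≤ β * (‖y‖ ^ 2 + ‖v‖ ^ 2) := by
    rw [real_inner_comm w y] at *
    nlinarith
  have hβ := h.nonneg
  -- Here `4β ≤ r₀ < r` is needed: `hN` bounds `⟪y, w⟫` from below well enough for `‖x‖² = ‖y + w‖²`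
  -- to dominate half of `‖y‖² + ‖v‖²`. This is the source of the factor 2 in `2β`.
  have hN2 : ‖y‖ ^ 2 + ‖v‖ ^ 2 ≤ 2 * (‖y‖ ^ 2 + 2 * ⟪y, w⟫_ℝ + ‖w‖ ^ 2) := by
    have h5 : r * (‖v‖ ^ 2 - ⟪y, w⟫_ℝ) ≤ r * ((‖y‖ ^ 2 + ‖v‖ ^ 2) / 4) := by
      refine hN.trans ?_
      have : β ≤ r / 4 := by linarith [h.le]
      nlinarith [sq_nonneg ‖y‖, sq_nonneg ‖v‖]
    have h6 := le_of_mul_le_mul_left h5 hr0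
    nlinarith
  have hfin : |r * ⟪v, y⟫_ℝ + r * ⟪v, w⟫_ℝ| ≤ β * (‖y‖ ^ 2 + ‖v‖ ^ 2) := by
    rw [abs_le]
    simp only [real_inner_comm w y, real_inner_comm v y] at *
    constructor <;> nlinarith
  simp only [real_inner_comm w y, real_inner_comm v y] at *
  rw [← mul_add] at hfin ⊢
  nlinarith

end IsQuasiSkewAdjoint

end QuasiSkew

/-! ### Generation of groups by two-sided Yosida approximation -/

section Generation

variable {X : Type*} [NormedAddCommGroup X] [InnerProductSpace ℝ X]

theorem tendsto_apply_of_tendsto_on_dense {ι : Type*} {l : Filter ι} {T : ι → X →L[ℝ] X}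
    {L : X →L[ℝ] X} {C : ℝ} (hT : ∀ᶠ i in l, ‖T i‖ ≤ C) {s : Set X} (hs : Dense s)
    (h : ∀ x ∈ s, Tendsto (fun i => T i x) l (𝓝 (L x))) (x : X) :
    Tendsto (fun i => T i x) l (𝓝 (L x)) := by
  rcases l.eq_or_neBot with rfl | hl
  · simp
  have hC : 0 ≤ C := by
    obtain ⟨i, hi⟩ := hT.exists
    exact (norm_nonneg _).trans hi
  rw [Metric.tendsto_nhds]
  intro ε hε
  have hK : 0 < C + ‖L‖ + 1 := by positivity
  obtain ⟨y, hys, hy⟩ := hs.exists_dist_lt x (show 0 < ε / (2 * (C + ‖L‖ + 1)) by positivity)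
  have hy' : (C + ‖L‖ + 1) * ‖x - y‖ < ε / 2 := by
    rw [dist_eq_norm, lt_div_iff₀ (by positivity)] at hy
    linarith
  filter_upwards [hT, Metric.tendsto_nhds.1 (h y hys) (ε / 2) (by positivity)] with i hi hiy
  rw [dist_eq_norm] at hiy ⊢
  have e : T i x - L x = T i (x - y) + (T i y - L y) - L (x - y) := by
    rw [map_sub, map_sub]
    abel
  have h1 : ‖T i (x - y)‖ ≤ C * ‖x - y‖ := (T i).le_of_opNorm_le hi _
  have h2 : ‖L (x - y)‖ ≤ ‖L‖ * ‖x - y‖ := L.le_opNorm _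
  calc ‖T i x - L x‖ ≤ ‖T i (x - y)‖ + ‖T i y - L y‖ + ‖L (x - y)‖ := by
        rw [e]
        exact (norm_sub_le _ _).trans (by gcongr; exact norm_add_le _ _)
    _ < ε := by nlinarith [norm_nonneg (x - y)]

variable {Γ : Submodule ℝ (X × X)} {β r₀ : ℝ}

/-- Two-sided Yosida approximation of a quasi-skew-adjoint operator by commuting bounded
operators. -/
theorem IsQuasiSkewAdjoint.exists_yosida (h : IsQuasiSkewAdjoint Γ β r₀) :
    ∃ A : ℕ → X →L[ℝ] X, (∀ n m, Commute (A n) (A m)) ∧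
      (∀ n x, |⟪A n x, x⟫_ℝ| ≤ 2 * β * ‖x‖ ^ 2) ∧
      ∀ p ∈ Γ, Tendsto (fun n => A n p.1) atTop (𝓝 p.2) := by
  choose! R hR1 hR2 hR3 using fun (r : ℝ) (hr : r₀ < |r|) => h.exists_resolvent hr
  have hβ := h.nonneg
  have hle := h.le
  -- Commutation follows from the resolvent identity, obtained by applying `R r` to `(r - G) R s y`.
  have hcomm : ∀ r s, r₀ < |r| → r₀ < |s| → Commute (R r) (R s) := by
    intro r s hr hs
    ext y
    change R r (R s y) = R s (R r y)
    have h1 := hR1 r hr (R s y)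
    have h2 := hR2 s hs _ h1
    have h3 := hR2 r hr _ (hR1 s hs y)
    simp only at h2 h3
    rw [← h2]
    congr 1
    rw [show r • R s y - (s • R s y - y) = (r - s) • R s y + y by module, map_add, map_smul] at h3
    rw [← sub_eq_zero]
    rw [← sub_eq_zero] at h3
    rw [← neg_eq_zero, ← h3]
    module
  set lam : ℕ → ℝ := fun n => r₀ + 1 + n with hlam
  have hlr : ∀ n, r₀ < lam n := fun n => by
    have : (0 : ℝ) ≤ n := n.cast_nonneg
    simp only [hlam]
    linarith
  have hl0 : ∀ n, 0 < lam n := fun n => by linarith [hlr n]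
  have hl1 : ∀ n, r₀ < |lam n| := fun n => (hlr n).trans_le (le_abs_self _)
  have hl2 : ∀ n, r₀ < |-lam n| := fun n => by rw [abs_neg]; exact hl1 n
  have hlt : Tendsto lam atTop atTop :=
    tendsto_atTop_add_const_left _ _ tendsto_natCast_atTop_atTop
  -- Stated for both choices `μ = lam` and `μ = -lam`. On the domain `μ R(μ) p.1 - p.1 = R(μ) p.2`
  -- tends to `0`, and `lam n - β ≥ lam n / 2` gives the uniform bound 2.
  have hconv : ∀ μ : ℕ → ℝ, (∀ n, |μ n| = lam n) → ∀ y,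
      Tendsto (fun n => (μ n • R (μ n)) y) atTop (𝓝 (ContinuousLinearMap.id ℝ X y)) := by
    intro μ hμ
    have hμr : ∀ n, r₀ < |μ n| := fun n => by rw [hμ]; exact hlr n
    refine tendsto_apply_of_tendsto_on_dense (C := 2) (Eventually.of_forall fun n => ?_)
      h.dense ?_
    · refine ContinuousLinearMap.opNorm_le_bound _ (by norm_num) fun y => ?_
      have h1 := hR3 _ (hμr n) y
      rw [smul_apply, norm_smul, Real.norm_eq_abs]
      rw [hμ] at h1 ⊢
      have h2 : lam n / 2 ≤ lam n - β := by linarith [hlr n]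
      nlinarith [norm_nonneg (R (μ n) y)]
    · rintro _ ⟨p, hp, rfl⟩
      rw [ContinuousLinearMap.id_apply, tendsto_iff_norm_sub_tendsto_zero]
      have h2 : Tendsto (fun n => ‖p.2‖ * (lam n - β)⁻¹) atTop (𝓝 0) := by
        rw [← mul_zero ‖p.2‖]
        exact (tendsto_inv_atTop_zero.comp
          (tendsto_atTop_add_const_right _ (-β) hlt)).const_mul _
      refine squeeze_zero (fun n => norm_nonneg _) (fun n => ?_) h2
      have h3 := hR2 _ (hμr n) p hp
      rw [map_sub, map_smul] at h3
      have h4 : (μ n • R (μ n)) p.1 - p.1 = R (μ n) p.2 := by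
        rw [smul_apply]
        rw [sub_eq_iff_eq_add] at h3 ⊢
        rw [h3]
        abel
      rw [h4, ← div_eq_mul_inv, le_div_iff₀ (by linarith [hlr n]), mul_comm]
      have h5 := hR3 _ (hμr n) p.2
      rwa [hμ] at h5
  -- With `R(μ) = (μ - G)⁻¹` this is `λ² G (λ² - G²)⁻¹`. Taking both signs bounds the symmetric part
  -- from above and below, as needed for a group rather than a semigroup.
  refine ⟨fun n => (lam n ^ 2 / 2) • (R (lam n) + R (-lam n)), fun n m => ?_, fun n x => ?_,
    fun p hp => ?_⟩
  · refine Commute.smul_left (Commute.smul_right ?_ _) _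
    exact ((hcomm _ _ (hl1 n) (hl1 m)).add_right (hcomm _ _ (hl1 n) (hl2 m))).add_left
      ((hcomm _ _ (hl2 n) (hl1 m)).add_right (hcomm _ _ (hl2 n) (hl2 m)))
  · have h1 := hR1 _ (hl1 n) x
    have h2 := hR1 _ (hl2 n) x
    -- The vector `y` is `λ² (λ² - G²)⁻¹ x`, so that `G y = A n x` and `G² y = λ² (y - x)`.
    refine h.yosida_form_le (hlr n) (y := (lam n / 2) • (R (lam n) x - R (-lam n) x)) ?_ ?_
    · convert Γ.smul_mem (lam n / 2) (Γ.sub_mem h1 h2) using 1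
      ext
      · simp
      · simp only [smul_apply, add_apply, Prod.smul_snd, Prod.mk_sub_mk]
        module
    · convert Γ.smul_mem (lam n ^ 2 / 2) (Γ.add_mem h1 h2) using 1
      ext
      · simp
      · simp only [Prod.smul_snd, Prod.mk_add_mk]
        module
  · have h1 := (hconv lam (fun n => abs_of_pos (hl0 n)) p.2).add
      (hconv (fun n => -lam n) (fun n => by rw [abs_neg, abs_of_pos (hl0 n)]) p.2)
    have h2 := h1.const_smul (1 / 2 : ℝ)
    have e : (1 / 2 : ℝ) • (ContinuousLinearMap.id ℝ X p.2 + ContinuousLinearMap.id ℝ X p.2) =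
        p.2 := by
      simp only [ContinuousLinearMap.id_apply]
      module
    rw [e] at h2
    refine h2.congr fun n => ?_
    have h3 := hR2 _ (hl1 n) p hp
    have h4 := hR2 _ (hl2 n) p hp
    rw [map_sub, map_smul, sub_eq_iff_eq_add] at h3 h4
    simp only [smul_apply, add_apply]
    have h5 : R (lam n) p.2 = lam n • R (lam n) p.1 - p.1 := by rw [h3]; abel
    have h6 : R (-lam n) p.2 = -lam n • R (-lam n) p.1 - p.1 := by rw [h4]; abel
    rw [h5, h6]
    module

/-- The limit of the exponentials of commuting bounded operators with uniformly bounded symmetric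
parts, which converge on a dense set. -/
theorem exists_group_of_commuting [CompleteSpace X] {A : ℕ → X →L[ℝ] X} {ω : ℝ}
    (hcomm : ∀ n m, Commute (A n) (A m))
    (hform : ∀ n x, |⟪A n x, x⟫_ℝ| ≤ ω * ‖x‖ ^ 2)
    (hdense : Dense (Prod.fst '' (Γ : Set (X × X))))
    (hlim : ∀ p ∈ Γ, Tendsto (fun n => A n p.1) atTop (𝓝 p.2)) :
    ∃ U : ℝ → X →L[ℝ] X, IsC0Group U ∧ (∀ p ∈ Γ, IsOrbitDeriv U p.1 p.2) ∧
      ∀ t, ‖U t‖ ≤ Real.exp (ω * |t|) := by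
  set E : ℕ → ℝ → X →L[ℝ] X := fun n t => NormedSpace.exp (t • A n) with hE
  have hEb : ∀ n t, ‖E n t‖ ≤ Real.exp (ω * |t|) := fun n t => norm_exp_smul_le (hform n) t
  have hEbx : ∀ n t x, ‖E n t x‖ ≤ Real.exp (ω * |t|) * ‖x‖ := fun n t x =>
    (E n t).le_of_opNorm_le (hEb n t) x
  have hcauchy : ∀ t x, CauchySeq fun n => E n t x := by
    intro t x
    rw [cauchySeq_iff_tendsto_dist_atTop_0]
    simp only [dist_eq_norm]
    rw [← tendsto_zero_iff_norm_tendsto_zero]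
    -- On the domain, the difference of two exponentials is controlled by `‖A n p.1 - A m p.1‖`; the
    -- uniform bound on the exponentials extends the convergence to all of `X`.
    have key := tendsto_apply_of_tendsto_on_dense (l := (atTop : Filter (ℕ × ℕ)))
      (T := fun q => E q.1 t - E q.2 t) (L := 0) (C := Real.exp (ω * |t|) + Real.exp (ω * |t|))
      (Eventually.of_forall fun q => (norm_sub_le _ _).trans (add_le_add (hEb _ _) (hEb _ _)))
      hdense ?_ x
    · simpa using key
    rintro _ ⟨p, hp, rfl⟩
    rw [zero_apply, tendsto_zero_iff_norm_tendsto_zero]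
    have h0 := (hlim p hp).cauchySeq
    rw [cauchySeq_iff_tendsto_dist_atTop_0] at h0
    have h1 := (h0.const_mul |t|).const_mul (Real.exp (ω * |t|))
    rw [mul_zero, mul_zero] at h1
    refine squeeze_zero (fun _ => norm_nonneg _) (fun q => ?_) h1
    rw [dist_eq_norm]
    exact norm_exp_smul_sub_exp_smul_apply_le (hcomm _ _) (hform _) (hform _) t p.1
  choose f hf using fun t x => cauchySeq_tendsto_of_complete (hcauchy t x)
  let U : ℝ → X →L[ℝ] X := fun t =>
    continuousLinearMapOfTendsto (fun n => E n t) (f := f t) (tendsto_pi_nhds.2 (hf t))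
  have hU : ∀ t x, Tendsto (fun n => E n t x) atTop (𝓝 (U t x)) := hf
  have hUb : ∀ t, ‖U t‖ ≤ Real.exp (ω * |t|) := fun t =>
    ContinuousLinearMap.opNorm_le_bound _ (Real.exp_pos _).le fun x =>
      le_of_tendsto (hU t x).norm (Eventually.of_forall fun n => hEbx n t x)
  have hzero : U 0 = ContinuousLinearMap.id ℝ X := by
    ext x
    refine tendsto_nhds_unique (hU 0 x) ?_
    simp [hE]
  have hadd : ∀ s t, U (s + t) = (U s).comp (U t) := by
    intro s t
    ext x
    refine tendsto_nhds_unique (hU (s + t) x) ?_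
    have h1 : Tendsto (fun n => E n s (E n t x - U t x)) atTop (𝓝 0) := by
      have h2 := ((tendsto_iff_norm_sub_tendsto_zero.1 (hU t x)).const_mul (Real.exp (ω * |s|)))
      rw [mul_zero] at h2
      exact squeeze_zero_norm (fun n => hEbx n s _) h2
    have h3 := h1.add (hU s (U t x))
    rw [zero_add] at h3
    refine h3.congr fun n => ?_
    rw [map_sub, sub_add_cancel]
    simp only [hE, exp_add_smul]
    rfl
  -- The integrated equation for the approximations is used twice: to estimate `U t p.1 - p.1` for
  -- small `t`, and, in the limit, to identify the generator on `Γ`.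
  have h_int : ∀ p ∈ Γ, ∀ t, Tendsto (fun n => ∫ s in (0 : ℝ)..t, E n s (A n p.1)) atTop
      (𝓝 (U t p.1 - p.1)) := by
    intro p hp t
    refine ((hU t p.1).sub_const p.1).congr fun n => ?_
    have hd : ∀ s, HasDerivAt (fun s => E n s p.1) (E n s (A n p.1)) s := by
      intro s
      have h := (hasDerivAt_exp_smul_const (𝕂 := ℝ) (A n) s).clm_apply (hasDerivAt_const s p.1)
      simpa using h
    have hd' : Continuous fun s => E n s (A n p.1) :=
      continuous_iff_continuousAt.2 fun s =>
        (hasDerivAt_exp_smul_apply (A n) (A n p.1) s).continuousAt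
    rw [intervalIntegral.integral_eq_sub_of_hasDerivAt (fun s _ => hd s)
      (hd'.intervalIntegrable _ _)]
    simp [hE]
  have hexpcont : Continuous fun t : ℝ => Real.exp (ω * |t|) := by fun_prop
  have hcont0 : ∀ x, Tendsto (fun t => U t x) (𝓝 0) (𝓝 (ContinuousLinearMap.id ℝ X x)) := by
    refine tendsto_apply_of_tendsto_on_dense (C := 2) ?_ hdense ?_
    · have h1 : ∀ᶠ t : ℝ in 𝓝 0, Real.exp (ω * |t|) < 2 := by
        refine hexpcont.continuousAt.eventually_lt continuousAt_const ?_
        simp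
      filter_upwards [h1] with t ht
      exact (hUb t).trans ht.le
    · rintro _ ⟨p, hp, rfl⟩
      rw [ContinuousLinearMap.id_apply, tendsto_iff_norm_sub_tendsto_zero]
      have h1 : Tendsto (fun t : ℝ => Real.exp (|ω| * |t|) * ‖p.2‖ * |t - 0|) (𝓝 0) (𝓝 0) := by
        have : Continuous fun t : ℝ => Real.exp (|ω| * |t|) * ‖p.2‖ * |t - 0| := by fun_prop
        simpa using this.tendsto 0
      refine squeeze_zero (fun _ => norm_nonneg _) (fun t => ?_) h1
      refine le_of_tendsto_of_tendsto (h_int p hp t).norm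
        (((hlim p hp).norm.const_mul (Real.exp (|ω| * |t|))).mul_const _)
        (Eventually.of_forall fun n => ?_)
      refine intervalIntegral.norm_integral_le_of_norm_le_const fun s hs => ?_
      refine (hEbx n s _).trans ?_
      have hst : |s| ≤ |t| := by
        have := Set.abs_sub_left_of_mem_uIcc (Set.uIoc_subset_uIcc hs)
        simpa using this
      have : ω * |s| ≤ |ω| * |t| := by
        calc ω * |s| ≤ |ω| * |s| := by gcongr; exact le_abs_self _
          _ ≤ |ω| * |t| := by gcongr
      gcongr
  have hcont : ∀ x, Continuous fun t => U t x := by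
    intro x
    rw [continuous_iff_continuousAt]
    intro t
    have h1 : Tendsto (fun s => U t (U (s - t) x)) (𝓝 t) (𝓝 (U t x)) := by
      have h2 : Tendsto (fun s : ℝ => s - t) (𝓝 t) (𝓝 0) := by
        have : Continuous fun s : ℝ => s - t := by fun_prop
        simpa using this.tendsto t
      exact ((U t).continuous.tendsto _).comp ((hcont0 x).comp h2)
    refine h1.congr fun s => ?_
    have := hadd t (s - t)
    rw [add_sub_cancel] at this
    rw [this]
    rfl
  have hgroup : IsC0Group U := ⟨hzero, hadd, hcont⟩
  refine ⟨U, hgroup, fun p hp => (hgroup.isOrbitDeriv_iff_integral _ _).2 fun t => ?_, hUb⟩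
  refine tendsto_nhds_unique (h_int p hp t) ?_
  obtain ⟨M, hM⟩ := (hlim p hp).norm.bddAbove_range
  refine intervalIntegral.tendsto_integral_filter_of_dominated_convergence
    (fun s => Real.exp (ω * |s|) * M) (Eventually.of_forall fun n => ?_)
    (Eventually.of_forall fun n => Eventually.of_forall fun s _ => ?_)
    (Continuous.intervalIntegrable (by fun_prop) _ _) (Eventually.of_forall fun s _ => ?_)
  · exact (continuous_iff_continuousAt.2 fun s =>
        (hasDerivAt_exp_smul_apply (A n) (A n p.1) s).continuousAt).aestronglyMeasurable
  · refine (hEbx n s _).trans ?_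
    gcongr
    exact hM ⟨n, rfl⟩
  · have h1 : Tendsto (fun n => E n s (A n p.1 - p.2)) atTop (𝓝 0) := by
      have h2 := ((tendsto_iff_norm_sub_tendsto_zero.1 (hlim p hp)).const_mul
        (Real.exp (ω * |s|)))
      rw [mul_zero] at h2
      exact squeeze_zero_norm (fun n => hEbx n s _) h2
    have h3 := h1.add (hU s p.2)
    rw [zero_add] at h3
    refine h3.congr fun n => ?_
    rw [map_sub, sub_add_cancel]

/-- An operator that generates a `C₀`-group has no proper restriction which is
quasi-skew-adjoint. -/
theorem IsQuasiSkewAdjoint.eq_of_le (h : IsQuasiSkewAdjoint Γ β r₀)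
    {U : ℝ → X →L[ℝ] X} (hU : IsC0Group U) (hΓ : ∀ p ∈ Γ, IsOrbitDeriv U p.1 p.2) (x z : X)
    (hxz : IsOrbitDeriv U x z) : (x, z) ∈ Γ := by
  -- Choose `r` so large that `r - Γ` is onto while `r` is not an eigenvalue of the generator of
  -- `U`. The preimage of `r x - z` under `r - Γ` must then be `(x, z)` itself.
  obtain ⟨r, hr, hr1⟩ : ∃ r : ℝ, r₀ < |r| ∧ ‖U 1‖ < Real.exp r := by
    refine ⟨max (r₀ + 1) (‖U 1‖ + 1), ?_, ?_⟩
    · refine lt_of_lt_of_le ?_ (le_abs_self _)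
      exact lt_of_lt_of_le (by linarith) (le_max_left _ _)
    · have h1 := Real.add_one_le_exp (max (r₀ + 1) (‖U 1‖ + 1))
      linarith [le_max_right (r₀ + 1) (‖U 1‖ + 1)]
  obtain ⟨p, hp, hpr⟩ := h.surjective r hr (r • x - z)
  have h1 : IsOrbitDeriv U (x - p.1) (z - p.2) := hxz.sub (hΓ p hp)
  have h2 : z - p.2 = r • (x - p.1) := by
    rw [← sub_eq_zero] at hpr ⊢
    rw [← hpr]
    module
  rw [h2] at h1
  have h3 := hU.eq_zero_of_isOrbitDeriv_smul hr1 h1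
  rw [h3, smul_zero, sub_eq_zero] at h2
  rw [sub_eq_zero] at h3
  rw [h3, h2]
  exact hp

/-- A quasi-skew-adjoint operator generates a `C₀`-group. -/
theorem IsQuasiSkewAdjoint.exists_group [CompleteSpace X] (h : IsQuasiSkewAdjoint Γ β r₀) :
    ∃ U : ℝ → X →L[ℝ] X, IsC0Group U ∧ (∀ x z, (x, z) ∈ Γ ↔ IsOrbitDeriv U x z) ∧
      ∀ t, ‖U t‖ ≤ Real.exp (2 * β * |t|) := by
  obtain ⟨A, hcomm, hform, hlim⟩ := h.exists_yosida
  obtain ⟨U, hU, hΓ, hb⟩ := exists_group_of_commuting hcomm hform h.dense hlim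
  refine ⟨U, hU, fun x z => ⟨fun hp => hΓ _ hp, h.eq_of_le hU hΓ x z⟩, hb⟩

end Generation

/-! ### Closures of operators that almost commute with `Q` -/

section Conjugation

variable {X Y : Type*} [NormedAddCommGroup X] [InnerProductSpace ℝ X]
  [NormedAddCommGroup Y] [InnerProductSpace ℝ Y]

/-- The closure of the graph of the operator `ι u ↦ T u` in `X`. -/
def graphClosure (ι T : Y →L[ℝ] X) : Submodule ℝ (X × X) :=
  (LinearMap.range ((ι.prod T).toLinearMap)).topologicalClosure

theorem mk_mem_graphClosure (ι T : Y →L[ℝ] X) (u : Y) : (ι u, T u) ∈ graphClosure ι T :=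
  Submodule.le_topologicalClosure _ ⟨u, rfl⟩

theorem isClosed_graphClosure (ι T : Y →L[ℝ] X) :
    IsClosed (graphClosure ι T : Set (X × X)) :=
  Submodule.isClosed_topologicalClosure _

theorem graphClosure_subset {ι T : Y →L[ℝ] X} {s : Set (X × X)} (hs : IsClosed s)
    (h : ∀ u, (ι u, T u) ∈ s) {p : X × X} (hp : p ∈ graphClosure ι T) : p ∈ s := by
  refine closure_minimal ?_ hs (by exact hp)
  rintro _ ⟨u, rfl⟩
  exact h u

theorem graphClosure_form_le {ι T : Y →L[ℝ] X} {β : ℝ}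
    (h : ∀ u, |⟪T u, ι u⟫_ℝ| ≤ β * ‖ι u‖ ^ 2) :
    ∀ p ∈ graphClosure ι T, |⟪p.2, p.1⟫_ℝ| ≤ β * ‖p.1‖ ^ 2 := fun _ hp =>
  graphClosure_subset (s := {p : X × X | |⟪p.2, p.1⟫_ℝ| ≤ β * ‖p.1‖ ^ 2})
    (isClosed_le (by fun_prop) (by fun_prop)) h hp

/-- Closability follows from the form bound alone: at `(0, z) + c (ι u, T u)` the form is `c⟪z + c T
u, ι u⟫`, of size `O(c²)`. Dividing by `c` and letting `c → 0` gives `z ⊥ ι u`. -/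
theorem graphClosure_snd_eq_zero {ι T : Y →L[ℝ] X} (hι : DenseRange ι) {β : ℝ}
    (h : ∀ u, |⟪T u, ι u⟫_ℝ| ≤ β * ‖ι u‖ ^ 2) :
    ∀ p ∈ graphClosure ι T, p.1 = 0 → p.2 = 0 := by
  rintro ⟨x, z⟩ hp hx
  obtain rfl : x = 0 := hx
  change z = 0
  refine hι.eq_zero_of_inner_left ℝ fun u => ?_
  have h1 : ∀ c : ℝ, 0 < c → |⟪z + c • T u, ι u⟫_ℝ| ≤ β * c * ‖ι u‖ ^ 2 := by
    intro c hc
    have h2 := graphClosure_form_le h _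
      (Submodule.add_mem _ hp (Submodule.smul_mem _ c (mk_mem_graphClosure ι T u)))
    simp only [Prod.smul_mk, Prod.mk_add_mk, zero_add, real_inner_smul_right, norm_smul,
      abs_mul, abs_of_pos hc, Real.norm_eq_abs] at h2
    refine le_of_mul_le_mul_left ?_ hc
    nlinarith
  have h2 : Tendsto (fun c : ℝ => |⟪z + c • T u, ι u⟫_ℝ|) (𝓝[>] 0) (𝓝 |⟪z, ι u⟫_ℝ|) := by
    have : Continuous fun c : ℝ => |⟪z + c • T u, ι u⟫_ℝ| := by fun_prop
    simpa using (this.tendsto 0).mono_left nhdsWithin_le_nhds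
  have h3 : Tendsto (fun c : ℝ => β * c * ‖ι u‖ ^ 2) (𝓝[>] 0) (𝓝 0) := by
    have : Continuous fun c : ℝ => β * c * ‖ι u‖ ^ 2 := by fun_prop
    simpa using (this.tendsto 0).mono_left nhdsWithin_le_nhds
  have h4 := le_of_tendsto_of_tendsto h2 h3
    (eventually_nhdsWithin_of_forall fun c hc => h1 c hc)
  exact abs_nonpos_iff.1 h4

variable [CompleteSpace X]

/-- For nonnegative `P` the form of `P + 1` is coercive, so Lax–Milgram applies. -/
theorem exists_apply_add_self_eq {P : X →L[ℝ] X} (hP : ∀ x, 0 ≤ ⟪P x, x⟫_ℝ) (v : X) :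
    ∃ n, P n + n = v := by
  let b : X →L[ℝ] X →L[ℝ] ℝ := (innerSL ℝ).comp (P + ContinuousLinearMap.id ℝ X)
  have hb : ∀ x y, b x y = ⟪P x + x, y⟫_ℝ := fun x y => rfl
  have hco : IsCoercive b := by
    refine ⟨1, one_pos, fun u => ?_⟩
    rw [hb, inner_add_left, real_inner_self_eq_norm_sq]
    nlinarith [hP u]
  refine ⟨hco.continuousLinearEquivOfBilin.symm v, ?_⟩
  refine ext_inner_right ℝ fun w => ?_
  rw [← hb, ← IsCoercive.continuousLinearEquivOfBilin_apply hco,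
    ContinuousLinearEquiv.apply_symm_apply]

variable {ι T : Y →L[ℝ] X} {Q : Y ≃L[ℝ] X} {B : X →L[ℝ] X} {β : ℝ}

/-- A Friedrichs-type argument: the commutation relation `Q T Q⁻¹ = T + B` implies that `r - T` has
dense range for large `|r|`. -/
theorem eq_zero_of_orthogonal_range (hι : Function.Injective ι)
    (hsymm : ∀ x y, ⟪ι (Q.symm x), y⟫_ℝ = ⟪x, ι (Q.symm y)⟫_ℝ)
    (hpos : ∀ x, 0 ≤ ⟪ι (Q.symm x), x⟫_ℝ)
    (hconj : ∀ u, T (Q.symm (ι u)) = ι (Q.symm (T u + B (ι u))))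
    (hform : ∀ u, |⟪T u, ι u⟫_ℝ| ≤ β * ‖ι u‖ ^ 2) {r : ℝ} (hr : β + ‖B‖ < |r|) {v : X}
    (hv : ∀ u, ⟪r • ι u - T u, v⟫_ℝ = 0) : v = 0 := by
  let P : X →L[ℝ] X := ι.comp Q.symm.toContinuousLinearMap
  have hP : ∀ x, ι (Q.symm x) = P x := fun x => rfl
  -- With `J = P (1 + P)⁻¹` one has `P n = J v` and `P m = J² v`. The test vector is `J² v`; since
  -- `m = P (n - m)` lies in the image of `Y`, the commutation relation can be applied at `m`.
  obtain ⟨n, hn⟩ := exists_apply_add_self_eq (P := P) hpos v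
  obtain ⟨m, hm⟩ := exists_apply_add_self_eq (P := P) hpos (P n)
  set m' : Y := Q.symm (n - m) with hm'
  have hmm : ι m' = m := by
    rw [hm', hP, map_sub, ← hm]
    abel
  have hY : Q.symm n = Q.symm m + m' := hι (by rw [map_add, hmm, hP, hP, hm])
  have hTu : T (Q.symm m) = P (T m' + B m) := by
    have := hconj m'
    rwa [hmm] at this
  -- This moves one `J` across `T`: from `P n = P m + m` and `T P m = P (T m + B m)` the commutator
  -- contributes only `⟪B m, P n⟫`.
  have h1 : ⟪T (Q.symm n), P n⟫_ℝ = ⟪T (Q.symm m), v⟫_ℝ - ⟪B m, P n⟫_ℝ := by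
    have e1 : P (T (Q.symm n)) = P (T (Q.symm m)) + T (Q.symm m) - P (B m) := by
      rw [hY, map_add, map_add, hTu, map_add]
      abel
    rw [← hP, ← hsymm, hP, e1, ← hP (B m), inner_sub_left, hsymm, inner_add_left, ← hP, hsymm, ← hn,
      inner_add_right]
    rfl
  -- Symmetry of `J`: `⟪J² v, v⟫ = ‖J v‖²`.
  have h2 : ⟪P m, v⟫_ℝ = ‖P n‖ ^ 2 := by
    rw [← real_inner_self_eq_norm_sq]
    nth_rewrite 2 [← hm]
    rw [← hn, inner_add_right, inner_add_right, ← hP m, hsymm m n, ← hP n, real_inner_comm m,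
      real_inner_comm (ι (Q.symm m))]
  have h3 : ‖m‖ ≤ ‖P n‖ := by
    have h4 : ‖m‖ ^ 2 ≤ ⟪P n, m⟫_ℝ := by
      rw [← hm, inner_add_left, real_inner_self_eq_norm_sq]
      have : 0 ≤ ⟪P m, m⟫_ℝ := hpos m
      linarith
    have h5 := real_inner_le_norm (P n) m
    by_contra! h6
    nlinarith [norm_nonneg (P n)]
  have h4 : r * ‖P n‖ ^ 2 = ⟪T (Q.symm n), P n⟫_ℝ + ⟪B m, P n⟫_ℝ := by
    have := hv (Q.symm m)
    rw [inner_sub_left, real_inner_smul_left, hP, h2] at this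
    linarith
  -- Since `|r| > β + ‖B‖`, this forces `J v = 0`. The mollifier is fixed and injective, so no limit
  -- is needed.
  have h5 : |r| * ‖P n‖ ^ 2 ≤ (β + ‖B‖) * ‖P n‖ ^ 2 := by
    have h6 : |⟪B m, P n⟫_ℝ| ≤ ‖B‖ * ‖P n‖ ^ 2 := by
      refine (abs_real_inner_le_norm _ _).trans ?_
      calc ‖B m‖ * ‖P n‖ ≤ (‖B‖ * ‖P n‖) * ‖P n‖ := by
            gcongr
            exact (B.le_opNorm m).trans (by gcongr)
        _ = _ := by ring
    calc |r| * ‖P n‖ ^ 2 = |r * ‖P n‖ ^ 2| := by rw [abs_mul, abs_of_nonneg (sq_nonneg ‖P n‖)]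
      _ ≤ |⟪T (Q.symm n), P n⟫_ℝ| + |⟪B m, P n⟫_ℝ| := by rw [h4]; exact abs_add_le _ _
      _ ≤ _ := by
        have := hform (Q.symm n)
        rw [hP] at this
        linarith
  have h6 : P n = 0 := by
    rw [← norm_le_zero_iff]
    by_contra! h7
    nlinarith [pow_pos h7 2]
  have h7 : n = 0 := by
    have : Q.symm n = 0 := hι (by rw [hP, h6, map_zero])
    simpa using this
  rw [← hn, h7, map_zero, zero_add]

theorem denseRange_of_symmetric (hι : Function.Injective ι)
    (hsymm : ∀ x y, ⟪ι (Q.symm x), y⟫_ℝ = ⟪x, ι (Q.symm y)⟫_ℝ) : DenseRange ι := by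
  change Dense ((LinearMap.range ι.toLinearMap : Submodule ℝ X) : Set X)
  rw [Submodule.dense_iff_topologicalClosure_eq_top, Submodule.topologicalClosure_eq_top_iff,
    Submodule.eq_bot_iff]
  intro v hv
  rw [Submodule.mem_orthogonal] at hv
  have h1 : ι (Q.symm v) = 0 := by
    refine ext_inner_left ℝ fun w => ?_
    rw [← hsymm, inner_zero_right]
    exact hv _ ⟨_, rfl⟩
  have h2 : Q.symm v = 0 := hι (by rw [h1, map_zero])
  simpa using h2

/-- For the closed operator the range of `r - T` is closed, by the lower bound `|r| - β`, and dense,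
by the Friedrichs argument. The threshold satisfies both `r₀ ≥ 4β`, for the Yosida estimate, and `r₀
≥ β + ‖B‖`, for density. -/
theorem isQuasiSkewAdjoint_graphClosure (hι : Function.Injective ι)
    (hsymm : ∀ x y, ⟪ι (Q.symm x), y⟫_ℝ = ⟪x, ι (Q.symm y)⟫_ℝ)
    (hpos : ∀ x, 0 ≤ ⟪ι (Q.symm x), x⟫_ℝ)
    (hconj : ∀ u, T (Q.symm (ι u)) = ι (Q.symm (T u + B (ι u)))) (hβ : 0 ≤ β)
    (hform : ∀ u, |⟪T u, ι u⟫_ℝ| ≤ β * ‖ι u‖ ^ 2) :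
    IsQuasiSkewAdjoint (graphClosure ι T) β (4 * β + ‖B‖) where
  nonneg := hβ
  le := by linarith [norm_nonneg B]
  form_le := graphClosure_form_le hform
  dense := (denseRange_of_symmetric hι hsymm).mono <| by
    rintro _ ⟨u, rfl⟩
    exact ⟨_, mk_mem_graphClosure ι T u, rfl⟩
  surjective r hr y := by
    have hr' : β + ‖B‖ < |r| := by linarith
    have hr0 : 0 < |r| - β := by linarith [norm_nonneg B]
    have hd : Dense ((LinearMap.range (r • ι - T).toLinearMap : Submodule ℝ X) : Set X) := by
      rw [Submodule.dense_iff_topologicalClosure_eq_top, Submodule.topologicalClosure_eq_top_iff,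
        Submodule.eq_bot_iff]
      intro v hv
      rw [Submodule.mem_orthogonal] at hv
      exact eq_zero_of_orthogonal_range hι hsymm hpos hconj hform hr' fun u => hv _ ⟨u, rfl⟩
    obtain ⟨w, hw, hwlim⟩ := mem_closure_iff_seq_limit.1 (hd y)
    choose u hu using hw
    have hu' : ∀ k, r • ι (u k) - T (u k) = w k := hu
    have hcauchy : CauchySeq fun k => ι (u k) := by
      rw [cauchySeq_iff_tendsto_dist_atTop_0]
      have h1 := (cauchySeq_iff_tendsto_dist_atTop_0.1 hwlim.cauchySeq).const_mul (|r| - β)⁻¹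
      rw [mul_zero] at h1
      refine squeeze_zero (fun _ => dist_nonneg) (fun k => ?_) h1
      rw [← div_eq_inv_mul, le_div_iff₀' hr0, dist_eq_norm, dist_eq_norm, ← hu', ← hu']
      have h2 := norm_fst_le_of_form_le (p := (ι (u k.1 - u k.2), T (u k.1 - u k.2)))
        (hform (u k.1 - u k.2)) r
      simp only [map_sub] at h2
      refine h2.trans_eq (congrArg norm ?_)
      module
    obtain ⟨x, hx⟩ := cauchySeq_tendsto_of_complete hcauchy
    refine ⟨(x, r • x - y), ?_, by simp⟩
    refine (isClosed_graphClosure ι T).mem_of_tendsto (hx.prodMk_nhds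
      ((hx.const_smul r).sub hwlim)) (Eventually.of_forall fun k => ?_)
    have : r • ι (u k) - w k = T (u k) := by rw [← hu']; abel
    rw [this]
    exact mk_mem_graphClosure ι T (u k)

/-- The conjugation identity extends from a core to the closure. -/
theorem conjugationIdentity_of_graph_eq [CompleteSpace Y] (hι : Function.Injective ι)
    (hconj : ∀ u, T (Q.symm (ι u)) = ι (Q.symm (T u + B (ι u)))) {r₀ : ℝ}
    (hΓ : IsQuasiSkewAdjoint (graphClosure ι T) β r₀) {A : X →ₗ.[ℝ] X}
    (hA : A.graph = graphClosure ι T) : ConjugationIdentity ι Q A B := by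
  have hmap : ∀ p ∈ graphClosure ι T,
      (ι (Q.symm p.1), ι (Q.symm (p.2 + B p.1))) ∈ graphClosure ι T := by
    intro p hp
    refine graphClosure_subset
      (s := (fun p : X × X => (ι (Q.symm p.1), ι (Q.symm (p.2 + B p.1)))) ⁻¹'
        (graphClosure ι T : Set (X × X)))
      ((isClosed_graphClosure ι T).preimage (by fun_prop)) (fun u => ?_) hp
    rw [Set.mem_preimage, ← hconj]
    exact mk_mem_graphClosure ι T _
  intro x z
  rw [hA]
  constructor
  · rintro ⟨w, hw, rfl⟩
    -- Besides lying above `r₀`, this `r` satisfies `r - β > ‖B‖`, so that `‖B R‖ < 1` and `1 - B R`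
    -- is invertible.
    set r : ℝ := |r₀| + β + ‖B‖ + 1 with hr
    have hβ := hΓ.nonneg
    have hr0 : 0 < r := by positivity
    have hrr : r₀ < |r| := by
      rw [abs_of_pos hr0]
      linarith [le_abs_self r₀, norm_nonneg B]
    obtain ⟨R, hR1, -, hR3⟩ := hΓ.exists_resolvent hrr
    rw [abs_of_pos hr0] at hR3
    have hRn : ‖R‖ ≤ (r - β)⁻¹ := by
      have h1 : 0 < r - β := by linarith [abs_nonneg r₀, norm_nonneg B]
      refine ContinuousLinearMap.opNorm_le_bound _ (by positivity) fun y => ?_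
      rw [← div_eq_inv_mul, le_div_iff₀' h1]
      exact hR3 y
    have hBR : ‖B * R‖ < 1 := by
      have h1 : 0 < r - β := by linarith [abs_nonneg r₀, norm_nonneg B]
      calc ‖B * R‖ ≤ ‖B‖ * (r - β)⁻¹ := (norm_mul_le _ _).trans (by gcongr)
        _ < 1 := by
          rw [← div_eq_mul_inv, div_lt_one h1]
          linarith [abs_nonneg r₀]
    obtain ⟨S, hS⟩ := isUnit_one_sub_of_norm_lt_one hBR
    set y : X := (↑S⁻¹ : X →L[ℝ] X) (r • x - Q w) with hy
    -- With `g = R y` this reads `(r - A - B) g = r x - Q w`. The aim is `x = g`, which places `x`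
    -- in the domain of `A`.
    have hSy : y - B (R y) = r • x - Q w := by
      have h1 : (↑S * ↑S⁻¹ : X →L[ℝ] X) (r • x - Q w) = r • x - Q w := by
        rw [S.mul_inv]
        rfl
      rw [hS] at h1
      exact h1
    have h2 := Submodule.sub_mem _ hw (hmap _ (hR1 y))
    -- By `hmap`, `A Q⁻¹ g = Q⁻¹ (A + B) g`. Hence `Q⁻¹ (x - g)` is annihilated by `r - A` and
    -- vanishes.
    have h3 : x - R y = 0 := by
      have h4 := hΓ.eq_zero_of_smul hrr h2 ?_
      · have h5 := congrArg Prod.fst h4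
        simp only [Prod.fst_sub, Prod.fst_zero, ← map_sub] at h5
        have h6 : Q.symm (x - R y) = 0 := hι (by rw [h5, map_zero])
        rwa [map_eq_zero_iff _ Q.symm.injective] at h6
      · simp only [Prod.fst_sub, Prod.snd_sub]
        have h5 : ι w = ι (Q.symm (Q w)) := by simp
        rw [h5, ← map_sub, ← map_sub, ← map_sub, ← map_sub, ← map_smul, ← map_smul, ← map_sub,
          ← map_sub]
        have h6 : r • (x - R y) - (Q w - (r • R y - y + B (R y))) = 0 := by
          rw [← sub_eq_zero] at hSy
          rw [← neg_eq_zero, ← hSy]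
          module
        rw [h6, map_zero, map_zero]
    have h4 := hR1 y
    rw [← sub_eq_zero.1 h3] at h4
    refine ⟨_, h4, ?_⟩
    rw [← sub_eq_zero.1 h3] at hSy
    rw [← sub_eq_zero] at hSy ⊢
    rw [← neg_eq_zero, ← hSy]
    module
  · rintro ⟨g, hg, rfl⟩
    exact ⟨Q.symm (g + B x), hmap _ hg, by simp⟩

end Conjugation

/-! ### Fourier multipliers on real Schwartz functions -/

section SchwartzMultipliers

/-- A real Schwartz function as a complex one. -/
def schwartzOfReal : 𝓢(ℝ, ℝ) →L[ℝ] 𝓢(ℝ, ℂ) := SchwartzMap.postcompCLM Complex.ofRealCLM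

@[simp]
theorem schwartzOfReal_apply (φ : 𝓢(ℝ, ℝ)) (x : ℝ) : schwartzOfReal φ x = φ x := rfl

theorem schwartzOfReal_injective : Function.Injective schwartzOfReal := by
  intro φ ψ h
  ext x
  have := congrArg (fun f : 𝓢(ℝ, ℂ) => f x) h
  simpa using this

/-- The Fourier transform of a real Schwartz function. -/
def realFourier (φ : 𝓢(ℝ, ℝ)) : 𝓢(ℝ, ℂ) := 𝓕 (schwartzOfReal φ)

theorem realFourier_injective : Function.Injective realFourier := by
  intro φ ψ h
  have h1 := congrArg (fun f : 𝓢(ℝ, ℂ) => 𝓕⁻ f) h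
  simp only [realFourier, FourierTransform.fourierInv_fourier_eq] at h1
  exact schwartzOfReal_injective h1

theorem realFourier_apply (φ : 𝓢(ℝ, ℝ)) (ξ : ℝ) :
    realFourier φ ξ = ∫ x, Complex.exp (↑(-2 * Real.pi * x * ξ) * Complex.I) • (φ x : ℂ) := by
  rw [realFourier, SchwartzMap.fourier_coe, Real.fourier_real_eq_integral_exp_smul]
  rfl

theorem realFourier_neg (φ : 𝓢(ℝ, ℝ)) (ξ : ℝ) :
    realFourier φ (-ξ) = (starRingEnd ℂ) (realFourier φ ξ) := by
  rw [realFourier_apply, realFourier_apply, ← integral_conj]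
  refine integral_congr_ae (Eventually.of_forall fun x => ?_)
  simp only [smul_eq_mul, map_mul, Complex.conj_ofReal, ← Complex.exp_conj, Complex.conj_I]
  congr 2
  push_cast
  ring

theorem realFourier_deriv (φ : 𝓢(ℝ, ℝ)) (ξ : ℝ) :
    realFourier (SchwartzMap.derivCLM ℝ ℝ φ) ξ =
      (2 * Real.pi * ξ : ℝ) * Complex.I * realFourier φ ξ := by
  have h1 : schwartzOfReal (SchwartzMap.derivCLM ℝ ℝ φ) =
      SchwartzMap.derivCLM ℝ ℂ (schwartzOfReal φ) := by
    ext x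
    have h := (φ.hasDerivAt x).ofReal_comp
    rw [SchwartzMap.derivCLM_apply]
    change ((deriv φ x : ℝ) : ℂ) = deriv (fun y => ((φ y : ℝ) : ℂ)) x
    rw [h.deriv]
  rw [realFourier, h1, SchwartzMap.fourier_coe]
  change 𝓕 (deriv (schwartzOfReal φ)) ξ = _
  rw [Real.fourier_deriv (schwartzOfReal φ).integrable (schwartzOfReal φ).differentiable
    (SchwartzMap.derivCLM ℝ ℂ (schwartzOfReal φ)).integrable]
  rw [realFourier, SchwartzMap.fourier_coe]
  simp only [smul_eq_mul]
  push_cast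
  ring

theorem integral_inner_realFourier (φ ψ : 𝓢(ℝ, ℝ)) :
    ∫ ξ, ⟪realFourier φ ξ, realFourier ψ ξ⟫_ℂ = ((∫ x, φ x * ψ x : ℝ) : ℂ) := by
  rw [realFourier, realFourier, SchwartzMap.integral_inner_fourier_fourier, ← integral_complex_ofReal]
  refine integral_congr_ae (Eventually.of_forall fun x => ?_)
  simp [mul_comm]

/-- The Fourier multiplier with symbol `m`, followed by taking the real part. -/
def realMultiplier (m : ℝ → ℂ) : 𝓢(ℝ, ℝ) →L[ℝ] 𝓢(ℝ, ℝ) :=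
  (SchwartzMap.postcompCLM Complex.reCLM).comp
    (((SchwartzMap.fourierMultiplierCLM ℂ m).restrictScalars ℝ).comp schwartzOfReal)

/-- For a conjugate-symmetric symbol the inverse transform is already real, so taking the real part
loses nothing. -/
theorem realFourier_realMultiplier {m : ℝ → ℂ} (hm : m.HasTemperateGrowth)
    (hsymm : ∀ ξ, m (-ξ) = (starRingEnd ℂ) (m ξ)) (φ : 𝓢(ℝ, ℝ)) (ξ : ℝ) :
    realFourier (realMultiplier m φ) ξ = m ξ * realFourier φ ξ := by
  set g : 𝓢(ℝ, ℂ) := SchwartzMap.smulLeftCLM ℂ m (realFourier φ) with hg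
  have hgx : ∀ ξ, g ξ = m ξ * realFourier φ ξ := fun ξ => by
    rw [hg, SchwartzMap.smulLeftCLM_apply_apply hm, smul_eq_mul]
  have h1 : schwartzOfReal (realMultiplier m φ) = 𝓕⁻ g := by
    ext x
    have h2 : (starRingEnd ℂ) ((𝓕⁻ g) x) = (𝓕⁻ g) x := by
      rw [SchwartzMap.fourierInv_coe, Real.fourierInv_eq', ← integral_conj,
        ← integral_neg_eq_self]
      refine integral_congr_ae (Eventually.of_forall fun ξ => ?_)
      simp only [smul_eq_mul, map_mul, ← Complex.exp_conj, Complex.conj_I, hgx, hsymm,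
        realFourier_neg, Complex.conj_ofReal, RingHomCompTriple.comp_apply, RingHom.id_apply,
        inner_neg_left]
      congr 2
      push_cast
      ring
    change ((Complex.re ((𝓕⁻ g) x) : ℝ) : ℂ) = (𝓕⁻ g) x
    exact Complex.conj_eq_iff_re.1 h2
  rw [realFourier, h1, FourierTransform.fourier_fourierInv_eq, hgx]

theorem integral_realMultiplier_mul {m m' : ℝ → ℂ} (hm : m.HasTemperateGrowth)
    (hsymm : ∀ ξ, m (-ξ) = (starRingEnd ℂ) (m ξ)) (hm' : m'.HasTemperateGrowth)
    (hsymm' : ∀ ξ, m' (-ξ) = (starRingEnd ℂ) (m' ξ)) (h : ∀ ξ, m' ξ = (starRingEnd ℂ) (m ξ))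
    (φ ψ : 𝓢(ℝ, ℝ)) :
    ∫ x, realMultiplier m φ x * ψ x = ∫ x, φ x * realMultiplier m' ψ x := by
  apply Complex.ofReal_injective
  rw [← integral_inner_realFourier, ← integral_inner_realFourier]
  refine integral_congr_ae (Eventually.of_forall fun ξ => ?_)
  simp only [realFourier_realMultiplier hm hsymm, realFourier_realMultiplier hm' hsymm', h,
    RCLike.inner_apply, map_mul]
  ring

/-- The symbol of `(1 - ∂ₓ²)^{-1/2}`. -/
def besselSymbol (ξ : ℝ) : ℝ := (Real.sqrt (1 + (2 * Real.pi * ξ) ^ 2))⁻¹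

theorem one_add_sq_pos (ξ : ℝ) : 0 < 1 + (2 * Real.pi * ξ) ^ 2 := by positivity

theorem besselSymbol_pos (ξ : ℝ) : 0 < besselSymbol ξ :=
  inv_pos.2 (Real.sqrt_pos.2 (one_add_sq_pos ξ))

theorem besselSymbol_sq (ξ : ℝ) : besselSymbol ξ ^ 2 * (1 + (2 * Real.pi * ξ) ^ 2) = 1 := by
  rw [besselSymbol, inv_pow, Real.sq_sqrt (one_add_sq_pos ξ).le,
    inv_mul_cancel₀ (one_add_sq_pos ξ).ne']

theorem besselSymbol_neg (ξ : ℝ) : besselSymbol (-ξ) = besselSymbol ξ := by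
  simp [besselSymbol]

@[fun_prop]
theorem besselSymbol_hasTemperateGrowth : besselSymbol.HasTemperateGrowth := by
  have h1 := (Function.hasTemperateGrowth_one_add_norm_sq_rpow ℝ (-1 / 2 : ℝ)).comp
    (f := fun ξ : ℝ => 2 * Real.pi * ξ) (by fun_prop)
  have h2 : besselSymbol = (fun x : ℝ => (1 + ‖x‖ ^ 2) ^ (-1 / 2 : ℝ)) ∘
      fun ξ : ℝ => 2 * Real.pi * ξ := by
    funext ξ
    simp only [Function.comp_apply, Real.norm_eq_abs, sq_abs, besselSymbol]
    rw [Real.sqrt_eq_rpow, ← Real.rpow_neg (one_add_sq_pos ξ).le]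
    norm_num
  rw [h2]
  exact h1

/-- The symbol of `∂ₓ(1 - ∂ₓ²)^{-1/2}`. -/
def rieszSymbol (ξ : ℝ) : ℂ := (2 * Real.pi * ξ : ℝ) * Complex.I * besselSymbol ξ

theorem besselSymbol_ofReal_hasTemperateGrowth :
    (fun ξ => (besselSymbol ξ : ℂ)).HasTemperateGrowth := by fun_prop

theorem rieszSymbol_hasTemperateGrowth : rieszSymbol.HasTemperateGrowth := by
  unfold rieszSymbol
  fun_prop

/-- `(1 - ∂ₓ²)^{-1/2}` on real Schwartz functions. -/
def schwartzBessel : 𝓢(ℝ, ℝ) →L[ℝ] 𝓢(ℝ, ℝ) := realMultiplier fun ξ => besselSymbol ξ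

/-- `∂ₓ(1 - ∂ₓ²)^{-1/2}` on real Schwartz functions. -/
def schwartzRiesz : 𝓢(ℝ, ℝ) →L[ℝ] 𝓢(ℝ, ℝ) := realMultiplier rieszSymbol

theorem besselSymbol_symm (ξ : ℝ) :
    (besselSymbol (-ξ) : ℂ) = (starRingEnd ℂ) (besselSymbol ξ : ℂ) := by
  rw [besselSymbol_neg, Complex.conj_ofReal]

theorem rieszSymbol_symm (ξ : ℝ) : rieszSymbol (-ξ) = (starRingEnd ℂ) (rieszSymbol ξ) := by
  simp only [rieszSymbol, besselSymbol_neg, map_mul, Complex.conj_ofReal, Complex.conj_I]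
  push_cast
  ring

theorem realFourier_schwartzBessel (φ : 𝓢(ℝ, ℝ)) (ξ : ℝ) :
    realFourier (schwartzBessel φ) ξ = besselSymbol ξ * realFourier φ ξ :=
  realFourier_realMultiplier besselSymbol_ofReal_hasTemperateGrowth besselSymbol_symm φ ξ

theorem realFourier_schwartzRiesz (φ : 𝓢(ℝ, ℝ)) (ξ : ℝ) :
    realFourier (schwartzRiesz φ) ξ = rieszSymbol ξ * realFourier φ ξ :=
  realFourier_realMultiplier rieszSymbol_hasTemperateGrowth rieszSymbol_symm φ ξ

theorem realFourier_ext {φ ψ : 𝓢(ℝ, ℝ)} (h : ∀ ξ, realFourier φ ξ = realFourier ψ ξ) : φ = ψ :=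
  realFourier_injective (SchwartzMap.ext h)

theorem realFourier_sub (φ ψ : 𝓢(ℝ, ℝ)) (ξ : ℝ) :
    realFourier (φ - ψ) ξ = realFourier φ ξ - realFourier ψ ξ := by
  have h : 𝓕 (schwartzOfReal (φ - ψ)) = 𝓕 (schwartzOfReal φ) - 𝓕 (schwartzOfReal ψ) := by
    rw [map_sub]
    exact map_sub (FourierTransform.fourierCLM ℂ 𝓢(ℝ, ℂ)) _ _
  rw [realFourier, h]
  rfl

theorem deriv_schwartzBessel (φ : 𝓢(ℝ, ℝ)) :
    SchwartzMap.derivCLM ℝ ℝ (schwartzBessel φ) = schwartzRiesz φ := by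
  refine realFourier_ext fun ξ => ?_
  rw [realFourier_deriv, realFourier_schwartzBessel, realFourier_schwartzRiesz, rieszSymbol]
  ring

theorem schwartzBessel_deriv (φ : 𝓢(ℝ, ℝ)) :
    schwartzBessel (SchwartzMap.derivCLM ℝ ℝ φ) = schwartzRiesz φ := by
  refine realFourier_ext fun ξ => ?_
  rw [realFourier_schwartzBessel, realFourier_deriv, realFourier_schwartzRiesz, rieszSymbol]
  ring

theorem schwartzBessel_riesz (φ : 𝓢(ℝ, ℝ)) :
    schwartzBessel (schwartzRiesz φ) = schwartzRiesz (schwartzBessel φ) := by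
  refine realFourier_ext fun ξ => ?_
  simp only [realFourier_schwartzBessel, realFourier_schwartzRiesz]
  ring

/-- With `R = ∂ₓ P` this is `(1 - ∂ₓ²) P² = 1`, expressed through bounded operators only. It
replaces explicit use of the unbounded `Q` below. -/
theorem schwartzBessel_sq_sub (φ : 𝓢(ℝ, ℝ)) :
    schwartzBessel (schwartzBessel φ) - schwartzRiesz (schwartzRiesz φ) = φ := by
  refine realFourier_ext fun ξ => ?_
  simp only [realFourier_sub, realFourier_schwartzBessel, realFourier_schwartzRiesz, rieszSymbol]
  have h : (besselSymbol ξ : ℂ) ^ 2 * (1 + ((2 * Real.pi * ξ : ℝ) : ℂ) ^ 2) = 1 := by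
    exact_mod_cast besselSymbol_sq ξ
  linear_combination realFourier φ ξ * h -
    ((2 * Real.pi * ξ : ℝ) : ℂ) ^ 2 * (besselSymbol ξ : ℂ) ^ 2 * realFourier φ ξ *
      Complex.I_sq

theorem integral_schwartzBessel_mul (φ ψ : 𝓢(ℝ, ℝ)) :
    ∫ x, schwartzBessel φ x * ψ x = ∫ x, φ x * schwartzBessel ψ x :=
  integral_realMultiplier_mul besselSymbol_ofReal_hasTemperateGrowth besselSymbol_symm
    besselSymbol_ofReal_hasTemperateGrowth besselSymbol_symm
    (fun _ => (Complex.conj_ofReal _).symm) φ ψ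

theorem integral_schwartzRiesz_mul (φ ψ : 𝓢(ℝ, ℝ)) :
    ∫ x, schwartzRiesz φ x * ψ x = -∫ x, φ x * schwartzRiesz ψ x := by
  have h := SchwartzMap.integral_mul_deriv_eq_neg_deriv_mul ψ (schwartzBessel φ)
  rw [← deriv_schwartzBessel, ← schwartzBessel_deriv, ← integral_schwartzBessel_mul]
  simp only [SchwartzMap.derivCLM_apply]
  simp only [mul_comm _ (ψ _), h, mul_comm (deriv ψ _)]

end SchwartzMultipliers

/-! ### The operators `P` and `R = ∂ₓ P` on `L²` -/

section L2Operators

theorem denseRange_toLp_real : DenseRange fun φ : 𝓢(ℝ, ℝ) => (φ.toLp 2 : RealL2) :=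
  SchwartzMap.denseRange_toLpCLM (F := ℝ) (E := ℝ) (μ := volume) ENNReal.ofNat_ne_top

theorem inner_toLp_right (w : RealL2) (ψ : 𝓢(ℝ, ℝ)) : ⟪w, ψ.toLp 2⟫_ℝ = ∫ x, w x * ψ x := by
  rw [L2.inner_def]
  refine integral_congr_ae ?_
  filter_upwards [ψ.coeFn_toLp 2] with x hx
  rw [hx]
  simp [mul_comm]

theorem inner_toLp_toLp (φ ψ : 𝓢(ℝ, ℝ)) :
    ⟪(φ.toLp 2 : RealL2), ψ.toLp 2⟫_ℝ = ∫ x, φ x * ψ x := by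
  rw [inner_toLp_right]
  refine integral_congr_ae ?_
  filter_upwards [φ.coeFn_toLp 2] with x hx
  rw [hx]

theorem toLp_eq_sub (φ : 𝓢(ℝ, ℝ)) : (φ.toLp 2 : RealL2) =
    ((schwartzBessel (schwartzBessel φ)).toLp 2 : RealL2) -
      ((schwartzRiesz (schwartzRiesz φ)).toLp 2 : RealL2) := by
  have h := map_sub (SchwartzMap.toLpCLM ℝ ℝ 2 (volume : Measure ℝ))
    (schwartzBessel (schwartzBessel φ)) (schwartzRiesz (schwartzRiesz φ))
  rwa [schwartzBessel_sq_sub] at h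

/-- Pair `φ = P² φ - R² φ` with `φ`, using that `P` is symmetric and `R` skew. It yields the `L²`
bounds for the extensions and the isometry of `P : L² → H¹`. -/
theorem norm_sq_schwartzBessel_add (φ : 𝓢(ℝ, ℝ)) :
    ‖((schwartzBessel φ).toLp 2 : RealL2)‖ ^ 2 + ‖((schwartzRiesz φ).toLp 2 : RealL2)‖ ^ 2 =
      ‖(φ.toLp 2 : RealL2)‖ ^ 2 := by
  have e := toLp_eq_sub φ
  have h : ⟪(φ.toLp 2 : RealL2), φ.toLp 2⟫_ℝ =
      ⟪((schwartzBessel φ).toLp 2 : RealL2), (schwartzBessel φ).toLp 2⟫_ℝ +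
      ⟪((schwartzRiesz φ).toLp 2 : RealL2), (schwartzRiesz φ).toLp 2⟫_ℝ := by
    have hsub : ∀ f g h : RealL2, f = g - h → ⟪f, f⟫_ℝ = ⟪f, g⟫_ℝ - ⟪f, h⟫_ℝ := by
      intro f g h hf
      rw [← inner_sub_right, ← hf]
    rw [hsub _ _ _ e]
    simp only [inner_toLp_toLp]
    rw [← integral_schwartzBessel_mul φ (schwartzBessel φ),
      integral_schwartzRiesz_mul φ (schwartzRiesz φ)]
    ring
  simp only [← real_inner_self_eq_norm_sq]
  exact h.symm

/-- `(1 - ∂ₓ²)^{-1/2}` on `L²`. -/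
def bessel : RealL2 →L[ℝ] RealL2 :=
  ((SchwartzMap.toLpCLM ℝ ℝ 2 volume).comp schwartzBessel).toLinearMap.extendOfNorm
    (SchwartzMap.toLpCLM ℝ ℝ 2 (volume : Measure ℝ)).toLinearMap

/-- `∂ₓ(1 - ∂ₓ²)^{-1/2}` on `L²`. -/
def riesz : RealL2 →L[ℝ] RealL2 :=
  ((SchwartzMap.toLpCLM ℝ ℝ 2 volume).comp schwartzRiesz).toLinearMap.extendOfNorm
    (SchwartzMap.toLpCLM ℝ ℝ 2 (volume : Measure ℝ)).toLinearMap

theorem bessel_toLp (φ : 𝓢(ℝ, ℝ)) : bessel (φ.toLp 2) = (schwartzBessel φ).toLp 2 := by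
  refine LinearMap.extendOfNorm_eq (𝕜 := ℝ)
    (e := (SchwartzMap.toLpCLM ℝ ℝ 2 (volume : Measure ℝ)).toLinearMap)
    denseRange_toLp_real ⟨1, fun ψ => ?_⟩ φ
  rw [one_mul]
  refine le_of_sq_le_sq ?_ (norm_nonneg _)
  have := norm_sq_schwartzBessel_add ψ
  exact (le_add_of_nonneg_right (sq_nonneg _)).trans this.le

theorem riesz_toLp (φ : 𝓢(ℝ, ℝ)) : riesz (φ.toLp 2) = (schwartzRiesz φ).toLp 2 := by
  refine LinearMap.extendOfNorm_eq (𝕜 := ℝ)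
    (e := (SchwartzMap.toLpCLM ℝ ℝ 2 (volume : Measure ℝ)).toLinearMap)
    denseRange_toLp_real ⟨1, fun ψ => ?_⟩ φ
  rw [one_mul]
  refine le_of_sq_le_sq ?_ (norm_nonneg _)
  have := norm_sq_schwartzBessel_add ψ
  exact (le_add_of_nonneg_left (sq_nonneg _)).trans this.le

theorem norm_sq_bessel_add (f : RealL2) : ‖bessel f‖ ^ 2 + ‖riesz f‖ ^ 2 = ‖f‖ ^ 2 := by
  refine denseRange_toLp_real.induction_on f (isClosed_eq (by fun_prop) (by fun_prop)) fun φ => ?_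
  rw [bessel_toLp, riesz_toLp]
  exact norm_sq_schwartzBessel_add φ

theorem bessel_symm (f g : RealL2) : ⟪bessel f, g⟫_ℝ = ⟪f, bessel g⟫_ℝ := by
  refine denseRange_toLp_real.induction_on f (isClosed_eq (by fun_prop) (by fun_prop)) fun φ => ?_
  refine denseRange_toLp_real.induction_on g (isClosed_eq (by fun_prop) (by fun_prop)) fun ψ => ?_
  rw [bessel_toLp, bessel_toLp, inner_toLp_toLp, inner_toLp_toLp, integral_schwartzBessel_mul]

theorem riesz_skew (f g : RealL2) : ⟪riesz f, g⟫_ℝ = -⟪f, riesz g⟫_ℝ := by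
  refine denseRange_toLp_real.induction_on f (isClosed_eq (by fun_prop) (by fun_prop)) fun φ => ?_
  refine denseRange_toLp_real.induction_on g (isClosed_eq (by fun_prop) (by fun_prop)) fun ψ => ?_
  rw [riesz_toLp, riesz_toLp, inner_toLp_toLp, inner_toLp_toLp, integral_schwartzRiesz_mul]

theorem bessel_riesz (f : RealL2) : bessel (riesz f) = riesz (bessel f) := by
  refine denseRange_toLp_real.induction_on f (isClosed_eq (by fun_prop) (by fun_prop)) fun φ => ?_
  rw [riesz_toLp, bessel_toLp, bessel_toLp, riesz_toLp, schwartzBessel_riesz]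

theorem bessel_sq_sub (f : RealL2) : bessel (bessel f) - riesz (riesz f) = f := by
  refine denseRange_toLp_real.induction_on f (isClosed_eq (by fun_prop) (by fun_prop)) fun φ => ?_
  rw [riesz_toLp, bessel_toLp, bessel_toLp, riesz_toLp]
  exact (toLp_eq_sub φ).symm

theorem inner_bessel_self_nonneg (f : RealL2) : 0 ≤ ⟪bessel f, f⟫_ℝ := by
  refine denseRange_toLp_real.induction_on f (isClosed_le (by fun_prop) (by fun_prop)) fun φ => ?_
  rw [bessel_toLp, inner_toLp_toLp]
  have h := integral_inner_realFourier (schwartzBessel φ) φ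
  have h2 : ∫ ξ, ⟪realFourier (schwartzBessel φ) ξ, realFourier φ ξ⟫_ℂ =
      ((∫ ξ, besselSymbol ξ * ‖realFourier φ ξ‖ ^ 2 : ℝ) : ℂ) := by
    rw [← integral_complex_ofReal]
    refine integral_congr_ae (Eventually.of_forall fun ξ => ?_)
    simp only [realFourier_schwartzBessel, RCLike.inner_apply, map_mul, Complex.conj_ofReal]
    push_cast
    rw [← Complex.mul_conj']
    ring
  rw [h2] at h
  rw [← Complex.ofReal_injective h]
  exact integral_nonneg fun ξ => mul_nonneg (besselSymbol_pos ξ).le (sq_nonneg _)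

theorem hasWeakDeriv_toLp (φ : 𝓢(ℝ, ℝ)) :
    HasWeakDeriv (φ.toLp 2) ((SchwartzMap.derivCLM ℝ ℝ φ).toLp 2) := by
  rw [hasWeakDeriv_iff_inner]
  intro ψ
  rw [inner_toLp_toLp, inner_toLp_toLp]
  exact SchwartzMap.integral_mul_deriv_eq_neg_deriv_mul φ ψ

theorem isClosed_setOf_hasWeakDeriv : IsClosed {p : RealL2 × RealL2 | HasWeakDeriv p.1 p.2} := by
  simp only [hasWeakDeriv_iff_inner, Set.ofPred_forall]
  exact isClosed_iInter fun φ => isClosed_eq (by fun_prop) (by fun_prop)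

theorem hasWeakDeriv_bessel (f : RealL2) : HasWeakDeriv (bessel f) (riesz f) := by
  refine denseRange_toLp_real.induction_on f
    (isClosed_setOf_hasWeakDeriv.preimage (f := fun f => (bessel f, riesz f)) (by fun_prop))
    fun φ => ?_
  rw [bessel_toLp, riesz_toLp, ← deriv_schwartzBessel]
  exact hasWeakDeriv_toLp _

/-- It shows `H¹ = P L²`: the element `P u - R v` plays the role of `Q u`. This identity underlies
the surjectivity of `Q⁻¹`, integration by parts and the density of Schwartz functions. -/
theorem HasWeakDeriv.bessel_sub {u v : RealL2} (h : HasWeakDeriv u v) :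
    bessel (bessel u - riesz v) = u := by
  rw [hasWeakDeriv_iff_inner] at h
  rw [← sub_eq_zero]
  refine denseRange_toLp_real.eq_zero_of_inner_left ℝ fun φ => ?_
  have h1 := h (schwartzBessel (schwartzRiesz φ))
  rw [deriv_schwartzBessel, ← riesz_toLp, ← riesz_toLp, ← bessel_toLp, ← riesz_toLp] at h1
  have h2 := congrArg (fun g => ⟪u, g⟫_ℝ) (bessel_sq_sub (φ.toLp 2))
  simp only [inner_sub_right] at h2
  rw [map_sub, inner_sub_left, inner_sub_left, bessel_symm, bessel_symm, bessel_symm, riesz_skew,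
    ← bessel_riesz]
  linarith

theorem HasWeakDeriv.map_bessel {u v : RealL2} (h : HasWeakDeriv u v) :
    HasWeakDeriv (bessel u) (bessel v) := by
  rw [hasWeakDeriv_iff_inner] at h ⊢
  intro φ
  have h1 := h (schwartzBessel φ)
  rw [deriv_schwartzBessel, ← schwartzBessel_deriv, ← bessel_toLp, ← bessel_toLp] at h1
  rw [bessel_symm, bessel_symm, h1]

theorem HasWeakDeriv.riesz_eq {u v : RealL2} (h : HasWeakDeriv u v) : riesz u = bessel v :=
  (hasWeakDeriv_bessel u).unique h.map_bessel

theorem bessel_injective : Function.Injective bessel := by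
  rw [injective_iff_map_eq_zero]
  intro f hf
  have h1 := hasWeakDeriv_bessel f
  rw [hf] at h1
  have h2 := h1.unique hasWeakDeriv_zero
  have h3 := bessel_sq_sub f
  rwa [hf, h2, map_zero, map_zero, sub_zero, eq_comm] at h3

theorem HasWeakDeriv.map_riesz {u v : RealL2} (h : HasWeakDeriv u v) :
    HasWeakDeriv (riesz u) (riesz v) := by
  rw [h.riesz_eq]
  exact hasWeakDeriv_bessel v

theorem HasWeakDeriv.sub {u u₁ v v₁ : RealL2} (hu : HasWeakDeriv u u₁) (hv : HasWeakDeriv v v₁) :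
    HasWeakDeriv (u - v) (u₁ - v₁) := by
  have := hu.add (hv.smul (-1))
  rwa [neg_one_smul, neg_one_smul, ← sub_eq_add_neg, ← sub_eq_add_neg] at this

/-- Integration by parts in `H¹`. -/
theorem HasWeakDeriv.inner_eq_neg {u u₁ v v₁ : RealL2} (hu : HasWeakDeriv u u₁)
    (hv : HasWeakDeriv v v₁) : ⟪u₁, v⟫_ℝ = -⟪u, v₁⟫_ℝ := by
  have h1 := hv.bessel_sub
  set g := bessel v - riesz v₁
  have h2 : v₁ = riesz g := by
    rw [← h1] at hv
    exact hv.unique (hasWeakDeriv_bessel g)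
  rw [← h1, h2, ← bessel_symm, ← hu.riesz_eq, riesz_skew]

end L2Operators

/-! ### Identification of `P` as a Fourier multiplier on `L²` -/

section Fourier

/-- The Fourier transform on real `L²`. -/
def fourierL2 (f : RealL2) : Lp ℂ 2 (volume : Measure ℝ) := 𝓕 (Complex.ofRealCLM.compLp f)

theorem continuous_fourierL2 : Continuous fourierL2 :=
  (MeasureTheory.Lp.fourierTransformₗᵢ ℝ ℂ).continuous.comp
    (Complex.ofRealCLM.compLpL 2 (volume : Measure ℝ)).continuous

theorem fourierL2_toLp (φ : 𝓢(ℝ, ℝ)) : fourierL2 (φ.toLp 2) = (realFourier φ).toLp 2 := by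
  rw [fourierL2, realFourier, ← SchwartzMap.toLp_fourier_eq]
  congr 1

theorem besselSymbol_le_one (ξ : ℝ) : besselSymbol ξ ≤ 1 := by
  refine inv_le_one_of_one_le₀ ?_
  rw [Real.one_le_sqrt]
  linarith [sq_nonneg (2 * Real.pi * ξ)]

theorem continuous_besselSymbol : Continuous besselSymbol := by
  unfold besselSymbol
  exact Continuous.inv₀ (by fun_prop) fun ξ => (Real.sqrt_pos.2 (one_add_sq_pos ξ)).ne'

theorem fourierL2_bessel (f : RealL2) :
    fourierL2 (bessel f) =ᵐ[volume] fun ξ => (besselSymbol ξ : ℂ) * fourierL2 f ξ := by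
  have hm : MemLp (fun ξ => (besselSymbol ξ : ℂ)) ⊤ (volume : Measure ℝ) :=
    memLp_top_of_bound (Complex.continuous_ofReal.comp
      continuous_besselSymbol).aestronglyMeasurable 1 (Eventually.of_forall fun ξ => by
        rw [Complex.norm_real, Real.norm_of_nonneg (besselSymbol_pos ξ).le]
        exact besselSymbol_le_one ξ)
  let M : Lp ℂ 2 (volume : Measure ℝ) →L[ℂ] Lp ℂ 2 (volume : Measure ℝ) :=
    (ContinuousLinearMap.mul ℂ ℂ).holderL volume ⊤ 2 2 hm.toLp
  have hM : ∀ g, M g =ᵐ[volume] fun ξ => (besselSymbol ξ : ℂ) * g ξ := by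
    intro g
    filter_upwards [(ContinuousLinearMap.mul ℂ ℂ).coeFn_holder (r := 2) hm.toLp g, hm.coeFn_toLp]
      with ξ h1 h2
    rw [show M g = (ContinuousLinearMap.mul ℂ ℂ).holder 2 hm.toLp g from rfl, h1, h2]
    rfl
  have key : fourierL2 (bessel f) = M (fourierL2 f) := by
    have hc := continuous_fourierL2
    refine denseRange_toLp_real.induction_on f (isClosed_eq (by fun_prop) (by fun_prop))
      fun φ => ?_
    rw [bessel_toLp, fourierL2_toLp, fourierL2_toLp]
    ext1
    filter_upwards [hM ((realFourier φ).toLp 2), (realFourier φ).coeFn_toLp 2,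
      (realFourier (schwartzBessel φ)).coeFn_toLp 2] with ξ h1 h2 h3
    rw [h1, h2, h3, realFourier_schwartzBessel]
  rw [key]
  exact hM _

end Fourier

/-! ### The isometry `Q` between `H²` and `H¹` -/

namespace SobolevSpace

theorem _root_.HasWeakDeriv.memSobolevSpace_succ {n : ℕ} {u v : RealL2} (h : HasWeakDeriv u v)
    (hv : MemSobolevSpace n v) : MemSobolevSpace (n + 1) u := by
  intro k hk
  rcases k with _ | k
  · simpa [h.weakDeriv_eq] using h
  · rw [Function.iterate_succ_apply, Function.iterate_succ_apply, h.weakDeriv_eq]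
    exact hv k (by omega)

theorem memSobolevSpace_zero (u : RealL2) : MemSobolevSpace 0 u := fun k hk => by omega

variable {n : ℕ}

theorem hasWeakDeriv (u : SobolevSpace (n + 1)) : HasWeakDeriv u.toL2 u.deriv.toL2 :=
  u.mem 0 (by omega)

theorem toL2_incl (u : SobolevSpace (n + 1)) : (incl u).toL2 = u.toL2 := rfl

theorem deriv_incl (u : SobolevSpace (n + 2)) : (incl u).deriv = incl u.deriv := rfl

theorem norm_one_sq (u : SobolevSpace 1) : ‖u‖ ^ 2 = ‖u.toL2‖ ^ 2 + ‖u.deriv.toL2‖ ^ 2 := by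
  rw [norm_sq_eq, Finset.sum_range_succ, Finset.sum_range_one]
  simp only [Nat.choose_self, Nat.choose_zero_right, Nat.cast_one, one_mul]
  rfl

theorem norm_two_sq (u : SobolevSpace 2) :
    ‖u‖ ^ 2 = ‖u.toL2‖ ^ 2 + 2 * ‖u.deriv.toL2‖ ^ 2 + ‖u.deriv.deriv.toL2‖ ^ 2 := by
  rw [norm_sq_eq, Finset.sum_range_succ, Finset.sum_range_succ, Finset.sum_range_one]
  simp only [Nat.choose_self, Nat.choose_zero_right, Nat.choose_one_right, Nat.cast_one, one_mul,
    Nat.cast_ofNat]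
  rfl

theorem inner_one (u v : SobolevSpace 1) :
    ⟪u, v⟫_ℝ = ⟪u.toL2, v.toL2⟫_ℝ + ⟪u.deriv.toL2, v.deriv.toL2⟫_ℝ := by
  rw [inner_eq, Finset.sum_range_succ, Finset.sum_range_one]
  simp only [Nat.choose_self, Nat.choose_zero_right, Nat.cast_one, one_mul]
  rfl

/-- The element of `H^{n+1}` with a given derivative in `Hⁿ`. -/
def mk (u : RealL2) (v : SobolevSpace n) (h : HasWeakDeriv u v.toL2) : SobolevSpace (n + 1) :=
  ⟨u, h.memSobolevSpace_succ v.mem⟩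

theorem toL2_mk (u : RealL2) (v : SobolevSpace n) (h : HasWeakDeriv u v.toL2) :
    (mk u v h).toL2 = u := rfl

theorem deriv_mk (u : RealL2) (v : SobolevSpace n) (h : HasWeakDeriv u v.toL2) :
    (mk u v h).deriv = v :=
  toL2_injective ((mk u v h).hasWeakDeriv.unique h)

theorem ext {u v : SobolevSpace n} (h : u.toL2 = v.toL2) : u = v := toL2_injective h

/-- An `L²` function as an element of `H⁰`. -/
def ofL2 (u : RealL2) : SobolevSpace 0 := ⟨u, memSobolevSpace_zero u⟩

/-- The element of `H¹` with a given derivative in `L²`. -/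
def mkOne (u v : RealL2) (h : HasWeakDeriv u v) : SobolevSpace 1 := mk u (ofL2 v) h

theorem toL2_mkOne (u v : RealL2) (h : HasWeakDeriv u v) : (mkOne u v h).toL2 = u := rfl

theorem toL2_deriv_mkOne (u v : RealL2) (h : HasWeakDeriv u v) :
    (mkOne u v h).deriv.toL2 = v :=
  congrArg toL2 (deriv_mk u (ofL2 v) h)

/-- `(1 - ∂ₓ²)^{-1/2}` as an isometry of `L²` into `H¹`. -/
def besselL2 : RealL2 →ₗᵢ[ℝ] SobolevSpace 1 where
  toFun f := mkOne (bessel f) (riesz f) (hasWeakDeriv_bessel f)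
  map_add' f g := ext (map_add bessel f g)
  map_smul' c f := ext (map_smul bessel c f)
  norm_map' f := by
    refine (sq_eq_sq₀ (norm_nonneg _) (norm_nonneg _)).1 ?_
    change ‖mkOne (bessel f) (riesz f) (hasWeakDeriv_bessel f)‖ ^ 2 = _
    rw [norm_one_sq, toL2_mkOne, toL2_deriv_mkOne, norm_sq_bessel_add]

theorem toL2_besselL2 (f : RealL2) : (besselL2 f).toL2 = bessel f := rfl

theorem toL2_deriv_besselL2 (f : RealL2) : (besselL2 f).deriv.toL2 = riesz f :=
  toL2_deriv_mkOne _ _ (hasWeakDeriv_bessel f)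

theorem besselL2_surjective : Function.Surjective besselL2 := fun u =>
  ⟨bessel u.toL2 - riesz u.deriv.toL2, ext u.hasWeakDeriv.bessel_sub⟩

theorem hasWeakDeriv_bessel_toL2 (u : SobolevSpace 1) :
    HasWeakDeriv (bessel u.toL2) (besselL2 u.deriv.toL2).toL2 := by
  rw [toL2_besselL2]
  exact u.hasWeakDeriv.map_bessel

/-- `(1 - ∂ₓ²)^{-1/2}` as an isometry of `H¹` into `H²`. -/
def besselUp : SobolevSpace 1 →ₗᵢ[ℝ] SobolevSpace 2 where
  toFun u := mk (bessel u.toL2) (besselL2 u.deriv.toL2) u.hasWeakDeriv_bessel_toL2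
  map_add' u v := ext (by
    rw [toL2_mk, map_add, map_add, map_add]
    rfl)
  map_smul' c u := ext (by
    rw [toL2_mk, map_smul, map_smul, map_smul]
    rfl)
  norm_map' u := by
    refine (sq_eq_sq₀ (norm_nonneg _) (norm_nonneg _)).1 ?_
    change ‖mk (bessel u.toL2) (besselL2 u.deriv.toL2) u.hasWeakDeriv_bessel_toL2‖ ^ 2 = _
    -- Apply `‖f‖² = ‖P f‖² + ‖R f‖²` to `u` and to `u'`. Since `R u = P u'`, the middle term occurs
    -- twice, matching the binomial coefficient 2.
    rw [norm_two_sq, toL2_mk, deriv_mk, toL2_deriv_besselL2, toL2_besselL2, norm_one_sq,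
      ← norm_sq_bessel_add u.toL2, ← norm_sq_bessel_add u.deriv.toL2, u.hasWeakDeriv.riesz_eq]
    ring

theorem toL2_besselUp (u : SobolevSpace 1) : (besselUp u).toL2 = bessel u.toL2 := rfl

theorem deriv_besselUp (u : SobolevSpace 1) : (besselUp u).deriv = besselL2 u.deriv.toL2 :=
  deriv_mk _ _ u.hasWeakDeriv_bessel_toL2

theorem toL2_incl_besselUp (u : SobolevSpace 1) : (incl (besselUp u)).toL2 = bessel u.toL2 := rfl

theorem toL2_deriv_incl_besselUp (u : SobolevSpace 1) :
    (incl (besselUp u)).deriv.toL2 = bessel u.deriv.toL2 := by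
  rw [deriv_incl, deriv_besselUp]
  rfl

theorem besselUp_surjective : Function.Surjective besselUp := by
  intro u
  refine ⟨mkOne (bessel u.toL2 - riesz u.deriv.toL2)
    (bessel u.deriv.toL2 - riesz u.deriv.deriv.toL2)
    (u.hasWeakDeriv.map_bessel.sub u.deriv.hasWeakDeriv.map_riesz), ext ?_⟩
  rw [toL2_besselUp, toL2_mkOne]
  exact u.hasWeakDeriv.bessel_sub

/-- `(1 - ∂ₓ²)^{1/2}` as an isometric isomorphism of `H²` onto `H¹`. -/
def sqrtOneSub : SobolevSpace 2 ≃ₗᵢ[ℝ] SobolevSpace 1 :=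
  (LinearIsometryEquiv.ofSurjective besselUp besselUp_surjective).symm

theorem sqrtOneSub_besselUp (u : SobolevSpace 1) : sqrtOneSub (besselUp u) = u :=
  sqrtOneSub.apply_symm_apply u

theorem isSqrtOneSubDerivSq_sqrtOneSub : IsSqrtOneSubDerivSq sqrtOneSub := by
  intro v
  obtain ⟨u, rfl⟩ := besselUp_surjective v
  rw [sqrtOneSub_besselUp]
  filter_upwards [fourierL2_bessel u.toL2] with ξ h
  change fourierL2 u.toL2 ξ = _ * fourierL2 (bessel u.toL2) ξ
  rw [h, ← mul_assoc, besselSymbol]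
  have h1 : (Real.sqrt (1 + (2 * Real.pi * ξ) ^ 2) : ℂ) ≠ 0 := by
    exact_mod_cast (Real.sqrt_pos.2 (one_add_sq_pos ξ)).ne'
  rw [Complex.ofReal_inv, mul_inv_cancel₀ h1, one_mul]

theorem incl_injective : Function.Injective (incl (n := n)) := fun u v h => by
  have := congrArg toL2 h
  rw [toL2_incl, toL2_incl] at this
  exact ext this

theorem inner_incl_besselUp (u v : SobolevSpace 1) :
    ⟪incl (besselUp u), v⟫_ℝ = ⟪u, incl (besselUp v)⟫_ℝ := by
  rw [inner_one, inner_one]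
  simp only [toL2_incl_besselUp, toL2_deriv_incl_besselUp, bessel_symm]

theorem inner_incl_besselUp_self_nonneg (u : SobolevSpace 1) : 0 ≤ ⟪incl (besselUp u), u⟫_ℝ := by
  rw [inner_one, toL2_incl_besselUp, toL2_deriv_incl_besselUp]
  exact add_nonneg (inner_bessel_self_nonneg _) (inner_bessel_self_nonneg _)

end SobolevSpace

/-! ### The Sobolev inequality for Schwartz functions -/

section Schwartz

theorem SchwartzMap.integrable_mul_real (φ ψ : 𝓢(ℝ, ℝ)) : Integrable fun x => φ x * ψ x :=
  ((SchwartzMap.pairing (ContinuousLinearMap.mul ℝ ℝ) φ ψ).integrable (μ := volume)).congr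
    (Eventually.of_forall fun x => by simp)

/-- One-dimensional Sobolev inequality for Schwartz functions. -/
theorem SchwartzMap.sq_apply_le (φ : 𝓢(ℝ, ℝ)) (x : ℝ) :
    φ x ^ 2 ≤ ‖(φ.toLp 2 : RealL2)‖ ^ 2 +
      ‖((SchwartzMap.derivCLM ℝ ℝ φ).toLp 2 : RealL2)‖ ^ 2 := by
  have hi : Integrable fun y => 2 * (φ y * deriv φ y) :=
    (SchwartzMap.integrable_mul_real φ (SchwartzMap.derivCLM ℝ ℝ φ)).const_mul 2
  have hd : ∀ y, HasDerivAt (fun y => φ y ^ 2) (2 * (φ y * deriv φ y)) y := by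
    intro y
    have := (φ.hasDerivAt y).pow 2
    refine this.congr_deriv ?_
    simp only [Nat.cast_ofNat]
    ring
  have h0 : Tendsto (fun y => φ y ^ 2) atBot (𝓝 0) := by
    have h1 : Tendsto φ atBot (𝓝 0) :=
      (SchwartzMap.tendsto_cocompact φ).mono_left atBot_le_cocompact
    simpa using h1.pow 2
  have h := integral_Iic_of_hasDerivAt_of_tendsto (a := x)
    (hd x).continuousAt.continuousWithinAt (fun y _ => hd y) hi.integrableOn h0
  rw [sub_zero] at h
  rw [← h, ← real_inner_self_eq_norm_sq, ← real_inner_self_eq_norm_sq, inner_toLp_toLp,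
    inner_toLp_toLp, ← integral_add (SchwartzMap.integrable_mul_real φ φ)
      (SchwartzMap.integrable_mul_real _ _)]
  have hi2 : Integrable fun y => φ y * φ y +
      SchwartzMap.derivCLM ℝ ℝ φ y * SchwartzMap.derivCLM ℝ ℝ φ y :=
    (SchwartzMap.integrable_mul_real φ φ).add (SchwartzMap.integrable_mul_real _ _)
  calc ∫ y in Set.Iic x, 2 * (φ y * deriv φ y)
      ≤ ∫ y in Set.Iic x, (φ y * φ y +
          SchwartzMap.derivCLM ℝ ℝ φ y * SchwartzMap.derivCLM ℝ ℝ φ y) := by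
        refine integral_mono hi.integrableOn hi2.integrableOn fun y => ?_
        simp only [SchwartzMap.derivCLM_apply]
        nlinarith [sq_nonneg (φ y - deriv φ y)]
    _ ≤ _ := setIntegral_le_integral hi2 (Eventually.of_forall fun y => by
        simp only [SchwartzMap.derivCLM_apply, Pi.zero_apply]
        nlinarith [sq_nonneg (φ y), sq_nonneg (deriv φ y)])

end Schwartz

/-! ### Multiplication in `H¹` and the energy estimate -/

namespace SobolevSpace

theorem norm_deriv_le {n : ℕ} (u : SobolevSpace (n + 1)) : ‖u.deriv‖ ≤ ‖u‖ := by
  refine le_of_sq_le_sq ?_ (norm_nonneg _)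
  rw [norm_sq_eq, norm_sq_eq, Finset.sum_range_succ' _ (n + 1)]
  refine le_add_of_le_of_nonneg (Finset.sum_le_sum fun k _ => ?_) (by positivity)
  refine mul_le_mul_of_nonneg_right ?_ (by positivity)
  have : n.choose k ≤ (n + 1).choose (k + 1) := by
    rw [Nat.choose_succ_succ]
    omega
  exact_mod_cast this

theorem norm_incl_le {n : ℕ} (u : SobolevSpace (n + 1)) : ‖incl u‖ ≤ ‖u‖ := by
  have h : ‖incl (n := n)‖ ≤ 1 := LinearMap.mkContinuous_norm_le _ zero_le_one _
  simpa using incl.le_of_opNorm_le h u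

/-- The derivative as a bounded operator. -/
def derivL {n : ℕ} : SobolevSpace (n + 1) →L[ℝ] SobolevSpace n :=
  LinearMap.mkContinuous
    { toFun := deriv
      map_add' := fun u v => ext ((u + v).hasWeakDeriv.unique (by
        rw [map_add, map_add]
        exact u.hasWeakDeriv.add v.hasWeakDeriv))
      map_smul' := fun c u => ext ((c • u).hasWeakDeriv.unique (by
        rw [map_smul, map_smul]
        exact u.hasWeakDeriv.smul c)) } 1 fun u => by
    rw [one_mul]
    exact norm_deriv_le u

theorem derivL_apply {n : ℕ} (u : SobolevSpace (n + 1)) : derivL u = u.deriv := rfl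

theorem norm_toL2_le {n : ℕ} (u : SobolevSpace n) : ‖u.toL2‖ ≤ ‖u‖ := by
  have h := u.norm_iterate_le (Nat.zero_le n)
  rwa [Function.iterate_zero, id_eq] at h

/-- The embedding of `Hⁿ` into `L²` as a bounded operator. -/
def toL2L {n : ℕ} : SobolevSpace n →L[ℝ] RealL2 :=
  toL2.mkContinuous 1 fun u => by
    rw [one_mul]
    exact norm_toL2_le u

theorem norm_deriv_toL2_le {n : ℕ} (u : SobolevSpace (n + 1)) : ‖u.deriv.toL2‖ ≤ ‖u‖ :=
  (norm_toL2_le _).trans (norm_deriv_le u)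

/-- A Schwartz function as an element of `H¹`. -/
def ofSchwartz (φ : 𝓢(ℝ, ℝ)) : SobolevSpace 1 :=
  mkOne (φ.toLp 2) ((SchwartzMap.derivCLM ℝ ℝ φ).toLp 2) (hasWeakDeriv_toLp φ)

theorem toL2_ofSchwartz (φ : 𝓢(ℝ, ℝ)) : (ofSchwartz φ).toL2 = φ.toLp 2 := rfl

theorem toL2_deriv_ofSchwartz (φ : 𝓢(ℝ, ℝ)) :
    (ofSchwartz φ).deriv.toL2 = (SchwartzMap.derivCLM ℝ ℝ φ).toLp 2 :=
  toL2_deriv_mkOne _ _ (hasWeakDeriv_toLp φ)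

/-- `P` is an isometry of `L²` onto `H¹` preserving Schwartz functions, so density is inherited from
`L²`. -/
theorem denseRange_ofSchwartz : DenseRange ofSchwartz := by
  have h := besselL2_surjective.denseRange.comp denseRange_toLp_real besselL2.continuous
  refine h.mono ?_
  rintro _ ⟨φ, rfl⟩
  refine ⟨schwartzBessel φ, ext ?_⟩
  rw [Function.comp_apply, toL2_besselL2, bessel_toLp, toL2_ofSchwartz]

/-- One-dimensional Sobolev inequality. -/
theorem ae_abs_le_norm (u : SobolevSpace 1) : ∀ᵐ x, |u.toL2 x| ≤ ‖u‖ := by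
  obtain ⟨w, hw, hlim⟩ := mem_closure_iff_seq_limit.1 (denseRange_ofSchwartz u)
  choose φ hφ using hw
  have hlim' : Tendsto (fun k => (w k).toL2) atTop (𝓝 u.toL2) :=
    (toL2L.continuous.tendsto u).comp hlim
  obtain ⟨ns, hns, hae⟩ := (tendstoInMeasure_of_tendsto_Lp hlim').exists_seq_tendsto_ae
  have hb : ∀ k, ∀ᵐ x, |(w k).toL2 x| ≤ ‖w k‖ := by
    intro k
    filter_upwards [(φ k).coeFn_toLp 2] with x hx
    rw [← hφ k, toL2_ofSchwartz, hx]
    refine abs_le_of_sq_le_sq ?_ (norm_nonneg _)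
    rw [norm_one_sq, toL2_ofSchwartz, toL2_deriv_ofSchwartz]
    exact (φ k).sq_apply_le x
  filter_upwards [hae, ae_all_iff.2 hb] with x h1 h2
  exact le_of_tendsto_of_tendsto h1.abs (hlim.norm.comp hns.tendsto_atTop)
    (Eventually.of_forall fun i => h2 (ns i))

theorem memLp_top (u : SobolevSpace 1) : MemLp u.toL2 ⊤ (volume : Measure ℝ) :=
  memLp_top_of_bound (Lp.aestronglyMeasurable _) ‖u‖ u.ae_abs_le_norm

/-- The embedding of `H¹` into `L^∞`. -/
def toLInfty : SobolevSpace 1 →L[ℝ] Lp ℝ ⊤ (volume : Measure ℝ) :=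
  LinearMap.mkContinuous
    { toFun := fun u => u.memLp_top.toLp
      map_add' := fun u v => by
        rw [← MemLp.toLp_add, MemLp.toLp_eq_toLp_iff, map_add]
        exact Lp.coeFn_add _ _
      map_smul' := fun c u => by
        rw [RingHom.id_apply, ← MemLp.toLp_const_smul, MemLp.toLp_eq_toLp_iff, map_smul]
        exact Lp.coeFn_smul _ _ } 1 fun u => by
    rw [one_mul]
    change ‖u.memLp_top.toLp‖ ≤ _
    rw [Lp.norm_toLp]
    refine ENNReal.toReal_le_of_le_ofReal (norm_nonneg _) ?_
    rw [eLpNorm_exponent_top]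
    exact eLpNormEssSup_le_of_ae_bound u.ae_abs_le_norm

theorem coeFn_toLInfty (u : SobolevSpace 1) : toLInfty u =ᵐ[volume] u.toL2 :=
  u.memLp_top.coeFn_toLp

theorem norm_toLInfty_le (u : SobolevSpace 1) : ‖toLInfty u‖ ≤ ‖u‖ := by
  have h : ‖toLInfty‖ ≤ 1 := LinearMap.mkContinuous_norm_le _ zero_le_one _
  simpa using toLInfty.le_of_opNorm_le h u

/-- Multiplication by `H¹` functions on `L²`. -/
def mulL : SobolevSpace 1 →L[ℝ] RealL2 →L[ℝ] RealL2 :=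
  ((ContinuousLinearMap.mul ℝ ℝ).holderL (volume : Measure ℝ) ⊤ 2 2).comp toLInfty

theorem coeFn_mulL (a : SobolevSpace 1) (f : RealL2) :
    mulL a f =ᵐ[volume] fun x => a.toL2 x * f x := by
  filter_upwards [(ContinuousLinearMap.mul ℝ ℝ).coeFn_holder (r := 2) (toLInfty a) f,
    a.coeFn_toLInfty] with x h1 h2
  rw [show mulL a f = (ContinuousLinearMap.mul ℝ ℝ).holder 2 (toLInfty a) f from rfl, h1, h2]
  rfl

theorem norm_mulL_le (a : SobolevSpace 1) (f : RealL2) : ‖mulL a f‖ ≤ ‖a‖ * ‖f‖ := by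
  refine ((ContinuousLinearMap.mul ℝ ℝ).norm_holder_apply_apply_le (r := 2)
    (toLInfty a) f).trans ?_
  rw [ContinuousLinearMap.opNorm_mul, one_mul]
  gcongr
  exact norm_toLInfty_le a

theorem mulL_comm (a b : SobolevSpace 1) : mulL a b.toL2 = mulL b a.toL2 := by
  ext1
  filter_upwards [coeFn_mulL a b.toL2, coeFn_mulL b a.toL2] with x h1 h2
  rw [h1, h2, mul_comm]

theorem inner_mulL (a : SobolevSpace 1) (f g : RealL2) :
    ⟪mulL a f, g⟫_ℝ = ⟪f, mulL a g⟫_ℝ := by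
  rw [L2.inner_def, L2.inner_def]
  refine integral_congr_ae ?_
  filter_upwards [coeFn_mulL a f, coeFn_mulL a g] with x h1 h2
  rw [h1, h2]
  simp only [RCLike.inner_apply, conj_trivial]
  ring

theorem mulL_ofSchwartz (φ ψ : 𝓢(ℝ, ℝ)) : mulL (ofSchwartz φ) (ψ.toLp 2) =
    (SchwartzMap.pairing (ContinuousLinearMap.mul ℝ ℝ) φ ψ).toLp 2 := by
  ext1
  filter_upwards [coeFn_mulL (ofSchwartz φ) (ψ.toLp 2), φ.coeFn_toLp 2, ψ.coeFn_toLp 2,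
    (SchwartzMap.pairing (ContinuousLinearMap.mul ℝ ℝ) φ ψ).coeFn_toLp 2] with x h1 h2 h3 h4
  rw [h1, h4, h3, toL2_ofSchwartz, h2]
  rfl

/-- Product rule. -/
theorem hasWeakDeriv_mulL (a b : SobolevSpace 1) :
    HasWeakDeriv (mulL a b.toL2) (mulL a b.deriv.toL2 + mulL b a.deriv.toL2) := by
  have hc1 : Continuous fun u : SobolevSpace 1 => u.toL2 := toL2L.continuous
  have hc2 : Continuous fun u : SobolevSpace 1 => u.deriv.toL2 := (toL2L.comp derivL).continuous
  refine denseRange_ofSchwartz.induction_on a (isClosed_setOf_hasWeakDeriv.preimage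
    (f := fun a => (mulL a b.toL2, mulL a b.deriv.toL2 + mulL b a.deriv.toL2))
    (by fun_prop)) fun φ => ?_
  refine denseRange_ofSchwartz.induction_on b (isClosed_setOf_hasWeakDeriv.preimage
    (f := fun b => (mulL (ofSchwartz φ) b.toL2,
      mulL (ofSchwartz φ) b.deriv.toL2 + mulL b (ofSchwartz φ).deriv.toL2))
    (by fun_prop)) fun ψ => ?_
  rw [toL2_deriv_ofSchwartz, toL2_deriv_ofSchwartz, toL2_ofSchwartz, mulL_ofSchwartz,
    mulL_ofSchwartz, mulL_ofSchwartz]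
  have h := hasWeakDeriv_toLp (SchwartzMap.pairing (ContinuousLinearMap.mul ℝ ℝ) φ ψ)
  have e : SchwartzMap.derivCLM ℝ ℝ (SchwartzMap.pairing (ContinuousLinearMap.mul ℝ ℝ) φ ψ) =
      SchwartzMap.pairing (ContinuousLinearMap.mul ℝ ℝ) φ (SchwartzMap.derivCLM ℝ ℝ ψ) +
      SchwartzMap.pairing (ContinuousLinearMap.mul ℝ ℝ) ψ (SchwartzMap.derivCLM ℝ ℝ φ) := by
    ext x
    rw [SchwartzMap.derivCLM_apply]
    have hx : HasDerivAt (SchwartzMap.pairing (ContinuousLinearMap.mul ℝ ℝ) φ ψ)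
        (_root_.deriv φ x * ψ x + φ x * _root_.deriv ψ x) x :=
      (φ.hasDerivAt x).mul (ψ.hasDerivAt x)
    rw [hx.deriv, add_apply, SchwartzMap.pairing_apply_apply,
      SchwartzMap.pairing_apply_apply, SchwartzMap.derivCLM_apply, SchwartzMap.derivCLM_apply]
    simp only [ContinuousLinearMap.mul_apply']
    ring
  rw [e] at h
  exact h

theorem norm_le_add (u : SobolevSpace 1) : ‖u‖ ≤ ‖u.toL2‖ + ‖u.deriv.toL2‖ := by
  refine le_of_sq_le_sq ?_ (by positivity)
  rw [norm_one_sq]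
  nlinarith [norm_nonneg u.toL2, norm_nonneg u.deriv.toL2]

/-- The product of two elements of `H¹`. -/
def mulOne (a b : SobolevSpace 1) : SobolevSpace 1 := mkOne _ _ (hasWeakDeriv_mulL a b)

theorem toL2_mulOne (a b : SobolevSpace 1) : (mulOne a b).toL2 = mulL a b.toL2 := rfl

theorem toL2_deriv_mulOne (a b : SobolevSpace 1) :
    (mulOne a b).deriv.toL2 = mulL a b.deriv.toL2 + mulL b a.deriv.toL2 :=
  toL2_deriv_mkOne _ _ (hasWeakDeriv_mulL a b)

theorem norm_mulOne_le (a b : SobolevSpace 1) : ‖mulOne a b‖ ≤ 3 * ‖a‖ * ‖b‖ := by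
  refine (norm_le_add _).trans ?_
  rw [toL2_mulOne, toL2_deriv_mulOne]
  have h1 := norm_mulL_le a b.toL2
  have h2 := norm_mulL_le a b.deriv.toL2
  have h3 := norm_mulL_le b a.deriv.toL2
  have h4 := norm_add_le (mulL a b.deriv.toL2) (mulL b a.deriv.toL2)
  have h5 : ‖a‖ * ‖b.toL2‖ ≤ ‖a‖ * ‖b‖ := by gcongr; exact norm_toL2_le b
  have h6 : ‖a‖ * ‖b.deriv.toL2‖ ≤ ‖a‖ * ‖b‖ := by gcongr; exact norm_deriv_toL2_le b
  have h7 : ‖b‖ * ‖a.deriv.toL2‖ ≤ ‖b‖ * ‖a‖ := by gcongr; exact norm_deriv_toL2_le a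
  linarith

/-- Multiplication in `H¹`. -/
def mulOneL : SobolevSpace 1 →L[ℝ] SobolevSpace 1 →L[ℝ] SobolevSpace 1 :=
  LinearMap.mkContinuous₂
    (LinearMap.mk₂ ℝ mulOne
      (fun a a' b => ext (by simp only [map_add, toL2_mulOne, add_apply]))
      (fun c a b => ext (by simp only [map_smul, toL2_mulOne, smul_apply]))
      (fun a b b' => ext (by simp only [map_add, toL2_mulOne]))
      (fun c a b => ext (by simp only [map_smul, toL2_mulOne]))) 3 norm_mulOne_le

theorem mulOneL_apply (a b : SobolevSpace 1) : mulOneL a b = mulOne a b := rfl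

/-- The differential operator `a ∂ₓ + b` as an operator of `H²` into `H¹`. -/
def firstOrder (a b : SobolevSpace 1) : SobolevSpace 2 →L[ℝ] SobolevSpace 1 :=
  (mulOneL a).comp derivL + (mulOneL b).comp incl

theorem firstOrder_apply (a b : SobolevSpace 1) (u : SobolevSpace 2) :
    firstOrder a b u = mulOne a u.deriv + mulOne b (incl u) := rfl

theorem coeFn_firstOrder (a b : SobolevSpace 1) (u : SobolevSpace 2) :
    (firstOrder a b u).toL2 =ᵐ[volume]
      fun x => a.toL2 x * u.deriv.toL2 x + b.toL2 x * u.toL2 x := by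
  rw [firstOrder_apply, map_add, toL2_mulOne, toL2_mulOne]
  filter_upwards [Lp.coeFn_add (mulL a u.deriv.toL2) (mulL b (incl u).toL2),
    coeFn_mulL a u.deriv.toL2, coeFn_mulL b (incl u).toL2] with x h1 h2 h3
  rw [h1, Pi.add_apply, h2, h3]
  rfl

theorem norm_firstOrder_le (a b : SobolevSpace 1) (u : SobolevSpace 2) :
    ‖firstOrder a b u‖ ≤ 3 * (‖a‖ + ‖b‖) * ‖u‖ := by
  rw [firstOrder_apply]
  have h1 := norm_mulOne_le a u.deriv
  have h2 := norm_mulOne_le b (incl u)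
  have h3 : 3 * ‖a‖ * ‖u.deriv‖ ≤ 3 * ‖a‖ * ‖u‖ := by gcongr; exact norm_deriv_le u
  have h4 : 3 * ‖b‖ * ‖incl u‖ ≤ 3 * ‖b‖ * ‖u‖ := by gcongr; exact norm_incl_le u
  have := norm_add_le (mulOne a u.deriv) (mulOne b (incl u))
  linarith

/-- The energy estimate for `a ∂ₓ + b` in `H¹`. -/
theorem abs_inner_firstOrder_le (a : SobolevSpace 2) (b : SobolevSpace 1) (u : SobolevSpace 2) :
    |⟪firstOrder (incl a) b u, incl u⟫_ℝ| ≤ (2 * ‖a‖ + 3 * ‖b‖) * ‖incl u‖ ^ 2 := by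
  set w : SobolevSpace 1 := incl u with hw
  have hwd : w.deriv.toL2 = u.deriv.toL2 := rfl
  have h1 : |⟪mulOne b w, w⟫_ℝ| ≤ 3 * ‖b‖ * ‖w‖ ^ 2 := by
    refine (abs_real_inner_le_norm _ _).trans ?_
    have := norm_mulOne_le b w
    nlinarith [norm_nonneg w]
  -- Integration by parts gives `2⟪a u'', u'⟫ = -⟪a' u', u'⟫`, which removes the second derivative
  -- from the `H¹` form.
  have hparts := (hasWeakDeriv_mulL (incl a) u.deriv).inner_eq_neg u.deriv.hasWeakDeriv
  rw [mulL_comm (incl a) u.deriv, ← mulL_comm, inner_mulL, inner_add_left] at hparts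
  have had : mulL u.deriv (incl a).deriv.toL2 = mulL a.deriv u.deriv.toL2 := mulL_comm u.deriv a.deriv
  rw [had] at hparts
  have h2 : ⟪mulOne (incl a) u.deriv, w⟫_ℝ = ⟪mulL (incl a) u.deriv.toL2, w.toL2⟫_ℝ +
      ⟪mulL a.deriv u.deriv.toL2, u.deriv.toL2⟫_ℝ / 2 := by
    rw [inner_one, toL2_mulOne, toL2_deriv_mulOne, had, hwd, inner_add_left]
    have h3 := real_inner_comm u.deriv.toL2 (mulL (incl a) u.deriv.deriv.toL2)
    linarith
  have h3 : |⟪mulL (incl a) u.deriv.toL2, w.toL2⟫_ℝ| ≤ ‖a‖ * ‖w‖ ^ 2 := by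
    refine (abs_real_inner_le_norm _ _).trans ?_
    have h4 := norm_mulL_le (incl a) u.deriv.toL2
    have h5 : ‖u.deriv.toL2‖ ≤ ‖w‖ := norm_deriv_toL2_le w
    have h6 := norm_toL2_le w
    have h7 := norm_incl_le a
    calc ‖mulL (incl a) u.deriv.toL2‖ * ‖w.toL2‖ ≤ (‖a‖ * ‖w‖) * ‖w‖ := by
          gcongr
          exact h4.trans (by gcongr)
      _ = _ := by ring
  have h4 : |⟪mulL a.deriv u.deriv.toL2, u.deriv.toL2⟫_ℝ| ≤ ‖a‖ * ‖w‖ ^ 2 := by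
    refine (abs_real_inner_le_norm _ _).trans ?_
    have h4 := norm_mulL_le a.deriv u.deriv.toL2
    have h5 : ‖u.deriv.toL2‖ ≤ ‖w‖ := norm_deriv_toL2_le w
    have h7 := norm_deriv_le a
    calc ‖mulL a.deriv u.deriv.toL2‖ * ‖u.deriv.toL2‖ ≤ (‖a‖ * ‖w‖) * ‖w‖ := by
          gcongr
          exact h4.trans (by gcongr)
      _ = _ := by ring
  rw [firstOrder_apply, inner_add_left, h2]
  rw [abs_le] at h1 h3 h4 ⊢
  have h0 : 0 ≤ ‖a‖ * ‖w‖ ^ 2 := by positivity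
  constructor <;> nlinarith

end SobolevSpace

/-! ### The commutator of `P` with multiplication, on the Fourier side -/

section Commutator

theorem integral_norm_mul_norm_le {F G : ℝ → ℂ} (hF : MemLp F 2) (hG : MemLp G 2) :
    ∫ x, ‖F x‖ * ‖G x‖ ≤ Real.sqrt (∫ x, ‖F x‖ ^ 2) * Real.sqrt (∫ x, ‖G x‖ ^ 2) := by
  have h := integral_mul_norm_le_Lp_mul_Lq (f := F) (g := G) Real.HolderConjugate.two_two
    (by simpa using hF) (by simpa using hG)
  simpa [Real.sqrt_eq_rpow] using h

theorem sqrt_integral_norm_realFourier_sq (φ : 𝓢(ℝ, ℝ)) :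
    Real.sqrt (∫ ξ, ‖realFourier φ ξ‖ ^ 2) = ‖(φ.toLp 2 : RealL2)‖ := by
  rw [Real.sqrt_eq_iff_mul_self_eq (integral_nonneg fun ξ => sq_nonneg _) (norm_nonneg _), ← sq,
    ← real_inner_self_eq_norm_sq, inner_toLp_toLp]
  apply Complex.ofReal_injective
  rw [← integral_inner_realFourier, ← integral_complex_ofReal]
  refine integral_congr_ae (Eventually.of_forall fun ξ => ?_)
  simp only [inner_self_eq_norm_sq_to_K]
  norm_cast

/-- The `L²` norm of the symbol of `(1 - ∂ₓ²)^{-1/2}`. -/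
def besselSymbolNorm : ℝ := Real.sqrt (∫ ξ, ‖(besselSymbol ξ : ℂ)‖ ^ 2)

theorem memLp_besselSymbol : MemLp (fun ξ => (besselSymbol ξ : ℂ)) 2 := by
  have hm : AEStronglyMeasurable (fun ξ => (besselSymbol ξ : ℂ)) volume :=
    (Complex.continuous_ofReal.comp continuous_besselSymbol).aestronglyMeasurable
  rw [memLp_two_iff_integrable_sq_norm hm]
  have h := integrable_inv_one_add_sq.comp_mul_left' (R := 2 * Real.pi) (by positivity)
  refine h.congr (Eventually.of_forall fun ξ => ?_)
  simp only [Complex.norm_real, Real.norm_eq_abs, sq_abs]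
  exact (eq_inv_of_mul_eq_one_left (besselSymbol_sq ξ)).symm

theorem integral_norm_realFourier_schwartzBessel_le (φ : 𝓢(ℝ, ℝ)) :
    ∫ ξ, ‖realFourier (schwartzBessel φ) ξ‖ ≤ besselSymbolNorm * ‖(φ.toLp 2 : RealL2)‖ := by
  rw [← sqrt_integral_norm_realFourier_sq]
  simp only [realFourier_schwartzBessel, norm_mul]
  exact integral_norm_mul_norm_le memLp_besselSymbol ((realFourier φ).memLp 2)

/-- The difference of reciprocals carries the product `p(t) p(s)`, and `x ↦ |1 + ix|` is
1-Lipschitz. -/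
theorem abs_besselSymbol_sub_le (s t : ℝ) : |besselSymbol t - besselSymbol s| ≤
    |2 * Real.pi * (s - t)| * (besselSymbol t * besselSymbol s) := by
  have hn : ∀ x : ℝ, Real.sqrt (1 + x ^ 2) = ‖(1 + x * Complex.I : ℂ)‖ := by
    intro x
    have := Complex.norm_add_mul_I 1 x
    simpa using this.symm
  have h1 : |Real.sqrt (1 + (2 * Real.pi * s) ^ 2) - Real.sqrt (1 + (2 * Real.pi * t) ^ 2)| ≤
      |2 * Real.pi * (s - t)| := by
    rw [hn, hn]
    refine (abs_norm_sub_norm_le _ _).trans_eq ?_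
    rw [add_sub_add_left_eq_sub, ← sub_mul, norm_mul, Complex.norm_I, mul_one, ← Complex.ofReal_sub,
      Complex.norm_real, Real.norm_eq_abs, mul_sub]
  have hs := Real.sqrt_pos.2 (one_add_sq_pos s)
  have ht := Real.sqrt_pos.2 (one_add_sq_pos t)
  have h2 : besselSymbol t - besselSymbol s =
      (Real.sqrt (1 + (2 * Real.pi * s) ^ 2) - Real.sqrt (1 + (2 * Real.pi * t) ^ 2)) *
        (besselSymbol t * besselSymbol s) := by
    simp only [besselSymbol]
    field_simp
  rw [h2, abs_mul, abs_of_pos (mul_pos (besselSymbol_pos t) (besselSymbol_pos s))]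
  gcongr
  exact (mul_pos (besselSymbol_pos t) (besselSymbol_pos s)).le

theorem fourierInv_schwartzOfReal (φ : 𝓢(ℝ, ℝ)) (t : ℝ) :
    (𝓕⁻ (schwartzOfReal φ)) t = realFourier φ (-t) := by
  rw [SchwartzMap.fourierInv_coe, Real.fourierInv_eq_fourier_neg, realFourier,
    SchwartzMap.fourier_coe]

/-- The inverse Fourier transform of a product of two functions. -/
theorem fourierInv_pairing_schwartzOfReal (f g : 𝓢(ℝ, ℝ)) (ζ : ℝ) :
    (𝓕⁻ (SchwartzMap.pairing (ContinuousLinearMap.mul ℂ ℂ) (schwartzOfReal f)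
      (schwartzOfReal g))) ζ = ∫ t, realFourier f (-t) * realFourier g (t - ζ) := by
  have h := SchwartzMap.convolution_apply (ContinuousLinearMap.mul ℂ ℂ)
    (𝓕⁻ (schwartzOfReal f)) (𝓕⁻ (schwartzOfReal g)) ζ
  rw [convolution_def] at h
  have h' := SchwartzMap.fourier_convolution (ContinuousLinearMap.mul ℂ ℂ)
    (𝓕⁻ (schwartzOfReal f)) (𝓕⁻ (schwartzOfReal g))
  rw [FourierTransform.fourier_fourierInv_eq, FourierTransform.fourier_fourierInv_eq] at h'
  rw [← h', FourierTransform.fourierInv_fourier_eq, h]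
  refine integral_congr_ae (Eventually.of_forall fun t => ?_)
  simp only [ContinuousLinearMap.mul_apply', fourierInv_schwartzOfReal, neg_sub]

/-- The Fourier representation of the integral of a product of three functions. -/
theorem integral_mul_mul_eq (χ f g : 𝓢(ℝ, ℝ)) :
    ((∫ x, χ x * (f x * g x) : ℝ) : ℂ) =
      ∫ ζ, realFourier χ ζ * ∫ t, realFourier f (-t) * realFourier g (t - ζ) := by
  have h := SchwartzMap.integral_fourierInv_mul_eq (realFourier χ)
    (SchwartzMap.pairing (ContinuousLinearMap.mul ℂ ℂ) (schwartzOfReal f) (schwartzOfReal g))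
  simp only [fourierInv_pairing_schwartzOfReal] at h
  rw [← h, ← integral_complex_ofReal]
  refine integral_congr_ae (Eventually.of_forall fun x => ?_)
  simp only [realFourier, FourierTransform.fourierInv_fourier_eq,
    SchwartzMap.pairing_apply_apply, schwartzOfReal_apply, ContinuousLinearMap.mul_apply']
  push_cast
  rfl

theorem integrable_realFourier_mul_integral (χ f g : 𝓢(ℝ, ℝ)) :
    Integrable fun ζ => realFourier χ ζ * ∫ t, realFourier f (-t) * realFourier g (t - ζ) := by
  simp only [← fourierInv_pairing_schwartzOfReal]
  exact (SchwartzMap.pairing (ContinuousLinearMap.mul ℂ ℂ) (realFourier χ)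
    (𝓕⁻ (SchwartzMap.pairing (ContinuousLinearMap.mul ℂ ℂ) (schwartzOfReal f)
      (schwartzOfReal g)))).integrable

theorem memLp_realFourier_neg (f : 𝓢(ℝ, ℝ)) : MemLp (fun t => realFourier f (-t)) 2 :=
  ((realFourier f).memLp 2).comp_measurePreserving (Measure.measurePreserving_neg (volume : Measure ℝ))

theorem memLp_realFourier_sub (g : 𝓢(ℝ, ℝ)) (ζ : ℝ) : MemLp (fun t => realFourier g (t - ζ)) 2 :=
  ((realFourier g).memLp 2).comp_measurePreserving (measurePreserving_sub_right volume ζ)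

theorem integrable_realFourier_mul (f g : 𝓢(ℝ, ℝ)) (ζ : ℝ) :
    Integrable fun t => realFourier f (-t) * realFourier g (t - ζ) :=
  (memLp_realFourier_neg f).integrable_mul (memLp_realFourier_sub g ζ)

theorem integral_norm_realFourier_mul_le (f g : 𝓢(ℝ, ℝ)) (ζ : ℝ) :
    ∫ t, ‖realFourier f (-t)‖ * ‖realFourier g (t - ζ)‖ ≤
      ‖(f.toLp 2 : RealL2)‖ * ‖(g.toLp 2 : RealL2)‖ := by
  refine (integral_norm_mul_norm_le (memLp_realFourier_neg f) (memLp_realFourier_sub g ζ)).trans_eq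
    ?_
  rw [integral_neg_eq_self (fun t => ‖realFourier f t‖ ^ 2),
    integral_sub_right_eq_self (fun t => ‖realFourier g t‖ ^ 2), sqrt_integral_norm_realFourier_sq,
    sqrt_integral_norm_realFourier_sq]

/-- The commutator estimate for Schwartz functions. -/
theorem abs_integral_commutator_le (φ f g : 𝓢(ℝ, ℝ)) :
    |(∫ x, schwartzBessel φ x * (schwartzBessel f x * g x)) -
      ∫ x, schwartzBessel φ x * (f x * schwartzBessel g x)| ≤
      besselSymbolNorm * ‖((SchwartzMap.derivCLM ℝ ℝ φ).toLp 2 : RealL2)‖ *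
        (‖((schwartzBessel f).toLp 2 : RealL2)‖ * ‖((schwartzBessel g).toLp 2 : RealL2)‖) := by
  set χ := schwartzBessel φ with hχ
  set N : ℝ := ‖((schwartzBessel f).toLp 2 : RealL2)‖ * ‖((schwartzBessel g).toLp 2 : RealL2)‖
    with hN
  set I : 𝓢(ℝ, ℝ) → 𝓢(ℝ, ℝ) → ℝ → ℂ := fun f g ζ =>
    ∫ t, realFourier f (-t) * realFourier g (t - ζ) with hI
  have hdiff : ∀ ζ, ‖I (schwartzBessel f) g ζ - I f (schwartzBessel g) ζ‖ ≤
      |2 * Real.pi * ζ| * N := by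
    intro ζ
    rw [hI]
    simp only
    rw [← integral_sub (integrable_realFourier_mul _ _ _) (integrable_realFourier_mul _ _ _)]
    have h_int : Integrable fun t => ‖realFourier (schwartzBessel f) (-t)‖ *
        ‖realFourier (schwartzBessel g) (t - ζ)‖ :=
      (integrable_realFourier_mul (schwartzBessel f) (schwartzBessel g) ζ).norm.congr
        (Eventually.of_forall fun t => norm_mul _ _)
    refine (norm_integral_le_of_norm_le (h_int.const_mul |2 * Real.pi * ζ|)
      (Eventually.of_forall fun t => ?_)).trans ?_
    -- The commutator has kernel `p(t) - p(t - ζ)`. Its bound supplies one factor `p` for each of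
    -- `f` and `g` and a factor `|2πζ|`, which differentiates `χ`.
    · have e : realFourier (schwartzBessel f) (-t) * realFourier g (t - ζ) -
          realFourier f (-t) * realFourier (schwartzBessel g) (t - ζ) =
          ((besselSymbol t - besselSymbol (t - ζ) : ℝ) : ℂ) *
            (realFourier f (-t) * realFourier g (t - ζ)) := by
        rw [realFourier_schwartzBessel, realFourier_schwartzBessel, besselSymbol_neg]
        push_cast
        ring
      rw [e, realFourier_schwartzBessel, realFourier_schwartzBessel, besselSymbol_neg]
      simp only [norm_mul, Complex.norm_real, Real.norm_eq_abs, abs_of_pos (besselSymbol_pos _)]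
      have h1 := abs_besselSymbol_sub_le (t - ζ) t
      rw [sub_sub_cancel_left, mul_neg, abs_neg] at h1
      calc _ ≤ (|2 * Real.pi * ζ| * (besselSymbol t * besselSymbol (t - ζ))) *
            (‖realFourier f (-t)‖ * ‖realFourier g (t - ζ)‖) := by gcongr
        _ = _ := by ring
    · rw [integral_const_mul]
      gcongr
      exact integral_norm_realFourier_mul_le _ _ ζ
  have hbound : ∀ ζ, ‖realFourier χ ζ * I (schwartzBessel f) g ζ -
      realFourier χ ζ * I f (schwartzBessel g) ζ‖ ≤
      ‖realFourier (schwartzBessel (SchwartzMap.derivCLM ℝ ℝ φ)) ζ‖ * N := by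
    intro ζ
    rw [← mul_sub, norm_mul, schwartzBessel_deriv, ← deriv_schwartzBessel, realFourier_deriv,
      norm_mul, norm_mul, Complex.norm_I, mul_one, Complex.norm_real, Real.norm_eq_abs]
    calc _ ≤ ‖realFourier χ ζ‖ * (|2 * Real.pi * ζ| * N) := by gcongr; exact hdiff ζ
      _ = _ := by ring
  have key : (((∫ x, χ x * (schwartzBessel f x * g x)) -
      ∫ x, χ x * (f x * schwartzBessel g x) : ℝ) : ℂ) =
      ∫ ζ, (realFourier χ ζ * I (schwartzBessel f) g ζ -
        realFourier χ ζ * I f (schwartzBessel g) ζ) := by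
    rw [Complex.ofReal_sub, integral_mul_mul_eq, integral_mul_mul_eq,
      integral_sub (integrable_realFourier_mul_integral _ _ _)
        (integrable_realFourier_mul_integral _ _ _)]
  rw [← Real.norm_eq_abs, ← Complex.norm_real, key]
  refine (norm_integral_le_of_norm_le
    (((realFourier (schwartzBessel (SchwartzMap.derivCLM ℝ ℝ φ))).integrable
      (μ := volume)).norm.mul_const N) (Eventually.of_forall hbound)).trans ?_
  rw [integral_mul_const]
  gcongr
  exact integral_norm_realFourier_schwartzBessel_le _

end Commutator

/-- If `|⟪E f, g⟫| ≤ M ‖P f‖ ‖P g‖` for an injective symmetric operator `P`, then `E = P C P` with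
an operator `C` of norm at most `M`. -/
theorem exists_factorization_of_abs_inner_le {X : Type*} [NormedAddCommGroup X]
    [InnerProductSpace ℝ X] [CompleteSpace X] (P E : X →L[ℝ] X) (hP : Function.Injective P)
    (hsymm : ∀ x y, ⟪P x, y⟫_ℝ = ⟪x, P y⟫_ℝ) {M : ℝ} (hM : 0 ≤ M)
    (hE : ∀ f g, |⟪E f, g⟫_ℝ| ≤ M * (‖P f‖ * ‖P g‖)) :
    ∃ C : X →L[ℝ] X, ‖C‖ ≤ M ∧ ∀ f, P (C (P f)) = E f := by
  have hd : DenseRange P :=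
    denseRange_of_symmetric (ι := P) (Q := ContinuousLinearEquiv.refl ℝ X) hP hsymm
  -- The functional `g ↦ ⟪E f, g⟫` is bounded in terms of `‖P g‖`, so it extends from the dense
  -- range of `P`; the Riesz representation provides `d`. The same extension in the variable `P f`
  -- then gives `C`.
  have h1 : ∀ f, ∃ d, P d = E f ∧ ‖d‖ ≤ M * ‖P f‖ := by
    intro f
    have hn : ∀ g, ‖(innerSL ℝ (E f) : X →L[ℝ] ℝ).toLinearMap g‖ ≤ (M * ‖P f‖) *
        ‖P.toLinearMap g‖ := fun g => by
      rw [mul_assoc]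
      exact hE f g
    refine ⟨(InnerProductSpace.toDual ℝ X).symm
      ((innerSL ℝ (E f) : X →L[ℝ] ℝ).toLinearMap.extendOfNorm P.toLinearMap), ?_, ?_⟩
    · refine ext_inner_right ℝ fun g => ?_
      rw [hsymm, InnerProductSpace.toDual_symm_apply]
      exact LinearMap.extendOfNorm_eq hd ⟨_, hn⟩ g
    · rw [LinearIsometryEquiv.norm_map]
      exact LinearMap.opNorm_extendOfNorm_le hd (by positivity) hn
  choose d hd1 hd2 using h1
  let D : X →ₗ[ℝ] X :=
    { toFun := d
      map_add' := fun f g => hP (by rw [map_add, hd1, hd1, hd1, map_add])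
      map_smul' := fun r f => hP (by rw [RingHom.id_apply, map_smul, hd1, hd1, map_smul]) }
  refine ⟨D.extendOfNorm P.toLinearMap, LinearMap.opNorm_extendOfNorm_le hd hM hd2, fun f => ?_⟩
  rw [← hd1 f]
  exact congrArg P (LinearMap.extendOfNorm_eq (f := D) hd ⟨M, hd2⟩ f)

/-! ### Boundedness of `[Q, c]` in `H¹` -/

namespace SobolevSpace

theorem incl_besselUp_ofSchwartz (φ : 𝓢(ℝ, ℝ)) :
    incl (besselUp (ofSchwartz φ)) = ofSchwartz (schwartzBessel φ) :=
  ext (by rw [toL2_incl_besselUp, toL2_ofSchwartz, toL2_ofSchwartz, bessel_toLp])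

theorem besselSymbolNorm_nonneg : 0 ≤ besselSymbolNorm := Real.sqrt_nonneg _

theorem inner_mulL_ofSchwartz_toLp (φ f g : 𝓢(ℝ, ℝ)) :
    ⟪mulL (ofSchwartz φ) (f.toLp 2), g.toLp 2⟫_ℝ = ∫ x, φ x * (f x * g x) := by
  rw [mulL_ofSchwartz, inner_toLp_toLp]
  refine integral_congr_ae (Eventually.of_forall fun x => ?_)
  simp [mul_assoc]

/-- The commutator of a multiplication operator with `(1 - ∂ₓ²)^{-1/2}`. -/
def besselCommutator (c : SobolevSpace 2) : RealL2 →L[ℝ] RealL2 :=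
  (mulL (incl c)).comp bessel - bessel.comp (mulL (incl c))

theorem besselCommutator_apply (c : SobolevSpace 2) (f : RealL2) :
    besselCommutator c f = mulL (incl c) (bessel f) - bessel (mulL (incl c) f) := rfl

theorem abs_inner_besselCommutator_le (c : SobolevSpace 2) (f g : RealL2) :
    |⟪besselCommutator c f, g⟫_ℝ| ≤
      besselSymbolNorm * ‖c.deriv‖ * (‖bessel f‖ * ‖bessel g‖) := by
  have hdef : ∀ (c : SobolevSpace 2) (f g : RealL2), ⟪besselCommutator c f, g⟫_ℝ =
      ⟪mulL (incl c) (bessel f), g⟫_ℝ - ⟪mulL (incl c) f, bessel g⟫_ℝ := fun c f g => by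
    rw [besselCommutator_apply, inner_sub_left, bessel_symm]
  -- Writing `c = P d` with `d ∈ H¹` gives `‖c'‖ = ‖d'‖` (in `H¹` and `L²` respectively), so the
  -- Schwartz estimate has the right constant and extends by density in `d`, `f` and `g`.
  obtain ⟨d, rfl⟩ := besselUp_surjective c
  simp only [← derivL_apply]
  induction d using denseRange_ofSchwartz.induction_on with
  | hp =>
    simp only [hdef]
    exact isClosed_le (by fun_prop) (by fun_prop)
  | ih φ =>
  induction f using denseRange_toLp_real.induction_on with
  | hp => exact isClosed_le (by fun_prop) (by fun_prop)
  | ih f =>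
  induction g using denseRange_toLp_real.induction_on with
  | hp => exact isClosed_le (by fun_prop) (by fun_prop)
  | ih g =>
  rw [hdef, derivL_apply, deriv_besselUp, LinearIsometry.norm_map, toL2_deriv_ofSchwartz,
    incl_besselUp_ofSchwartz, bessel_toLp, bessel_toLp, inner_mulL_ofSchwartz_toLp, inner_mulL_ofSchwartz_toLp]
  exact abs_integral_commutator_le φ f g

theorem exists_besselCommutator_factorization (c : SobolevSpace 2) :
    ∃ C : RealL2 →L[ℝ] RealL2, ‖C‖ ≤ besselSymbolNorm * ‖c.deriv‖ ∧
      ∀ f, bessel (C (bessel f)) = besselCommutator c f :=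
  exists_factorization_of_abs_inner_le bessel (besselCommutator c) bessel_injective bessel_symm
    (mul_nonneg besselSymbolNorm_nonneg (norm_nonneg _))
    (abs_inner_besselCommutator_le c)

/-- The product of `c ∈ H²` with `w ∈ H²` as the image of an `L²` function under
`(1 - ∂ₓ²)⁻¹`. -/
theorem mulL_incl_eq_bessel_bessel (c w : SobolevSpace 2) :
    mulL (incl c) w.toL2 = bessel (bessel (mulL (incl c) (w.toL2 - w.deriv.deriv.toL2) -
      mulL (incl w) c.deriv.deriv.toL2 - (2 : ℝ) • mulL c.deriv w.deriv.toL2)) := by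
  have h1 := hasWeakDeriv_mulL (incl c) (incl w)
  rw [deriv_incl, deriv_incl, toL2_incl, toL2_incl, toL2_incl] at h1
  have h2 := (hasWeakDeriv_mulL (incl c) w.deriv).add (hasWeakDeriv_mulL (incl w) c.deriv)
  rw [deriv_incl, deriv_incl, toL2_incl, toL2_incl, mulL_comm w.deriv c.deriv] at h2
  -- For `f = c w ∈ H²`, `f = P (P f - R f')` and `R f' = P f''` give `f = P² (f - f'')`; the
  -- Leibniz rule expands `f''`.
  have h3 := h1.bessel_sub
  rw [h2.riesz_eq, ← map_sub] at h3
  rw [← h3]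
  congr 2
  rw [map_sub, two_smul]
  abel

/-- The operator `[(1 - ∂ₓ²)^{1/2}, c] (1 - ∂ₓ²)^{-1/2}`, which is bounded in `H¹`. -/
theorem exists_conjugation (c : SobolevSpace 2) :
    ∃ Φ : SobolevSpace 1 →L[ℝ] SobolevSpace 1, ‖Φ‖ ≤ (3 + besselSymbolNorm) * ‖c.deriv‖ ∧
      ∀ h : SobolevSpace 1, mulL (incl c) (bessel h.toL2) =
        bessel (mulL (incl c) h.toL2 + (Φ (incl (besselUp h))).toL2) := by
  obtain ⟨C, hC, hCeq⟩ := exists_besselCommutator_factorization c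
  let Q₀ := (LinearIsometryEquiv.ofSurjective besselL2 besselL2_surjective).symm
  have hQ₀ : ∀ f, Q₀ (besselL2 f) = f := fun f =>
    (LinearIsometryEquiv.ofSurjective besselL2 besselL2_surjective).symm_apply_apply f
  -- This is `[Q, c]` extended to `H¹`: `Q (c w) = P (c (1 - ∂ₓ²) w - w c'' - 2 c' w')`, and
  -- replacing `P c` by `c P` costs the commutator `P C P`. The constant 3 counts `w c''` once and
  -- `c' w'` twice.
  let Φ : SobolevSpace 1 →ₗ[ℝ] SobolevSpace 1 :=
    { toFun := fun w => besselL2 (-mulL w c.deriv.deriv.toL2 -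
        (2 : ℝ) • mulL c.deriv (toL2L (derivL w)) - C (Q₀ w))
      map_add' := fun w w' => by
        rw [← map_add]
        congr 1
        simp only [map_add, smul_add, add_apply]
        abel
      map_smul' := fun r w => by
        rw [RingHom.id_apply, ← besselL2.map_smul, smul_sub, smul_sub, smul_neg, smul_comm r (2 : ℝ)]
        simp only [map_smul, smul_apply] }
  have hb : ∀ w, ‖Φ w‖ ≤ (3 + besselSymbolNorm) * ‖c.deriv‖ * ‖w‖ := by
    intro w
    change ‖besselL2 _‖ ≤ _
    rw [LinearIsometry.norm_map]
    have h1 : ‖mulL w c.deriv.deriv.toL2‖ ≤ ‖w‖ * ‖c.deriv‖ :=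
      (norm_mulL_le _ _).trans (by gcongr; exact norm_deriv_toL2_le _)
    have h2 : ‖mulL c.deriv (toL2L (derivL w))‖ ≤ ‖c.deriv‖ * ‖w‖ :=
      (norm_mulL_le _ _).trans (by gcongr; exact norm_deriv_toL2_le _)
    have h3 : ‖C (Q₀ w)‖ ≤ besselSymbolNorm * ‖c.deriv‖ * ‖w‖ := by
      refine (C.le_of_opNorm_le hC _).trans_eq ?_
      rw [LinearIsometryEquiv.norm_map]
    have h4 := norm_sub_le (-mulL w c.deriv.deriv.toL2 -
        (2 : ℝ) • mulL c.deriv (toL2L (derivL w))) (C (Q₀ w))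
    have h5 := norm_sub_le (-mulL w c.deriv.deriv.toL2)
        ((2 : ℝ) • mulL c.deriv (toL2L (derivL w)))
    rw [norm_neg, norm_smul, Real.norm_ofNat] at h5
    nlinarith
  refine ⟨Φ.mkContinuous _ hb, Φ.mkContinuous_norm_le (by
    have := besselSymbolNorm_nonneg
    positivity) hb, fun h => ?_⟩
  -- With `h = P k` and `w = P h`, the function `k` equals `(1 - ∂ₓ²) w`.
  obtain ⟨k, rfl⟩ := besselL2_surjective h
  have hw : incl (besselUp (besselL2 k)) = besselL2 (bessel k) := ext rfl
  have hk : (besselUp (besselL2 k)).toL2 - (besselUp (besselL2 k)).deriv.deriv.toL2 = k := by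
    rw [deriv_besselUp, toL2_deriv_besselL2, toL2_besselUp, toL2_besselL2, toL2_deriv_besselL2,
      bessel_sq_sub]
  have h1 := mulL_incl_eq_bessel_bessel c (besselUp (besselL2 k))
  rw [hk, toL2_besselUp] at h1
  rw [h1]
  congr 1
  change _ = _ + (besselL2 (-mulL (incl (besselUp (besselL2 k))) c.deriv.deriv.toL2 -
        (2 : ℝ) • mulL c.deriv (incl (besselUp (besselL2 k))).deriv.toL2 -
          C (Q₀ (incl (besselUp (besselL2 k)))))).toL2
  rw [deriv_incl, toL2_incl, toL2_besselL2, toL2_besselL2]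
  have h2 : Q₀ (incl (besselUp (besselL2 k))) = bessel k := by rw [hw, hQ₀]
  rw [h2]
  simp only [map_sub, map_neg, hCeq, besselCommutator_apply]
  abel

end SobolevSpace

/-! ### From groups to semigroups -/

section Semigroup

variable {X : Type*} [NormedAddCommGroup X] [NormedSpace ℝ X] {U : ℝ → X →L[ℝ] X}

theorem IsC0Group.comp_neg (hU : IsC0Group U) : IsC0Group fun t => U (-t) where
  zero := by rw [neg_zero, hU.zero]
  add s t := by rw [neg_add, hU.add]
  continuous x := (hU.continuous x).comp continuous_neg

theorem IsC0Group.isC0Semigroup (hU : IsC0Group U) : IsC0Semigroup U where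
  zero := hU.zero
  add s t _ _ := hU.add s t
  continuousOn x := (hU.continuous x).continuousOn

theorem IsC0Group.isOrbitDeriv_comp_neg_iff (hU : IsC0Group U) (x z : X) :
    IsOrbitDeriv (fun t => U (-t)) x z ↔ IsOrbitDeriv U x (-z) := by
  have key : ∀ {U : ℝ → X →L[ℝ] X}, IsC0Group U → ∀ {z}, IsOrbitDeriv U x z →
      IsOrbitDeriv (fun t => U (-t)) x (-z) := by
    intro U hU z h
    rw [isOrbitDeriv_iff_hasDerivAt hU.zero] at h
    rw [isOrbitDeriv_iff_hasDerivAt hU.comp_neg.zero]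
    have h0 : HasDerivAt (fun t => U t x) z (-0) := by rwa [neg_zero]
    have h1 := h0.scomp (0 : ℝ) (hasDerivAt_neg (0 : ℝ))
    rw [neg_one_smul] at h1
    exact h1
  refine ⟨fun h => ?_, fun h => ?_⟩
  · simpa using key hU.comp_neg h
  · simpa using key hU h

/-- For a `C₀`-group, a right derivative of an orbit is a two-sided derivative. -/
theorem IsC0Group.tendsto_nhdsGT_iff_isOrbitDeriv [CompleteSpace X] (hU : IsC0Group U) (x z : X) :
    Tendsto (fun s : ℝ => s⁻¹ • (U s x - x)) (𝓝[>] 0) (𝓝 z) ↔ IsOrbitDeriv U x z := by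
  refine ⟨fun h => ?_, fun h => h.mono_left (nhdsWithin_mono _ fun s hs => ne_of_gt hs)⟩
  rw [IsOrbitDeriv, ← Set.Iio_union_Ioi, nhdsWithin_union]
  refine Tendsto.sup ?_ h
  obtain ⟨M, hM⟩ := hU.exists_bound (-1)
  have hneg : Tendsto (fun t : ℝ => -t) (𝓝[<] 0) (𝓝[>] 0) := by
    simpa using tendsto_neg_nhdsLT (a := (0 : ℝ))
  have h1 : Tendsto (fun t : ℝ => (-t)⁻¹ • (U (-t) x - x) - z) (𝓝[<] 0) (𝓝 0) := by
    simpa using (h.comp hneg).sub_const z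
  -- For `t < 0` the difference quotient is `U t` applied to the quotient at `-t > 0`; local
  -- boundedness of `U` near `0` passes the right limit to the left.
  have h2 : Tendsto (fun t : ℝ => U t ((-t)⁻¹ • (U (-t) x - x) - z)) (𝓝[<] 0) (𝓝 0) := by
    have h3 := h1.norm.const_mul M
    rw [norm_zero, mul_zero] at h3
    refine squeeze_zero_norm' ?_ h3
    filter_upwards [Ioo_mem_nhdsLT (show (-1 : ℝ) < 0 by norm_num)] with t ht
    exact (U t).le_of_opNorm_le (hM t (by rw [Set.mem_uIcc]; right; exact ⟨ht.1.le, ht.2.le⟩)) _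
  have h3 : Tendsto (fun t : ℝ => U t z) (𝓝[<] 0) (𝓝 z) := by
    have := (hU.continuous z).tendsto 0
    rw [hU.zero] at this
    exact this.mono_left nhdsWithin_le_nhds
  have h4 := h2.add h3
  rw [zero_add] at h4
  refine h4.congr fun t => ?_
  have h5 : U t (U (-t) x) = x := by
    have := hU.add t (-t)
    rw [add_neg_cancel, hU.zero] at this
    exact (congrArg (fun L : X →L[ℝ] X => L x) this).symm
  rw [map_sub, sub_add_cancel, map_smul, map_sub, h5, inv_neg, neg_smul, ← smul_neg, neg_sub]

/-- If `A` generates the group `U`, then `-A` generates the semigroup `U (-s)`. -/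
theorem IsGeneratorOfGroup.neg_isGeneratorOfSemigroup [CompleteSpace X] {A : X →ₗ.[ℝ] X}
    (hU : IsC0Group U) (hA : IsGeneratorOfGroup A U) :
    IsGeneratorOfSemigroup (-A) fun s => U (-s) := by
  intro x z
  rw [hU.comp_neg.tendsto_nhdsGT_iff_isOrbitDeriv, hU.isOrbitDeriv_comp_neg_iff,
    LinearPMap.neg_graph]
  refine Iff.trans ?_ (hA x (-z))
  simp only [Submodule.mem_map, Prod.exists, LinearMap.prodMap_apply, Prod.mk.injEq]
  constructor
  · rintro ⟨x', z', h, rfl, rfl⟩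
    simpa using h
  · intro h
    exact ⟨x, -z, h, rfl, by simp⟩

end Semigroup

/-- The generator of a `C₀`-group which extends an operator with quasi-skew-adjoint closure is
equal to that closure. -/
theorem IsGeneratorOfGroup.graph_eq_graphClosure {X Y : Type*} [NormedAddCommGroup X]
    [InnerProductSpace ℝ X] [CompleteSpace X] [NormedAddCommGroup Y] [InnerProductSpace ℝ Y]
    {ι T : Y →L[ℝ] X} {β r₀ : ℝ} (hΓ : IsQuasiSkewAdjoint (graphClosure ι T) β r₀)
    {U : ℝ → X →L[ℝ] X} (hU : IsC0Group U) {A : X →ₗ.[ℝ] X} (hA : IsGeneratorOfGroup A U)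
    (hT : ∀ u, (ι u, T u) ∈ A.graph) : A.graph = graphClosure ι T := by
  have hsub : ∀ p ∈ graphClosure ι T, IsOrbitDeriv U p.1 p.2 := fun p hp =>
    graphClosure_subset hU.isClosed_setOf_isOrbitDeriv (fun u => (hA _ _).1 (hT u)) hp
  ext ⟨x, z⟩
  exact ⟨fun h => hΓ.eq_of_le hU hsub x z ((hA x z).1 h), fun h => (hA x z).2 (hsub _ h)⟩

/-! ### The operator `a ∂ₓ + b` and its unique generator -/

namespace SobolevSpace

/-- With `Φ` and `Ψ` the extensions of `[Q, a]` and `[Q, b]`, `a ∂ₓ P u = a P u' = P (a u' + Φ P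
u')` and `b P u = P (b u + Ψ P u)`. So `B = Φ P ∂ₓ + Ψ P`, where `P ∂ₓ` is bounded in `H¹`. -/
theorem exists_conjugation_firstOrder (a b : SobolevSpace 2) :
    ∃ B : SobolevSpace 1 →L[ℝ] SobolevSpace 1,
      ‖B‖ ≤ (3 + besselSymbolNorm) * (‖a.deriv‖ + ‖b.deriv‖) ∧
      ∀ u, firstOrder (incl a) (incl b) (besselUp (incl u)) =
        incl (besselUp (firstOrder (incl a) (incl b) u + B (incl u))) := by
  obtain ⟨Φ, hΦ, hΦeq⟩ := exists_conjugation a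
  obtain ⟨Ψ, hΨ, hΨeq⟩ := exists_conjugation b
  have hK : 0 ≤ 3 + besselSymbolNorm := by linarith [besselSymbolNorm_nonneg]
  let B : SobolevSpace 1 →L[ℝ] SobolevSpace 1 :=
    Φ.comp (besselL2.toContinuousLinearMap.comp (toL2L.comp derivL)) +
      Ψ.comp (incl.comp besselUp.toContinuousLinearMap)
  have hB : ∀ w, B w = Φ (besselL2 w.deriv.toL2) + Ψ (incl (besselUp w)) := fun w => rfl
  refine ⟨B, ContinuousLinearMap.opNorm_le_bound _ (by positivity) fun w => ?_, fun u => ?_⟩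
  · rw [hB]
    refine (norm_add_le _ _).trans ?_
    rw [mul_add, add_mul]
    refine add_le_add ?_ ?_
    · refine (Φ.le_of_opNorm_le hΦ _).trans ?_
      rw [LinearIsometry.norm_map]
      gcongr
      exact norm_deriv_toL2_le w
    · refine (Ψ.le_of_opNorm_le hΨ _).trans ?_
      gcongr
      exact (norm_incl_le _).trans_eq (LinearIsometry.norm_map _ _)
  · have h1 := hΦeq u.deriv
    have h2 := hΨeq (incl u)
    have h3 : incl (besselUp u.deriv) = besselL2 (incl u).deriv.toL2 := ext rfl
    rw [h3] at h1
    refine ext ?_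
    rw [toL2_incl_besselUp, firstOrder_apply, firstOrder_apply, hB, deriv_besselUp]
    simp only [map_add, toL2_mulOne, toL2_besselL2, toL2_incl_besselUp] at h1 h2 ⊢
    have h4 : (incl u).deriv.toL2 = u.deriv.toL2 := rfl
    rw [h4] at h1 ⊢
    rw [h1, h2]
    abel

section

variable (a : SobolevSpace 3) (b : SobolevSpace 2)

/-- The operator `a ∂ₓ + b` from `H²` to `H¹`, for smooth coefficients. -/
def transport : SobolevSpace 2 →L[ℝ] SobolevSpace 1 := firstOrder (incl (incl a)) (incl b)

theorem coeFn_transport (u : SobolevSpace 2) : (transport a b u).toL2 =ᵐ[volume]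
    fun x => a.toL2 x * u.deriv.toL2 x + b.toL2 x * u.toL2 x :=
  coeFn_firstOrder _ _ u

theorem eq_transport_of_ae_eq {u : SobolevSpace 2} {f : SobolevSpace 1}
    (h : f.toL2 =ᵐ[volume] fun x => a.toL2 x * u.deriv.toL2 x + b.toL2 x * u.toL2 x) :
    f = transport a b u :=
  ext (Lp.ext (h.trans (coeFn_transport a b u).symm))

theorem abs_inner_transport_le (u : SobolevSpace 2) :
    |⟪transport a b u, incl u⟫_ℝ| ≤ (2 * ‖a‖ + 3 * ‖b‖) * ‖incl u‖ ^ 2 := by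
  refine (abs_inner_firstOrder_le _ _ _).trans ?_
  gcongr
  · exact norm_incl_le a
  · exact norm_incl_le b

theorem norm_transport_sub_le (a' : SobolevSpace 3) (b' : SobolevSpace 2) (u : SobolevSpace 2) :
    ‖transport a b u - transport a' b' u‖ ≤ 3 * (‖a - a'‖ + ‖b - b'‖) * ‖u‖ := by
  have h : transport a b u - transport a' b' u =
      firstOrder (incl (incl (a - a'))) (incl (b - b')) u := by
    simp only [transport, firstOrder_apply, ← mulOneL_apply, map_sub, sub_apply]
    abel
  rw [h]
  refine (norm_firstOrder_le _ _ u).trans ?_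
  gcongr
  · exact (norm_incl_le _).trans (norm_incl_le _)
  · exact norm_incl_le _

theorem exists_conjugation_transport :
    ∃ B : SobolevSpace 1 →L[ℝ] SobolevSpace 1,
      ‖B‖ ≤ 2 * (3 + besselSymbolNorm) * max ‖a.deriv‖ ‖b‖ ∧
      ∀ u, transport a b (sqrtOneSub.toContinuousLinearEquiv.symm (incl u)) =
        incl (sqrtOneSub.toContinuousLinearEquiv.symm (transport a b u + B (incl u))) := by
  obtain ⟨B, hB, hconj⟩ := exists_conjugation_firstOrder (incl a) b
  refine ⟨B, hB.trans ?_, hconj⟩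
  have h1 : ‖(incl a).deriv‖ ≤ max ‖a.deriv‖ ‖b‖ := by
    rw [deriv_incl]
    exact (norm_incl_le _).trans (le_max_left _ _)
  have h2 : ‖b.deriv‖ ≤ max ‖a.deriv‖ ‖b‖ := (norm_deriv_le b).trans (le_max_right _ _)
  rw [mul_comm 2, mul_assoc, two_mul]
  have := besselSymbolNorm_nonneg
  gcongr

theorem denseRange_incl : DenseRange (incl : SobolevSpace 2 →L[ℝ] SobolevSpace 1) :=
  denseRange_of_symmetric (Q := sqrtOneSub.toContinuousLinearEquiv) incl_injective
    inner_incl_besselUp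

/-- The graph of the closure of `a ∂ₓ + b` in `H¹`. -/
abbrev transportGraph : Submodule ℝ (SobolevSpace 1 × SobolevSpace 1) :=
  graphClosure (Y := SobolevSpace 2) incl (transport a b)

theorem isQuasiSkewAdjoint_transport :
    ∃ r₀, IsQuasiSkewAdjoint (transportGraph a b) (2 * ‖a‖ + 3 * ‖b‖) r₀ := by
  obtain ⟨B, -, hB⟩ := exists_conjugation_transport a b
  exact ⟨_, isQuasiSkewAdjoint_graphClosure (Q := sqrtOneSub.toContinuousLinearEquiv) (B := B)
    (T := transport a b) incl_injective inner_incl_besselUp inner_incl_besselUp_self_nonneg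
    hB (by positivity) (abs_inner_transport_le a b)⟩

variable {a b}

/-- Every generator extending `a ∂ₓ + b` is the closure of the latter. -/
theorem _root_.IsFirstOrderGenerator.graph_eq {G : SobolevSpace 1 →ₗ.[ℝ] SobolevSpace 1}
    (h : IsFirstOrderGenerator a b G) : G.graph = transportGraph a b := by
  obtain ⟨⟨U, hU, hG⟩, hT⟩ := h
  obtain ⟨r₀, hΓ⟩ := isQuasiSkewAdjoint_transport a b
  refine hG.graph_eq_graphClosure hΓ hU fun u => ?_
  obtain ⟨f, hf, hfe⟩ := hT u
  rwa [eq_transport_of_ae_eq a b hfe] at hf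

variable (a b) in
theorem existsUnique_isFirstOrderGenerator : ∃! G, IsFirstOrderGenerator a b G := by
  obtain ⟨r₀, hΓ⟩ := isQuasiSkewAdjoint_transport a b
  obtain ⟨U, hU, hUΓ, -⟩ := hΓ.exists_group
  have hgr := Submodule.toLinearPMap_graph_eq (transportGraph a b)
    (graphClosure_snd_eq_zero denseRange_incl (abs_inner_transport_le a b))
  refine ⟨(transportGraph a b).toLinearPMap, ⟨⟨U, hU, fun x z => ?_⟩, fun u => ?_⟩,
    fun G hG => LinearPMap.eq_of_eq_graph (hG.graph_eq.trans hgr.symm)⟩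
  · rw [hgr]
    exact hUΓ x z
  · rw [hgr]
    exact ⟨_, mk_mem_graphClosure _ _ u, coeFn_transport a b u⟩

theorem _root_.IsFirstOrderGenerator.exists_group {G : SobolevSpace 1 →ₗ.[ℝ] SobolevSpace 1}
    (h : IsFirstOrderGenerator a b G) : ∃ U : ℝ → SobolevSpace 1 →L[ℝ] SobolevSpace 1,
      IsC0Group U ∧ IsGeneratorOfGroup G U ∧
        ∀ t, ‖U t‖ ≤ Real.exp (2 * (2 * ‖a‖ + 3 * ‖b‖) * |t|) := by
  obtain ⟨r₀, hΓ⟩ := isQuasiSkewAdjoint_transport a b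
  obtain ⟨U, hU, hUΓ, hb⟩ := hΓ.exists_group
  refine ⟨U, hU, fun x z => ?_, hb⟩
  rw [h.graph_eq]
  exact hUΓ x z

theorem _root_.IsFirstOrderGenerator.exists_conjugationIdentity
    {G : SobolevSpace 1 →ₗ.[ℝ] SobolevSpace 1} (h : IsFirstOrderGenerator a b G) :
    ∃ B : SobolevSpace 1 →L[ℝ] SobolevSpace 1,
      ConjugationIdentity incl sqrtOneSub.toContinuousLinearEquiv G B ∧
        ‖B‖ ≤ 2 * (3 + besselSymbolNorm) * max ‖a.deriv‖ ‖b‖ := by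
  obtain ⟨r₀, hΓ⟩ := isQuasiSkewAdjoint_transport a b
  obtain ⟨B, hB, hconj⟩ := exists_conjugation_transport a b
  exact ⟨B, conjugationIdentity_of_graph_eq incl_injective hconj hΓ h.graph_eq, hB⟩

theorem _root_.IsFirstOrderGenerator.eq_transport {G : SobolevSpace 1 →ₗ.[ℝ] SobolevSpace 1}
    (h : IsFirstOrderGenerator a b G) {u : SobolevSpace 2} {f : SobolevSpace 1}
    (hf : (incl u, f) ∈ G.graph) : f = transport a b u :=
  G.mem_graph_snd_inj hf (h.graph_eq ▸ mk_mem_graphClosure _ _ u) rfl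

end

end SobolevSpace

end

/-! ### Verification of Kato's condition -/

theorem mainTheorem5 :
    ∃ Q : SobolevSpace 2 ≃ₗᵢ[ℝ] SobolevSpace 1, IsSqrtOneSubDerivSq Q ∧
    ∃ K : ℝ, 0 < K ∧
    ∀ (a : SobolevSpace 1 → SobolevSpace 3) (b : SobolevSpace 1 → SobolevSpace 2),
      (∃ L, LipschitzWith L a) → (∃ L, LipschitzWith L b) →
      (∃ M : ℝ, ∀ y, ‖a y‖ ≤ M) → (∃ M : ℝ, ∀ y, ‖b y‖ ≤ M) →
      (∀ y, ∃! G, IsFirstOrderGenerator (a y) (b y) G) ∧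
      ∀ A : SobolevSpace 1 → SobolevSpace 1 →ₗ.[ℝ] SobolevSpace 1,
        (∀ y, IsFirstOrderGenerator (a y) (b y) (A y)) →
        ∃ B : SobolevSpace 1 → SobolevSpace 1 →L[ℝ] SobolevSpace 1,
          (∀ y, ConjugationIdentity SobolevSpace.incl Q.toContinuousLinearEquiv (A y) (B y) ∧
            ‖B y‖ ≤ K * max ‖(a y).deriv‖ ‖b y‖) ∧
          ∀ R > 0, ∀ τ > 0,
            KatoCondition SobolevSpace.incl (Set.Icc (-τ) τ) R
              (fun _ v => A (SobolevSpace.incl v)) Q.toContinuousLinearEquiv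
              (fun _ v => B (SobolevSpace.incl v)) := by
  have hN := SobolevSpace.besselSymbolNorm_nonneg
  refine ⟨SobolevSpace.sqrtOneSub, SobolevSpace.isSqrtOneSubDerivSq_sqrtOneSub,
    2 * (3 + besselSymbolNorm), by positivity, ?_⟩
  rintro a b ⟨La, hLa⟩ ⟨Lb, hLb⟩ ⟨Ma, hMa⟩ ⟨Mb, hMb⟩
  refine ⟨fun y => SobolevSpace.existsUnique_isFirstOrderGenerator (a y) (b y), fun A hA => ?_⟩
  choose B hB using fun y => (hA y).exists_conjugationIdentity
  refine ⟨B, hB, fun R _ τ _ => ?_⟩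
  exact
    { injective := SobolevSpace.incl_injective
      denseRange := SobolevSpace.denseRange_incl
      generates := by
        choose U hU hG hb using fun y => (hA y).exists_group
        refine ⟨fun _ v s => U (SobolevSpace.incl v) (-s), fun t _ v =>
          ⟨(hU _).comp_neg.isC0Semigroup, (hG _).neg_isGeneratorOfSemigroup (hU _)⟩,
          -- This is `2β` with the suprema of the coefficient norms, hence independent of `v` and
          -- even of `R`.
          2 * (2 * Ma + 3 * Mb), fun t _ v _ s hs => (hb _ (-s)).trans ?_⟩
        rw [abs_neg, abs_of_nonneg hs]
        gcongr
        · exact hMa _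
        · exact hMb _
      conjugation := fun t _ v => (hB _).1
      stronglyMeasurable := fun v => stronglyMeasurable_const
      bounded := by
        refine ⟨2 * (3 + besselSymbolNorm) * max Ma Mb, fun t _ v _ => (hB _).2.trans ?_⟩
        gcongr
        · exact (SobolevSpace.norm_deriv_le _).trans (hMa _)
        · exact hMb _
      continuous := fun v => by
        refine ⟨fun _ => SobolevSpace.transport (a (SobolevSpace.incl v))
          (b (SobolevSpace.incl v)), fun t _ u => ?_, continuousOn_const⟩
        rw [(hA _).graph_eq]
        exact mk_mem_graphClosure _ _ u
      lipschitz := by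
        -- On `H²` both generators are given by the differential expression, so the difference has
        -- coefficients `a v₁ - a v₂` and `b v₁ - b v₂`; 3 is the constant of the product estimate
        -- in `H¹`.
        refine ⟨3 * (La + Lb), fun t _ u v₁ v₂ _ _ f₁ f₂ hf₁ hf₂ => ?_⟩
        rw [(hA _).eq_transport hf₁, (hA _).eq_transport hf₂]
        refine (SobolevSpace.norm_transport_sub_le _ _ _ _ u).trans ?_
        have h1 := hLa.norm_sub_le (SobolevSpace.incl v₁) (SobolevSpace.incl v₂)
        have h2 := hLb.norm_sub_le (SobolevSpace.incl v₁) (SobolevSpace.incl v₂)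
        gcongr ?_ * _
        linarith }
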